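/- A \emph{Hybrid instance of Berman--Karpinski type} $\mathcal H$ consists of $n\ge 1$ circles $\mathcal C^1,\dots,\mathcal C^n$ and of equations with three variables. Circle $\mathcal C^l$ carries the variables $x^l_1,\dots,x^l_{7t_l}$, where $t_l\ge 1$; the variables $x^l_7,x^l_{14},\dots,x^l_{7t_l}$ are its contact variables and all others are its checker variables. The equations of $\mathcal H$ are linear equations mod 2, namely: the circle equations $x^l_i\oplus x^l_{i+1}=0$ for $1\le i\le 7t_l-1$; the circle border equations $x^l_1\oplus x^l_{7t_l}=0$; the matching equations $x^l_i\oplus x^l_j=0$ for $\{i,j\}\in M^l$, where $M^l$ is a perfect matching on the checker variables of $\mathcal C^l$; and equations $x\oplus y\oplus z=c$ with $c\in\{0,1\}$ in three distinct contact variables, such that every contact variable occurs in exactly one of them. (So every variable occurs exactly three times; a matching equation between neighbours on a circle is counted separately from the circle equation.) Let $m_2$ and $m_3$ be the numbers of equations with exactly two and exactly three variables. The circles, the matchings and the equations are given explicitly. An instance $(V,d)$ of the $(1,B)$-ATSP problem is a finite asymmetric metric space ($d(v,v)=0$, triangle inequality, $d$ not necessarily symmetric) with $d(v,w)\in\{1,\dots,B\}$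 for all $v\ne w$. A tour $\sigma$ is a directed cycle that visits every vertex exactly once, and $\ell(\sigma)$ is the sum of the distances along its arcs. \textbf{Theorem.} (i) There is a polynomial-time algorithm that constructs from every Hybrid instance $\mathcal H$ of Berman--Karpinski type an instance $D_{\mathcal H}$ of the $(1,2)$-ATSP problem with the following properties. (a) If some assignment to the variables of $\mathcal H$ leaves at most $u$ equations unsatisfied, then $D_{\mathcal H}$ has a tour of length at most $3m_2+13m_3+n+1+u$. (b) There is a polynomial-time algorithm that computes from $\mathcal H$ and any tour $\sigma$ in $D_{\mathcal H}$ an assignment $\psi_\sigma$ to the variables of $\mathcal H$ such that, if the length of $\sigma$ is written as $\ell(\sigma)=3m_2+13m_3+n+1+u$ with $u\in\mathbb R$, then $\psi_\sigma$ leaves at most $u$ equations unsatisfied. (ii) There is a polynomial-time algorithm that constructs from every Hybrid instance $\mathcal H$ of Berman--Karpinski type an instance $(V_{\mathcal H},d_{\mathcal H})$ of the $(1,4)$-ATSP problem with the following properties. (a) If some assignment to the variables of $\mathcal H$ leaves at most $u$ equations unsatisfied, then $(V_{\mathcal H},d_{\mathcal H})$ has a tour of length at most $4m_2+20m_3+2n+2+2u$.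 (b) There is a polynomial-time algorithm that computes from $\mathcal H$ and any tour $\sigma$ in $(V_{\mathcal H},d_{\mathcal H})$ an assignment $\psi_\sigma$ to the variables of $\mathcal H$ such that, if the length of $\sigma$ is written as $\ell(\sigma)=4m_2+20m_3+2n+2+2u$ with $u\in\mathbb R$, then $\psi_\sigma$ leaves at most $u$ equations unsatisfied. (In particular, $u\ge 0$ for every tour in (i)(b) and (ii)(b).) -/

import Mathlib

namespace HybridATSP

/-! ### Polynomial time

While programs over binary trees (S-expressions). Every construct is charged for all the data that
it copies or inspects, so that a computed tree is never larger than the time used. -/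

/-- Binary trees, the only data type of the programs. -/
inductive Data where
  | nil : Data
  | cons : Data → Data → Data

namespace Data

/-- The number of nodes, leaves included. -/
def size : Data → ℕ
  | nil => 1
  | cons a b => size a + size b + 1

/-- The left subtree (`nil` for a leaf). -/
def head : Data → Data
  | nil => nil
  | cons a _ => a

/-- The right subtree (`nil` for a leaf). -/
def tail : Data → Data
  | nil => nil
  | cons _ b => b

end Data

/-- Programs; each one denotes a partial function from trees to trees. -/
inductive Prog where
  /-- return the input -/
  | id : Prog
  /-- return a leaf -/
  | nil : Prog
  /-- return the left subtree of the input -/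
  | head : Prog
  /-- return the right subtree of the input -/
  | tail : Prog
  /-- run both programs on the input and join the results -/
  | pair : Prog → Prog → Prog
  /-- run the first program, then the second one on the result -/
  | seq : Prog → Prog → Prog
  /-- run the second program if the first one returns a non-leaf, otherwise the third one -/
  | cond : Prog → Prog → Prog → Prog
  /-- as long as the first program returns a non-leaf, replace the input by the result of the
  second program -/
  | loop : Prog → Prog → Prog

/-- `p.Runs x y t`: on input `x` the program `p` halts with output `y` after time `t`. -/
inductive Prog.Runs : Prog → Data → Data → ℕ → Prop where
  | id (x : Data) : Runs Prog.id x x (x.size + 1)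
  | nil (x : Data) : Runs Prog.nil x Data.nil (x.size + 1)
  | head (x : Data) : Runs Prog.head x x.head (x.size + 1)
  | tail (x : Data) : Runs Prog.tail x x.tail (x.size + 1)
  | pair {p q : Prog} {x y z : Data} {s t : ℕ} : Runs p x y s → Runs q x z t →
      Runs (Prog.pair p q) x (Data.cons y z) (s + t + x.size + 1)
  | seq {p q : Prog} {x y z : Data} {s t : ℕ} : Runs p x y s → Runs q y z t →
      Runs (Prog.seq p q) x z (s + t + 1)
  | cond_true {c p q : Prog} {x a b y : Data} {s t : ℕ} : Runs c x (Data.cons a b) s →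
      Runs p x y t → Runs (Prog.cond c p q) x y (s + t + x.size + 1)
  | cond_false {c p q : Prog} {x y : Data} {s t : ℕ} : Runs c x Data.nil s →
      Runs q x y t → Runs (Prog.cond c p q) x y (s + t + x.size + 1)
  | loop_stop {c p : Prog} {x : Data} {s : ℕ} : Runs c x Data.nil s →
      Runs (Prog.loop c p) x x (s + x.size + 1)
  | loop_step {c p : Prog} {x a b y z : Data} {s t r : ℕ} : Runs c x (Data.cons a b) s →
      Runs p x y t → Runs (Prog.loop c p) y z r →
      Runs (Prog.loop c p) x z (s + t + r + x.size + 1)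

/-- Types whose elements are given to programs as trees. -/
class ToData (α : Type) where
  /-- the tree that represents an element -/
  toData : α → Data

/-- Unary numerals: all numbers that occur in the problem instances below are bounded by a
polynomial in the number of variables, respectively of vertices, of the instance. -/
instance : ToData ℕ where
  toData n := Nat.rec Data.nil (fun _ d => Data.cons Data.nil d) n

instance : ToData (ZMod 2) where
  toData a := ToData.toData a.val

instance {α β : Type} [ToData α] [ToData β] : ToData (α × β) where
  toData p := Data.cons (ToData.toData p.1) (ToData.toData p.2)

instance {α : Type} [ToData α] : ToData (List α) where
  toData l := l.foldr (fun a d => Data.cons (ToData.toData a) d) Data.nil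

/-- One program computes `f` on all inputs in `s`, in time polynomial in the size of the input. -/
def PolyTimeOn {α β : Type} [ToData α] [ToData β] (s : Set α) (f : α → β) : Prop :=
  ∃ (p : Prog) (T : Polynomial ℕ), ∀ a ∈ s,
    ∃ t : ℕ, t ≤ T.eval (ToData.toData a).size ∧
      p.Runs (ToData.toData a) (ToData.toData (f a)) t

/-! ### The Hybrid problem -/

/-- The variable `x^l_i` is the pair `(l, i)`; circles are numbered from `0`, the variables on a
circle from `1`. -/
abbrev Var : Type := ℕ × ℕ

/-- A linear equation mod 2: the sum of the listed variables equals the right-hand side. -/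
structure LinEq where
  vars : List Var
  rhs : ZMod 2

/-- The assignment `φ` satisfies the equation. -/
def LinEq.Sat (e : LinEq) (φ : Var → ZMod 2) : Prop := (e.vars.map φ).sum = e.rhs

instance (e : LinEq) (φ : Var → ZMod 2) : Decidable (e.Sat φ) :=
  inferInstanceAs (Decidable ((e.vars.map φ).sum = e.rhs))

/-- The data of a Hybrid instance that is made of circles. -/
structure HybridInstance where
  /-- the numbers `t_l`, one for each circle; circle `l` carries the variables
  `x^l_1, …, x^l_{7 t_l}` -/
  occ : List ℕ
  /-- the matching equations `x ⊕ y = 0` -/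
  matching : List (Var × Var)
  /-- the equations `x ⊕ y ⊕ z = c` with three variables -/
  triples : List (Var × Var × Var × ZMod 2)

instance : ToData HybridInstance where
  toData H := ToData.toData (H.occ, H.matching, H.triples)

namespace HybridInstance

variable (H : HybridInstance)

/-- The number `n` of circles. -/
def numCircles : ℕ := H.occ.length

/-- The number `7 t_l` of variables on circle `l`. -/
def circleSize (l : ℕ) : ℕ := 7 * H.occ.getD l 0

/-- All variables. -/
def vars : List Var :=
  (List.range H.numCircles).flatMap fun l => (List.range' 1 (H.circleSize l)).map fun i => (l, i)

/-- The contact variables `x^l_7, x^l_14, …, x^l_{7 t_l}`. -/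
def contacts : List Var := H.vars.filter fun x => 7 ∣ x.2

/-- The checker variables: all other variables. -/
def checkers : List Var := H.vars.filter fun x => ¬ 7 ∣ x.2

/-- The equations with two variables: the circle equations `x^l_i ⊕ x^l_{i+1} = 0` for
`1 ≤ i ≤ 7 t_l - 1`, the circle border equations `x^l_1 ⊕ x^l_{7 t_l} = 0`, and the matching
equations. -/
def twoVarEqs : List LinEq :=
  ((List.range H.numCircles).flatMap fun l =>
    (List.range' 1 (H.circleSize l - 1)).map fun i => ⟨[(l, i), (l, i + 1)], 0⟩) ++
  ((List.range H.numCircles).map fun l => ⟨[(l, 1), (l, H.circleSize l)], 0⟩) ++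
  H.matching.map fun e => ⟨[e.1, e.2], 0⟩

/-- The equations with three variables. -/
def threeVarEqs : List LinEq :=
  H.triples.map fun e => ⟨[e.1, e.2.1, e.2.2.1], e.2.2.2⟩

/-- The number `m₂` of equations with two variables. -/
def m₂ : ℕ := H.twoVarEqs.length

/-- The number `m₃` of equations with three variables. -/
def m₃ : ℕ := H.threeVarEqs.length

/-- The number of equations that the assignment `φ` leaves unsatisfied. -/
def numUnsat (φ : Var → ZMod 2) : ℕ :=
  (H.twoVarEqs ++ H.threeVarEqs).countP fun e => ¬ e.Sat φ

/-- The structure of the instances of Berman and Karpinski. -/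
structure IsBermanKarpinski : Prop where
  /-- there is at least one circle -/
  nonempty : H.occ ≠ []
  /-- no circle is empty -/
  occ_pos : ∀ t ∈ H.occ, 0 < t
  /-- a matching equation joins two variables of the same circle -/
  matching_circle : ∀ e ∈ H.matching, e.1.1 = e.2.1
  /-- the matching equations form a perfect matching on the checker variables -/
  matching_perfect : (H.matching.flatMap fun e => [e.1, e.2]).Perm H.checkers
  /-- the equations with three variables contain each contact variable exactly once, and no
  other variables -/
  triples_contacts : (H.triples.flatMap fun e => [e.1, e.2.1, e.2.2.1]).Perm H.contacts

end HybridInstance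

/-- The assignment that gives value `1` to exactly the listed variables. -/
def assignmentOf (S : List Var) : Var → ZMod 2 := fun x => if x ∈ S then 1 else 0

/-! ### The asymmetric traveling salesperson problem -/

/-- A distance function on the vertices `0, …, card - 1`; its other values are irrelevant. -/
structure ATSPInstance where
  card : ℕ
  dist : ℕ → ℕ → ℕ

/-- An instance is written down as its distance matrix. -/
instance : ToData ATSPInstance where
  toData D := ToData.toData
    ((List.range D.card).map fun v => (List.range D.card).map fun w => D.dist v w)

namespace ATSPInstance

variable (D : ATSPInstance)

/-- An instance of the `(1,B)`-ATSP problem: an asymmetric metric space whose nonzero distances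
belong to `{1, …, B}`. -/
structure IsOneB (B : ℕ) : Prop where
  dist_self : ∀ v < D.card, D.dist v v = 0
  one_le : ∀ v < D.card, ∀ w < D.card, v ≠ w → 1 ≤ D.dist v w
  le_bound : ∀ v < D.card, ∀ w < D.card, v ≠ w → D.dist v w ≤ B
  triangle : ∀ u < D.card, ∀ v < D.card, ∀ w < D.card,
    D.dist u w ≤ D.dist u v + D.dist v w

/-- A tour lists every vertex exactly once; it returns from the last vertex to the first one. -/
def IsTour (σ : List ℕ) : Prop := σ.Perm (List.range D.card)

/-- The length of a tour, the closing arc included. -/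
def tourLength (σ : List ℕ) : ℕ := (List.zipWith D.dist σ (σ.rotate 1)).sum

end ATSPInstance

end HybridATSP

open HybridATSP

namespace HybridATSP

/-! ### Closure properties of polynomial time -/

/-! A value is encoded as a direction of travel. Every variable `x` has a circle gadget, a path of
three vertices between `x` and its successor; value `1` means that the gadgets at `x` are run
through forward. Every matching equation and every contact variable has a parity gadget, again a
path of three vertices. For a matching equation in `x` and `y` it lies on the forward way at `x` and
on the backward way at `y`, so it is visited exactly once if and only if the two values agree. For
an equation with right-hand side `c` the gadget of a contact variable lies on its circle for value
`c`, and otherwise it is left to the core of the equation. A core can be crossed on short arcs with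
two or no gadgets, but not with one or three. The number of values different from `c` is even
exactly when the equation holds, because `3c = c` mod 2. The vertices `(8, l, 0)`, called hubs
below, string circles and cores together.

Short tours (`exists_tour`): on each circle the runs of value `0` are reversed in place (`arrange`).
Every change of value costs one jump, and so does every violated matching equation and every
violated parity at a core. `dist₂_le` and `dist₄_le` turn the number of jumps into both lengths.

Long tours: the length of an arc is split between its two ends, and `totalExcess` measures what a
tour pays above a flawless one (`sum_cost`). The ledger serves both metrics, which differ by a fixed
amount for the middle vertices of the gadgets (`cost_le_dist₂`, `cost_le_dist₄`). The excess is
shared out among the places where gadgets meet. A junction whose three gadgets disagree in direction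
pays at least 2 (`junction_bound`). A core with the wrong parity pays at least 2, since otherwise
the tour would close up inside the core (`core_lower_bound`).

Each variable receives the majority of the votes of its three gadgets, one for each of its three
equations, so at most one vote is lost at a junction, and only where the votes disagree
(`IsBermanKarpinski.numUnsat_le`). A gadget used by both its core and its circle may spoil the
parity at the core without cost there. Its junction pays 2 then, and reversing its vote repairs the
parity (`parity_repair`). Together the excess is at least twice the number of unsatisfied equations
(`IsTourPerm.two_mul_numUnsat_le`).

For the running times, all functions are assembled from operations closed under `PT`, the basic one
being a fold whose accumulator stays polynomially small. -/

instance : ToData Bool where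
  toData b := ToData.toData b.toNat

instance : ToData Unit where
  toData _ := Data.nil

/-- The size of the tree that represents an element. -/
def sz {α : Type} [ToData α] (a : α) : ℕ := (ToData.toData a).size

theorem Data.one_le_size (d : Data) : 1 ≤ d.size := by
  cases d <;> simp [Data.size]

theorem Data.size_head_le (d : Data) : d.head.size ≤ d.size := by
  cases d <;> simp [Data.size, Data.head]; omega

theorem Data.size_tail_le (d : Data) : d.tail.size ≤ d.size := by
  cases d <;> simp [Data.size, Data.tail]; omega

/-- A computed tree is not larger than the time used. -/
theorem Prog.Runs.size_le {p : Prog} {x y : Data} {t : ℕ} (h : p.Runs x y t) : y.size ≤ t := by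
  induction h with
  | id x => omega
  | nil x => simp [Data.size]
  | head x => have := x.size_head_le; omega
  | tail x => have := x.size_tail_le; omega
  | pair _ _ h1 h2 => have := Data.one_le_size; simp only [Data.size]; omega
  | seq _ _ _ h2 => omega
  | cond_true _ _ _ h2 => omega
  | cond_false _ _ _ h2 => omega
  | loop_stop _ _ => omega
  | loop_step _ _ _ _ _ h => omega

theorem eval_mono (T : Polynomial ℕ) {m n : ℕ} (h : m ≤ n) : T.eval m ≤ T.eval n := by
  induction T using Polynomial.induction_on' with
  | add p q hp hq => simp only [Polynomial.eval_add]; omega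
  | monomial k a =>
    simp only [Polynomial.eval_monomial]
    exact Nat.mul_le_mul_left _ (Nat.pow_le_pow_left h k)

section Size

variable {α β : Type} [ToData α] [ToData β]

theorem one_le_sz (a : α) : 1 ≤ sz a := Data.one_le_size _

theorem sz_pair (a : α) (b : β) : sz (a, b) = sz a + sz b + 1 := rfl

theorem sz_nil : sz ([] : List α) = 1 := rfl

theorem sz_cons (a : α) (l : List α) : sz (a :: l) = sz a + sz l + 1 := rfl

theorem sz_nat (n : ℕ) : sz n = 2 * n + 1 := by
  induction n with
  | zero => rfl
  | succ n ih =>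
    have h : sz (n + 1) = 1 + sz n + 1 := rfl
    omega

theorem sz_append (l l' : List α) : sz (l ++ l') + 1 = sz l + sz l' := by
  induction l with
  | nil => simp [sz_nil]; omega
  | cons a l ih => simp only [List.cons_append, sz_cons]; omega

theorem sz_prefix_le {l' l : List α} (h : l' <+: l) : sz l' ≤ sz l := by
  obtain ⟨m, rfl⟩ := h
  have := sz_append l' m
  have := one_le_sz m
  omega

theorem sz_suffix_le {l' l : List α} (h : l' <:+ l) : sz l' ≤ sz l := by
  obtain ⟨m, rfl⟩ := h
  have := sz_append m l'
  have := one_le_sz m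
  omega

theorem sz_mem_le {a : α} {l : List α} (h : a ∈ l) : sz a + 2 ≤ sz l := by
  induction l with
  | nil => simp at h
  | cons b l ih =>
    rcases List.mem_cons.1 h with rfl | h
    · have := one_le_sz l
      simp only [sz_cons]; omega
    · have := ih h
      simp only [sz_cons]; omega

theorem sz_reverse (l : List α) : sz l.reverse = sz l := by
  induction l with
  | nil => rfl
  | cons a l ih =>
    have := sz_append l.reverse [a]
    simp only [List.reverse_cons, sz_cons, sz_nil] at *
    omega

theorem length_le_sz (l : List α) : l.length ≤ sz l := by
  induction l with
  | nil => simp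
  | cons a l ih => simp only [List.length_cons, sz_cons]; omega

theorem sz_le_of_forall {l : List α} {A : ℕ} (h : ∀ a ∈ l, sz a ≤ A) :
    sz l ≤ l.length * (A + 1) + 1 := by
  induction l with
  | nil => simp [sz_nil]
  | cons a l ih =>
    have h1 := h a (by simp)
    have h2 := ih fun b hb => h b (by simp [hb])
    simp only [List.length_cons, sz_cons, Nat.succ_mul]
    omega

end Size

/-- One program computes `f` on all inputs in polynomial time. -/
def PT {α β : Type} [ToData α] [ToData β] (f : α → β) : Prop :=
  ∃ (p : Prog) (T : Polynomial ℕ), ∀ a, ∃ t, t ≤ T.eval (sz a) ∧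
    p.Runs (ToData.toData a) (ToData.toData (f a)) t

namespace PT

variable {α β γ δ : Type} [ToData α] [ToData β] [ToData γ] [ToData δ]

theorem polyTimeOn {f : α → β} (h : PT f) (s : Set α) : PolyTimeOn s f := by
  obtain ⟨p, T, h⟩ := h
  exact ⟨p, T, fun a _ => h a⟩

theorem sz_le {f : α → β} (h : PT f) : ∃ T : Polynomial ℕ, ∀ a, sz (f a) ≤ T.eval (sz a) := by
  obtain ⟨p, T, h⟩ := h
  refine ⟨T, fun a => ?_⟩
  obtain ⟨t, ht, hr⟩ := h a
  exact hr.size_le.trans ht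

/-- A function that does not change the representing tree. -/
theorem of_eq {f : α → β} (h : ∀ a, ToData.toData (f a) = ToData.toData a) : PT f := by
  refine ⟨Prog.id, Polynomial.X + 1, fun a => ⟨sz a + 1, by simp, ?_⟩⟩
  rw [h a]
  exact Prog.Runs.id _

theorem id : PT (fun a : α => a) := of_eq fun _ => rfl

theorem of_head {f : α → β} (h : ∀ a, ToData.toData (f a) = (ToData.toData a).head) : PT f := by
  refine ⟨Prog.head, Polynomial.X + 1, fun a => ⟨sz a + 1, by simp, ?_⟩⟩
  rw [h a]
  exact Prog.Runs.head _

theorem of_tail {f : α → β} (h : ∀ a, ToData.toData (f a) = (ToData.toData a).tail) : PT f := by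
  refine ⟨Prog.tail, Polynomial.X + 1, fun a => ⟨sz a + 1, by simp, ?_⟩⟩
  rw [h a]
  exact Prog.Runs.tail _

theorem comp {g : β → γ} {f : α → β} (hg : PT g) (hf : PT f) : PT (fun a => g (f a)) := by
  obtain ⟨p, T, hp⟩ := hf
  obtain ⟨q, S, hq⟩ := hg
  refine ⟨Prog.seq p q, T + S.comp T + 1, fun a => ?_⟩
  obtain ⟨t, ht, hr⟩ := hp a
  obtain ⟨s, hs, hr'⟩ := hq (f a)
  refine ⟨_, ?_, hr.seq hr'⟩
  have := eval_mono S (hr.size_le.trans ht)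
  simp only [Polynomial.eval_add, Polynomial.eval_comp, Polynomial.eval_one]
  unfold sz at *
  omega

theorem pair {f : α → β} {g : α → γ} (hf : PT f) (hg : PT g) : PT (fun a => (f a, g a)) := by
  obtain ⟨p, T, hp⟩ := hf
  obtain ⟨q, S, hq⟩ := hg
  refine ⟨Prog.pair p q, T + S + Polynomial.X + 1, fun a => ?_⟩
  obtain ⟨t, ht, hr⟩ := hp a
  obtain ⟨s, hs, hr'⟩ := hq a
  refine ⟨_, ?_, hr.pair hr'⟩
  simp only [Polynomial.eval_add, Polynomial.eval_X, Polynomial.eval_one]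
  unfold sz at *
  omega

theorem fst {f : α → β × γ} (hf : PT f) : PT (fun a => (f a).1) :=
  comp (g := Prod.fst) (of_head fun _ => rfl) hf

theorem snd {f : α → β × γ} (hf : PT f) : PT (fun a => (f a).2) :=
  comp (g := Prod.snd) (of_tail fun _ => rfl) hf

theorem const (b : β) : PT (fun _ : α => b) := by
  suffices h : ∀ d : Data, ∃ (p : Prog) (T : Polynomial ℕ), ∀ a : α, ∃ t, t ≤ T.eval (sz a) ∧
      p.Runs (ToData.toData a) d t from h _
  intro d
  induction d with
  | nil => exact ⟨Prog.nil, Polynomial.X + 1, fun a => ⟨_, by simp [sz], Prog.Runs.nil _⟩⟩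
  | cons x y hx hy =>
    obtain ⟨p, T, hp⟩ := hx
    obtain ⟨q, S, hq⟩ := hy
    refine ⟨Prog.pair p q, T + S + Polynomial.X + 1, fun a => ?_⟩
    obtain ⟨t, ht, hr⟩ := hp a
    obtain ⟨s, hs, hr'⟩ := hq a
    refine ⟨_, ?_, hr.pair hr'⟩
    simp only [Polynomial.eval_add, Polynomial.eval_X, Polynomial.eval_one]
    unfold sz at *
    omega

/-- `false` and the empty list are both represented by a leaf, so one branching rule covers tests on
Booleans and on lists. -/
theorem cond_aux {f g h : α → β} {c : α → γ} (hc : PT c) (hf : PT f) (hg : PT g)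
    (h1 : ∀ a, ToData.toData (c a) = Data.nil → h a = g a)
    (h2 : ∀ a, ToData.toData (c a) ≠ Data.nil → h a = f a) : PT h := by
  obtain ⟨p, T, hp⟩ := hf
  obtain ⟨q, S, hq⟩ := hg
  obtain ⟨r, R, hr⟩ := hc
  refine ⟨Prog.cond r p q, T + S + R + Polynomial.X + 1, fun a => ?_⟩
  obtain ⟨t, ht, hp⟩ := hp a
  obtain ⟨s, hs, hq⟩ := hq a
  obtain ⟨u, hu, hr⟩ := hr a
  simp only [Polynomial.eval_add, Polynomial.eval_X, Polynomial.eval_one]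
  rcases hd : ToData.toData (c a) with _ | ⟨x, y⟩
  · rw [h1 a hd]
    rw [hd] at hr
    exact ⟨_, by unfold sz at *; omega, Prog.Runs.cond_false hr hq⟩
  · rw [h2 a (by rw [hd]; simp)]
    rw [hd] at hr
    exact ⟨_, by unfold sz at *; omega, Prog.Runs.cond_true hr hp⟩

/-- The condition is a Boolean; this is why the definitions of the construction branch on `decide`.
-/
theorem ite {c : α → Bool} {f g : α → β} (hc : PT c) (hf : PT f) (hg : PT g) :
    PT (fun a => if c a then f a else g a) := by
  refine cond_aux hc hf hg ?_ ?_ <;> intro a h <;> cases hca : c a <;> simp [hca] at h ⊢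
  · exact absurd h (by simp [ToData.toData])
  · exact absurd rfl h

/-- Case distinction on a list being empty. -/
theorem ite_isEmpty {c : α → List γ} {f g : α → β} (hc : PT c) (hf : PT f) (hg : PT g) :
    PT (fun a => if (c a).isEmpty then f a else g a) := by
  refine cond_aux hc hg hf ?_ ?_ <;> intro a h <;> cases hca : c a <;>
    simp [hca, ToData.toData] at h ⊢

/-- The states `s 0, …, s k` of the loop are prescribed. A round pays for the test, the body and the
inspected state, each at most `A`, and 1 for itself. -/
theorem _root_.HybridATSP.loop_runs {c p : Prog} (A : ℕ) (k : ℕ) (s : ℕ → Data)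
    (hs : ∀ i, (s i).size ≤ A)
    (hc : ∀ i < k, ∃ a b t, t ≤ A ∧ c.Runs (s i) (Data.cons a b) t)
    (hp : ∀ i < k, ∃ t, t ≤ A ∧ p.Runs (s i) (s (i + 1)) t)
    (hk : ∃ t, t ≤ A ∧ c.Runs (s k) Data.nil t) :
    ∃ t, t ≤ (k + 1) * (3 * A + 1) ∧ (Prog.loop c p).Runs (s 0) (s k) t := by
  induction k generalizing s with
  | zero =>
    obtain ⟨t, ht, hr⟩ := hk
    exact ⟨_, by have := hs 0; omega, Prog.Runs.loop_stop hr⟩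
  | succ k ih =>
    obtain ⟨r, hr, hrr⟩ := ih (fun i => s (i + 1)) (fun i => hs _)
      (fun i hi => hc (i + 1) (by omega)) (fun i hi => hp (i + 1) (by omega)) hk
    obtain ⟨a, b, t, ht, h1⟩ := hc 0 (by omega)
    obtain ⟨u, hu, h2⟩ := hp 0 (by omega)
    refine ⟨_, ?_, Prog.Runs.loop_step h1 h2 hrr⟩
    have := hs 0
    rw [Nat.succ_mul (k + 1)]
    omega

/-- The only form of recursion that is used. A bound on all intermediate accumulators is
indispensable, since a fold of polynomial-time steps can produce trees of exponential size. -/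
theorem foldl {f : α → β → γ → β} {i : α → β} {l : α → List γ}
    (hf : PT (fun p : (α × β) × γ => f p.1.1 p.1.2 p.2)) (hi : PT i) (hl : PT l)
    (B : Polynomial ℕ)
    (hB : ∀ a l', l' <+: l a → sz (l'.foldl (f a) (i a)) ≤ B.eval (sz a)) :
    PT (fun a => (l a).foldl (f a) (i a)) := by
  obtain ⟨L, hL⟩ := hl.sz_le
  obtain ⟨q, Q, hq⟩ := pair (pair id hi) hl
  obtain ⟨p, T, hp⟩ := hf
  -- The state of the loop is the tree of `((a, acc), rest)`. Its tail is a leaf exactly when `rest`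
  -- is empty, so `Prog.tail` serves as the test.
  let hh : Prog := Prog.seq Prog.head Prog.head
  let body : Prog := Prog.pair
    (Prog.pair hh (Prog.seq (Prog.pair (Prog.pair hh (Prog.seq Prog.head Prog.tail))
      (Prog.seq Prog.tail Prog.head)) p)) (Prog.seq Prog.tail Prog.tail)
  -- `S` bounds the size of a state and `A` the time of a test or of a body; the 30 generously
  -- covers the copies of the state made by the projections.
  let S : Polynomial ℕ := Polynomial.X + B + L + 2
  let A : Polynomial ℕ := T.comp S + Polynomial.C 30 * S + 30
  refine ⟨Prog.seq q (Prog.seq (Prog.loop Prog.tail body) (Prog.seq Prog.head Prog.tail)),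
    Q + (L + 1) * (3 * A + 1) + 2 * S + 6, fun a => ?_⟩
  obtain ⟨t1, ht1, hr1⟩ := hq a
  let s : ℕ → Data := fun j =>
    ToData.toData ((a, ((l a).take j).foldl (f a) (i a)), (l a).drop j)
  have hS : ∀ j, (s j).size ≤ S.eval (sz a) := by
    intro j
    have h1 := hB a _ (List.take_prefix j (l a))
    have h2 := (sz_suffix_le (List.drop_suffix j (l a))).trans (hL a)
    have h3 : (s j).size = sz a + sz (((l a).take j).foldl (f a) (i a)) + 1 +
      sz ((l a).drop j) + 1 := rfl
    simp only [S, Polynomial.eval_add, Polynomial.eval_X, Polynomial.eval_ofNat]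
    omega
  have hA : A.eval (sz a) = T.eval (S.eval (sz a)) + 30 * S.eval (sz a) + 30 := by
    simp [A]
  have hlen : (l a).length ≤ L.eval (sz a) := (length_le_sz _).trans (hL a)
  obtain ⟨t2, ht2, hr2⟩ := loop_runs (c := Prog.tail) (p := body) (A.eval (sz a)) (l a).length s
    (fun j => by have := hS j; omega)
    (fun j hj => by
      have h := Prog.Runs.tail (s j)
      have h' : (s j).tail = ToData.toData ((l a).drop j) := rfl
      rw [h', List.drop_eq_getElem_cons hj] at h
      exact ⟨_, _, _, by have := hS j; omega, h⟩)
    (fun j hj => by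
      set acc := ((l a).take j).foldl (f a) (i a) with hacc
      obtain ⟨t, ht, hr⟩ := hp ((a, acc), (l a)[j])
      have e0 : s j = Data.cons (Data.cons (ToData.toData a) (ToData.toData acc))
          (Data.cons (ToData.toData (l a)[j]) (ToData.toData ((l a).drop (j + 1)))) := by
        simp only [s]
        rw [List.drop_eq_getElem_cons hj]
        rfl
      have e1 : s (j + 1) = Data.cons (Data.cons (ToData.toData a)
          (ToData.toData (f a acc (l a)[j]))) (ToData.toData ((l a).drop (j + 1))) := by
        simp only [s, acc]
        rw [← List.take_append_getElem hj, List.foldl_append]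
        rfl
      have hSj := hS j
      rw [e0] at hSj ⊢
      rw [e1]
      have hhr := (Prog.Runs.head (Data.cons (Data.cons (ToData.toData a) (ToData.toData acc))
          (Data.cons (ToData.toData (l a)[j]) (ToData.toData ((l a).drop (j + 1)))))).seq
          (Prog.Runs.head _)
      have hht := (Prog.Runs.head (Data.cons (Data.cons (ToData.toData a) (ToData.toData acc))
          (Data.cons (ToData.toData (l a)[j]) (ToData.toData ((l a).drop (j + 1)))))).seq
          (Prog.Runs.tail _)
      have hth := (Prog.Runs.tail (Data.cons (Data.cons (ToData.toData a) (ToData.toData acc))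
          (Data.cons (ToData.toData (l a)[j]) (ToData.toData ((l a).drop (j + 1)))))).seq
          (Prog.Runs.head _)
      have htt := (Prog.Runs.tail (Data.cons (Data.cons (ToData.toData a) (ToData.toData acc))
          (Data.cons (ToData.toData (l a)[j]) (ToData.toData ((l a).drop (j + 1)))))).seq
          (Prog.Runs.tail _)
      refine ⟨_, ?_, (hhr.pair (((hhr.pair hht).pair hth).seq hr)).pair htt⟩
      have hT := eval_mono T (m := sz ((a, acc), (l a)[j])) (n := S.eval (sz a)) (by
        simp only [sz_pair]
        simp only [Data.size] at hSj
        unfold sz at *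
        omega)
      simp only [Data.size, Data.head, Data.tail] at hSj ⊢
      omega)
    (by
      have h := Prog.Runs.tail (s (l a).length)
      have h' : (s (l a).length).tail = ToData.toData ((l a).drop (l a).length) := rfl
      rw [h', List.drop_length] at h
      exact ⟨_, by have := hS (l a).length; omega, h⟩)
  have e0 : s 0 = ToData.toData ((a, i a), l a) := rfl
  have e1 : ToData.toData ((l a).foldl (f a) (i a)) = (s (l a).length).head.tail := by
    simp only [s, List.take_length]
    rfl
  rw [e1]
  rw [e0] at hr2
  refine ⟨_, ?_, hr1.seq (hr2.seq ((Prog.Runs.head _).seq (Prog.Runs.tail _)))⟩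
  have h3 := hS (l a).length
  have h4 := (s (l a).length).size_head_le
  have h5 : ((l a).length + 1) * (3 * A.eval (sz a) + 1) ≤
    (L.eval (sz a) + 1) * (3 * A.eval (sz a) + 1) := Nat.mul_le_mul_right _ (by omega)
  simp only [Polynomial.eval_add, Polynomial.eval_mul, Polynomial.eval_ofNat,
    Polynomial.eval_one]
  omega

theorem cons {f : α → β} {l : α → List β} (hf : PT f) (hl : PT l) :
    PT (fun a => f a :: l a) :=
  comp (g := fun p : β × List β => p.1 :: p.2) (of_eq fun _ => rfl) (pair hf hl)

theorem singleton {f : α → β} (hf : PT f) : PT (fun a => [f a]) := cons hf (const [])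

/-- A fold that puts elements in front of an accumulator reverses their order, so this is the
natural primitive; `reverse` and `append` follow from it. -/
theorem revAppend {l m : α → List β} (hl : PT l) (hm : PT m) :
    PT (fun a => (l a).reverse ++ m a) := by
  obtain ⟨L, hL⟩ := hl.sz_le
  obtain ⟨M, hM⟩ := hm.sz_le
  have e : ∀ (l m : List β), l.foldl (fun acc x => x :: acc) m = l.reverse ++ m := by
    intro l
    induction l with
    | nil => simp
    | cons a l ih => intro m; simp [ih]
  have := foldl (f := fun (_ : α) (acc : List β) x => x :: acc) (cons (snd id) (snd (fst id)))
    hm hl (L + M) (fun a l' h => by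
      rw [e]
      have h1 := sz_append l'.reverse (m a)
      rw [sz_reverse] at h1
      have h2 := sz_prefix_le h
      have := hL a
      have := hM a
      simp only [Polynomial.eval_add]
      omega)
  simpa only [e] using this

theorem reverse {l : α → List β} (hl : PT l) : PT (fun a => (l a).reverse) := by
  simpa using revAppend hl (const [])

theorem append {l m : α → List β} (hl : PT l) (hm : PT m) : PT (fun a => l a ++ m a) := by
  simpa using revAppend (reverse hl) hm

theorem map {f : α → β → γ} {l : α → List β} (hf : PT (fun p : α × β => f p.1 p.2))
    (hl : PT l) : PT (fun a => (l a).map (f a)) := by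
  obtain ⟨L, hL⟩ := hl.sz_le
  obtain ⟨F, hF⟩ := hf.sz_le
  have e : ∀ (a : α) (l : List β) (acc : List γ),
      l.foldl (fun acc x => f a x :: acc) acc = (l.map (f a)).reverse ++ acc := by
    intro a l
    induction l with
    | nil => simp
    | cons b l ih => intro acc; simp [ih]
  have := foldl (f := fun (a : α) (acc : List γ) x => f a x :: acc) (i := fun _ => []) (l := l)
    (cons (comp hf (pair (fst (fst id)) (snd id))) (snd (fst id))) (const []) hl
    (L * (F.comp (Polynomial.X + L + 1) + 1) + 1) (fun a l' h => by
      rw [e, List.append_nil, sz_reverse]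
      have h2 : sz l' ≤ L.eval (sz a) := (sz_prefix_le h).trans (hL a)
      refine (sz_le_of_forall (A := F.eval (sz a + L.eval (sz a) + 1)) fun c hc => ?_).trans ?_
      · obtain ⟨b, hb, rfl⟩ := List.mem_map.1 hc
        refine (hF (a, b)).trans (eval_mono _ ?_)
        have := sz_mem_le hb
        simp only [sz_pair]
        omega
      · have h3 := (length_le_sz l').trans h2
        simp only [List.length_map, Polynomial.eval_add, Polynomial.eval_mul,
          Polynomial.eval_comp, Polynomial.eval_X, Polynomial.eval_one]
        exact Nat.add_le_add_right (Nat.mul_le_mul_right _ h3) 1)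
  simp only [e, List.append_nil] at this
  simpa using reverse this

theorem flatten {l : α → List (List β)} (hl : PT l) : PT (fun a => (l a).flatten) := by
  obtain ⟨L, hL⟩ := hl.sz_le
  have e : ∀ (l : List (List β)) (acc : List β),
      l.foldl (fun acc x => x.reverse ++ acc) acc = l.flatten.reverse ++ acc := by
    intro l
    induction l with
    | nil => simp
    | cons b l ih => intro acc; simp [ih]
  have hs : ∀ l : List (List β), sz l.flatten ≤ sz l := by
    intro l
    induction l with
    | nil => simp [sz_nil]
    | cons b l ih =>
      have := sz_append b l.flatten
      simp only [List.flatten_cons, sz_cons]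
      omega
  have := foldl (f := fun (_ : α) (acc : List β) x => x.reverse ++ acc) (i := fun _ => [])
    (revAppend (snd id) (snd (fst id))) (const []) hl L (fun a l' h => by
      rw [e, List.append_nil, sz_reverse]
      exact ((hs l').trans (sz_prefix_le h)).trans (hL a))
  simp only [e, List.append_nil] at this
  simpa using reverse this

theorem flatMap {f : α → β → List γ} {l : α → List β} (hf : PT (fun p : α × β => f p.1 p.2))
    (hl : PT l) : PT (fun a => (l a).flatMap (f a)) := by
  simpa only [List.flatMap_def] using flatten (map hf hl)

theorem filter {f : α → β → Bool} {l : α → List β} (hf : PT (fun p : α × β => f p.1 p.2))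
    (hl : PT l) : PT (fun a => (l a).filter (f a)) := by
  have e : ∀ a, (l a).filter (f a) = (l a).flatMap fun b => if f a b then [b] else [] := by
    intro a
    induction l a with
    | nil => rfl
    | cons b l ih => by_cases h : f a b <;> simp [h, ih]
  simp only [e]
  exact flatMap (f := fun a b => if f a b then [b] else []) (ite hf (singleton (snd id)) (const []))
    hl

theorem any {f : α → β → Bool} {l : α → List β} (hf : PT (fun p : α × β => f p.1 p.2))
    (hl : PT l) : PT (fun a => (l a).any (f a)) := by
  have e : ∀ a, (l a).any (f a) = if ((l a).filter (f a)).isEmpty then false else true := by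
    intro a
    induction l a with
    | nil => rfl
    | cons b l ih =>
      rw [List.any_cons, ih, List.filter_cons]
      by_cases h : f a b <;> simp only [h] <;> simp
  simp only [e]
  exact ite_isEmpty (filter hf hl) (const _) (const _)

theorem and {f g : α → Bool} (hf : PT f) (hg : PT g) : PT (fun a => f a && g a) := by
  have e : ∀ a, (f a && g a) = if f a then g a else false := by
    intro a; cases f a <;> rfl
  simp only [e]
  exact ite hf hg (const _)

theorem or {f g : α → Bool} (hf : PT f) (hg : PT g) : PT (fun a => f a || g a) := by
  have e : ∀ a, (f a || g a) = if f a then true else g a := by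
    intro a; cases f a <;> rfl
  simp only [e]
  exact ite hf (const _) hg

theorem not {f : α → Bool} (hf : PT f) : PT (fun a => !f a) := by
  have e : ∀ a, (!f a) = if f a then false else true := by
    intro a; cases f a <;> rfl
  simp only [e]
  exact ite hf (const _) (const _)

theorem toNat {f : α → Bool} (hf : PT f) : PT (fun a => (f a).toNat) :=
  comp (g := Bool.toNat) (of_eq fun _ => rfl) hf

/-- A unary numeral and a list of units are the same tree, so arithmetic is reduced to operations on
lists. -/
theorem _root_.HybridATSP.toData_replicate (n : ℕ) :
    ToData.toData (List.replicate n ()) = ToData.toData n := by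
  induction n with
  | zero => rfl
  | succ n ih =>
    have h : ToData.toData (n + 1) = Data.cons Data.nil (ToData.toData n) := rfl
    rw [h, ← ih]
    rfl

theorem replicate {f : α → ℕ} (hf : PT f) : PT (fun a => List.replicate (f a) ()) :=
  comp (g := fun n => List.replicate n ()) (of_eq toData_replicate) hf

theorem length {l : α → List β} (hl : PT l) : PT (fun a => (l a).length) := by
  have e : ∀ a, (l a).length = ((l a).map fun _ => ()).length := by simp
  simp only [e]
  exact comp (g := fun l : List Unit => l.length)
    (of_eq fun l => by
      rw [← toData_replicate]
      congr 1
      exact (List.eq_replicate_of_mem (fun _ _ => rfl)).symm)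
    (map (f := fun _ _ => ()) (const _) hl)

theorem add {f g : α → ℕ} (hf : PT f) (hg : PT g) : PT (fun a => f a + g a) := by
  have e : ∀ a, f a + g a = (List.replicate (f a) () ++ List.replicate (g a) ()).length := by simp
  simp only [e]
  exact length (append (replicate hf) (replicate hg))

theorem pred {f : α → ℕ} (hf : PT f) : PT (fun a => f a - 1) :=
  comp (g := fun n => n - 1) (of_tail fun n => by cases n <;> rfl) hf

theorem sub {f g : α → ℕ} (hf : PT f) (hg : PT g) : PT (fun a => f a - g a) := by
  obtain ⟨F, hF⟩ := hf.sz_le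
  have e : ∀ (l : List Unit) (n : ℕ), l.foldl (fun acc _ => acc - 1) n = n - l.length := by
    intro l
    induction l with
    | nil => simp
    | cons b l ih => intro n; simp only [List.foldl_cons, ih, List.length_cons]; omega
  have := foldl (f := fun (_ : α) (acc : ℕ) (_ : Unit) => acc - 1) (pred (snd (fst id))) hf
    (replicate hg) F (fun a l' _ => by
      rw [e]
      have := hF a
      simp only [sz_nat] at *
      omega)
  simpa only [e, List.length_replicate] using this

theorem decLe {f g : α → ℕ} (hf : PT f) (hg : PT g) : PT (fun a => decide (f a ≤ g a)) := by
  have e : ∀ a, decide (f a ≤ g a) =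
      if (List.replicate (f a - g a) ()).isEmpty then true else false := by
    intro a
    by_cases h : f a ≤ g a
    · simp [Nat.sub_eq_zero_of_le h, h]
    · have : f a - g a ≠ 0 := by omega
      simp [h, this]
  simp only [e]
  exact ite_isEmpty (replicate (sub hf hg)) (const _) (const _)

/-- Types with polynomial-time equality test. -/
class _root_.HybridATSP.PTEq (α : Type) [ToData α] [DecidableEq α] : Prop where
  pt : PT (fun p : α × α => decide (p.1 = p.2))

theorem decEq [DecidableEq β] [PTEq β] {f g : α → β} (hf : PT f) (hg : PT g) :
    PT (fun a => decide (f a = g a)) := comp PTEq.pt (pair hf hg)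

instance : PTEq ℕ where
  pt := by
    have e : ∀ p : ℕ × ℕ, decide (p.1 = p.2) = (decide (p.1 ≤ p.2) && decide (p.2 ≤ p.1)) := by
      intro p
      rw [← Bool.decide_and]
      congr 1
      rw [eq_iff_iff]
      omega
    simp only [e]
    exact and (decLe (fst id) (snd id)) (decLe (snd id) (fst id))

instance [DecidableEq α] [DecidableEq β] [PTEq α] [PTEq β] : PTEq (α × β) where
  pt := by
    have e : ∀ p : (α × β) × (α × β), decide (p.1 = p.2) =
        (decide (p.1.1 = p.2.1) && decide (p.1.2 = p.2.2)) := by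
      intro p
      rw [← Bool.decide_and]
      congr 1
      rw [eq_iff_iff, Prod.ext_iff]
    simp only [e]
    exact and (decEq (fst (fst id)) (fst (snd id))) (decEq (snd (fst id)) (snd (snd id)))

theorem mem [DecidableEq β] [PTEq β] {f : α → β} {l : α → List β}
    {_ : ∀ a, Decidable (f a ∈ l a)} (hf : PT f) (hl : PT l) :
    PT (fun a => decide (f a ∈ l a)) := by
  have e : ∀ a, decide (f a ∈ l a) = (l a).any fun b => decide (b = f a) := by
    intro a
    rw [Bool.eq_iff_iff]
    simp
  simp only [e]
  exact any (f := fun a b => decide (b = f a)) (decEq (snd id) (comp hf (fst id))) hl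

theorem range {f : α → ℕ} (hf : PT f) : PT (fun a => List.range (f a)) := by
  obtain ⟨F, hF⟩ := hf.sz_le
  have e : ∀ n : ℕ, (List.replicate n ()).foldl (fun (acc : List ℕ) _ => acc.length :: acc) [] =
      (List.range n).reverse := by
    intro n
    induction n with
    | zero => rfl
    | succ n ih => rw [List.replicate_succ', List.foldl_append, ih, List.range_succ]; simp
  have := foldl (f := fun (_ : α) (acc : List ℕ) (_ : Unit) => acc.length :: acc)
    (i := fun _ => []) (cons (length (snd (fst id))) (snd (fst id))) (const []) (replicate hf)
    (F * (F + 1) + 1) (fun a l' h => by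
      obtain ⟨n, rfl⟩ : ∃ n, l' = List.replicate n () :=
        ⟨_, List.eq_replicate_of_mem (fun _ _ => rfl)⟩
      have hn : n ≤ f a := by simpa using h.length_le
      have h1 := hF a
      rw [sz_nat] at h1
      rw [e, sz_reverse]
      refine (sz_le_of_forall (A := F.eval (sz a)) fun c hc => ?_).trans ?_
      · have := List.mem_range.1 hc
        rw [sz_nat]
        omega
      · simp only [List.length_range, Polynomial.eval_add, Polynomial.eval_mul,
          Polynomial.eval_one]
        exact Nat.add_le_add_right (Nat.mul_le_mul_right _ (by omega)) 1)
  simp only [e] at this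
  simpa using reverse this

theorem drop {f : α → ℕ} {l : α → List β} (hf : PT f) (hl : PT l) :
    PT (fun a => (l a).drop (f a)) := by
  obtain ⟨L, hL⟩ := hl.sz_le
  have e : ∀ (u : List Unit) (l : List β),
      u.foldl (fun acc _ => acc.tail) l = l.drop u.length := by
    intro u
    induction u with
    | nil => simp
    | cons b u ih => intro l; simp only [List.foldl_cons, ih, List.length_cons]; cases l <;> simp
  have := foldl (f := fun (_ : α) (acc : List β) (_ : Unit) => acc.tail)
    (comp (g := List.tail) (of_tail fun l => by cases l <;> rfl) (snd (fst id))) hl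
    (replicate hf) L (fun a l' _ => by
      rw [e]
      exact (sz_suffix_le (List.drop_suffix _ _)).trans (hL a))
  simpa only [e, List.length_replicate] using this

/-- The default is appended at the end before the head is taken, so that the head exists in both
cases and no test is needed. -/
theorem getD {f : α → ℕ} {l : α → List β} (hf : PT f) (hl : PT l) (d : β) :
    PT (fun a => (l a).getD (f a) d) := by
  have e : ∀ a, (l a).getD (f a) d = ((l a).drop (f a) ++ [d]).headD d := by
    intro a
    by_cases h : f a < (l a).length
    · rw [List.drop_eq_getElem_cons h]; simp [h]
    · simp [Nat.not_lt.1 h]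
  simp only [e]
  obtain ⟨p, T, hp⟩ := append (drop hf hl) (const [d])
  refine ⟨Prog.seq p Prog.head, T + T + 2, fun a => ?_⟩
  obtain ⟨t, ht, hr⟩ := hp a
  have h := hr.seq (Prog.Runs.head _)
  have h' : ∀ m : List β, (ToData.toData (m ++ [d])).head = ToData.toData ((m ++ [d]).headD d) := by
    intro m; cases m <;> rfl
  rw [h'] at h
  refine ⟨_, ?_, h⟩
  have h2 := hr.size_le
  simp only [Polynomial.eval_add, Polynomial.eval_ofNat]
  simp only at h2
  omega

end PT

/-! ### The construction -/

/-- Names of the vertices: kinds `0, 1, 2` form the path of a circle gadget, kinds `3, 4, 5` the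
path of a parity gadget, kinds `6` and `7` are the vertices of the cores of the equations with three
variables, and kind `8` stands for the vertices between the circles. -/
abbrev Label : Type := ℕ × Var

/-- An equation with three variables. -/
abbrev Triple : Type := Var × Var × Var × ZMod 2

/-- The vertex where a circle enters the parity gadget `p`. -/
def pin (b : Bool) (p : Var) : Label := if b then (3, p) else (5, p)

/-- The vertex where a circle leaves the parity gadget `p`. -/
def pout (b : Bool) (p : Var) : Label := if b then (5, p) else (3, p)

/-- The right-hand side of an equation with three variables. -/
def Triple.bit (t : Triple) : Bool := decide (t.2.2.2.val = 1)

/-- The vertices of the path `k, k + 1, k + 2`. -/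
def path (k : ℕ) (x : Var) : List Label := [(k, x), (k + 1, x), (k + 2, x)]

/-- The arcs at the core of an equation with three variables; `g` is the vertex that follows. -/
def coreArcs (t : Triple) (g : Label) : List (Label × Label) :=
  [((6, t.1), pout t.bit t.1), (pin t.bit t.1, (6, t.2.1)),
   ((6, t.2.1), pout t.bit t.2.1), (pin t.bit t.2.1, (6, t.2.2.1)),
   ((6, t.2.2.1), pout t.bit t.2.2.1), (pin t.bit t.2.2.1, (6, t.1)),
   ((6, t.1), (6, t.2.2.1)), ((6, t.2.2.1), (6, t.2.1)), ((6, t.2.1), (6, t.1)),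
   ((7, t.1), (6, t.1)), ((7, t.1), (6, t.2.1)), ((7, t.1), (6, t.2.2.1)),
   ((6, t.1), g), ((6, t.2.1), g), ((6, t.2.2.1), g)]

/-- Circle and parity gadgets may carry the same name, so the kinds are compared as well. The
relation is reflexive on gadgets and fails for hubs and core vertices. -/
def sameGadget (v w : Label) : Bool :=
  decide (v.2 = w.2) && ((decide (v.1 ≤ 2) && decide (w.1 ≤ 2)) ||
    ((decide (3 ≤ v.1) && decide (v.1 ≤ 5)) && (decide (3 ≤ w.1) && decide (w.1 ≤ 5))))

def isMid (v : Label) : Bool := decide (v.1 = 1) || decide (v.1 = 4)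

namespace HybridInstance

variable (H : HybridInstance)

/-- The preceding variable on the circle. -/
def prevVar (x : Var) : Var :=
  if decide (x.2 = 1) then (x.1, H.circleSize x.1) else (x.1, x.2 - 1)

/-- The last vertex of the circle gadget before `x`. -/
def cport (x : Var) : Label := (2, H.prevVar x)

/-- The vertex that is reached from `x` in forward direction. -/
def ain (x : Var) : Label :=
  if decide (x.2 = H.circleSize x.1) then (8, x.1 + 1, 0) else (0, x)

/-- The vertex from which `x` is reached in backward direction. -/
def aout (x : Var) : Label :=
  if decide (x.2 = H.circleSize x.1) then (8, x.1, 0) else (0, x)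

/-- The arcs at the variable `j.1`, which passes through the parity gadget `j.2.2` in forward
direction if `j.2.1` is true and in backward direction otherwise. -/
def junction (j : Var × Bool × Var) : List (Label × Label) :=
  if j.2.1 then
    [(H.cport j.1, pin j.2.1 j.2.2), (pout j.2.1 j.2.2, H.ain j.1), (H.aout j.1, H.cport j.1)]
  else
    [(H.cport j.1, H.ain j.1), (H.aout j.1, pin j.2.1 j.2.2), (pout j.2.1 j.2.2, H.cport j.1)]

def incidences : List (Var × Bool × Var) :=
  (H.matching.flatMap fun e => [(e.1, true, e.1), (e.2, false, e.1)]) ++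
  H.triples.flatMap fun t =>
    [(t.1, Triple.bit t, t.1), (t.2.1, Triple.bit t, t.2.1), (t.2.2.1, Triple.bit t, t.2.2.1)]

/-- The first vertices of the cores, and the first vertex of the tour. -/
def targets : List Label := (H.triples.map fun t => ((7, t.1) : Label)) ++ [(8, 0, 0)]

/-- The short arcs that do not belong to the paths of the gadgets. -/
def arcs : List (Label × Label) :=
  H.incidences.flatMap H.junction ++
  ((List.range H.numCircles).flatMap fun l =>
    [((8, l, 0), (0, l, H.circleSize l)), ((0, l, H.circleSize l), (8, l + 1, 0))]) ++
  ((8, H.numCircles, 0), H.targets.getD 0 (8, 0, 0)) ::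
  (H.triples.zip (H.targets.drop 1)).flatMap fun p => coreArcs p.1 p.2

/-- The names of the parity gadgets. -/
def pnames : List Var :=
  (H.matching.map fun e => e.1) ++ H.triples.flatMap fun t => [t.1, t.2.1, t.2.2.1]

def labels : List Label :=
  ((List.range (H.numCircles + 1)).map fun l => ((8, l, 0) : Label)) ++
  H.vars.flatMap (path 0) ++ H.pnames.flatMap (path 3) ++
  H.triples.flatMap fun t => [(7, t.1), (6, t.1), (6, t.2.1), (6, t.2.2.1)]

def dist₂ (v w : Label) : ℕ :=
  if decide (v = w) then 0
  else if (sameGadget v w && (isMid v || isMid w)) || decide ((v, w) ∈ H.arcs) then 1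
  else 2

def dist₄ (v w : Label) : ℕ :=
  if decide (v = w) then 0
  else if sameGadget v w then if isMid v || isMid w then 1 else 2
  else if decide ((v, w) ∈ H.arcs) then 2
  else if isMid v ^^ isMid w then 3
  else 4

/-- The vertices are numbered in the order of `labels`. -/
def toATSP (d : Label → Label → ℕ) : ATSPInstance where
  card := H.labels.length
  dist i j := d (H.labels.getD i (0, 0, 0)) (H.labels.getD j (0, 0, 0))

/-- The short arcs in a tour. -/
def usedArcs (σ : List ℕ) : List (Label × Label) :=
  H.arcs.filter fun a => decide (a ∈
    (σ.map fun i => H.labels.getD i (0, 0, 0)).zip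
      ((σ.map fun i => H.labels.getD i (0, 0, 0)).drop 1 ++
        [(σ.map fun i => H.labels.getD i (0, 0, 0)).getD 0 (0, 0, 0)]))

end HybridInstance

/-! ### Reading an assignment off the short arcs of a tour -/

section Decode

variable (U : List (Label × Label))

def inUsed (v : Label) : Bool := U.any fun a => decide (a.2 = v)

def outUsed (v : Label) : Bool := U.any fun a => decide (a.1 = v)

/-- The direction in which the gadget with first vertex `(k, x)` is traversed. -/
def gadgetVal (k : ℕ) (x : Var) : Bool :=
  decide ((outUsed U (k, x)).toNat + (inUsed U (k + 2, x)).toNat ≤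
    (inUsed U (k, x)).toNat + (outUsed U (k + 2, x)).toNat)

/-- The gadget is assigned to the core, but it is also entered or left by its circle. -/
def wild (b : Bool) (p : Var) : Bool :=
  (gadgetVal U 3 p ^^ b) && (inUsed U (pin b p) || outUsed U (pout b p))

/-- The core is responsible for the gadgets whose direction differs from `bit`. Three summands `bit`
amount to one mod 2, so the condition says that their number is even. -/
def parityOk (t : Triple) : Bool :=
  !(gadgetVal U 3 t.1 ^^ (gadgetVal U 3 t.2.1 ^^ (gadgetVal U 3 t.2.2.1 ^^ t.bit)))

/-- If the parity is wrong, the first wild gadget of the equation has its vote reversed. At most one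
of the three flips is true. -/
def flipFst (t : Triple) : Bool := !parityOk U t && wild U t.bit t.1

def flipSnd (t : Triple) : Bool :=
  (!parityOk U t && !wild U t.bit t.1) && wild U t.bit t.2.1

def flipThd (t : Triple) : Bool :=
  (!parityOk U t && !wild U t.bit t.1) && (!wild U t.bit t.2.1 && wild U t.bit t.2.2.1)

def tripleOn (t : Triple) : List Var :=
  (if gadgetVal U 3 t.1 ^^ flipFst U t then [t.1] else []) ++
  ((if gadgetVal U 3 t.2.1 ^^ flipSnd U t then [t.2.1] else []) ++
  (if gadgetVal U 3 t.2.2.1 ^^ flipThd U t then [t.2.2.1] else []))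

def maj (a b c : Bool) : Bool := (a && b) || (c && (a || b))

namespace HybridInstance

variable (H : HybridInstance)

/-- The variables whose parity gadgets vote for value `1`. -/
def parityOn : List Var :=
  (H.matching.flatMap fun e => if gadgetVal U 3 e.1 then [e.1, e.2] else []) ++
  H.triples.flatMap (tripleOn U)

/-- The variables of value `1`, by majority vote of the adjacent gadgets. -/
def decode : List Var :=
  H.vars.filter fun x =>
    maj (gadgetVal U 0 (H.prevVar x)) (gadgetVal U 0 x) (decide (x ∈ H.parityOn U))

end HybridInstance

end Decode

/-! ### The construction takes polynomial time -/

namespace PT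

variable {α β γ : Type} [ToData α] [ToData β] [ToData γ]

theorem xor {f g : α → Bool} (hf : PT f) (hg : PT g) : PT (fun a => f a ^^ g a) := by
  have e : ∀ a, (f a ^^ g a) = if f a then !g a else g a := by
    intro a; cases f a <;> simp
  simp only [e]
  exact ite hf (not hg) hg

theorem zip {l : α → List β} {m : α → List γ} (hl : PT l) (hm : PT m) :
    PT (fun a => (l a).zip (m a)) := by
  obtain ⟨L, hL⟩ := hl.sz_le
  obtain ⟨M, hM⟩ := hm.sz_le
  -- The fold over one list carries the unread part of the other one and the reversed result. `take
  -- 1` keeps the next element inside a list, which avoids a default element of `γ`.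
  let step : List γ × List (β × γ) → β → List γ × List (β × γ) := fun s b =>
    if s.1.isEmpty then s else (s.1.tail, (s.1.take 1).map (fun c => (b, c)) ++ s.2)
  have e : ∀ (l : List β) (m : List γ) (acc : List (β × γ)),
      l.foldl step (m, acc) = (m.drop l.length, (l.zip m).reverse ++ acc) := by
    intro l
    induction l with
    | nil => simp
    | cons b l ih =>
      intro m acc
      cases m with
      | nil =>
        have := ih [] acc
        simp_all [step]
      | cons c m =>
        have := ih m ((b, c) :: acc)
        simp_all [step]
  have hs : ∀ (l : List β) (m : List γ), sz (l.zip m) ≤ sz l + sz m := by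
    intro l
    induction l with
    | nil => intro m; simp [sz_nil]
    | cons b l ih =>
      intro m
      cases m with
      | nil => simp [sz_nil]
      | cons c m =>
        have := ih m
        simp only [List.zip_cons_cons, sz_cons, sz_pair]
        omega
  have htake : PT (fun l : List γ => l.take 1) := by
    have e : ∀ l : List γ, l.take 1 = (l.reverse.drop (l.length - 1)).reverse := by
      intro l
      cases l with
      | nil => rfl
      | cons a l => simp
    simp only [e]
    exact reverse (drop (pred (length id)) (reverse id))
  have hstep : PT (fun p : (α × (List γ × List (β × γ))) × β => step p.1.2 p.2) := by
    refine ite_isEmpty (fst (snd (fst id))) (snd (fst id)) (pair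
      (comp (g := List.tail) (of_tail fun l => by cases l <;> rfl) (fst (snd (fst id))))
      (append (map (f := fun (p : (α × (List γ × List (β × γ))) × β) (c : γ) => (p.2, c))
        (pair (snd (fst id)) (snd id)) (comp htake (fst (snd (fst id))))) (snd (snd (fst id)))))
  have := foldl (f := fun _ => step) (i := fun a => (m a, [])) hstep (pair hm (const [])) hl
    (M + M + L + 1) (fun a l' h => by
      rw [e, List.append_nil, sz_pair, sz_reverse]
      have h1 := hs l' (m a)
      have h2 := sz_prefix_le h
      have h3 := sz_suffix_le (List.drop_suffix l'.length (m a))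
      have := hL a
      have := hM a
      simp only [Polynomial.eval_add, Polynomial.eval_one]
      omega)
  simp only [e, List.append_nil] at this
  simpa using reverse (snd this)

theorem occ {f : α → HybridInstance} (hf : PT f) : PT (fun a => (f a).occ) :=
  comp (g := HybridInstance.occ) (of_head fun _ => rfl) hf

theorem matchingTriples {f : α → HybridInstance} (hf : PT f) :
    PT (fun a => ((f a).matching, (f a).triples)) :=
  comp (g := fun H : HybridInstance => (H.matching, H.triples)) (of_tail fun _ => rfl) hf

theorem matching {f : α → HybridInstance} (hf : PT f) : PT (fun a => (f a).matching) :=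
  fst (matchingTriples hf)

theorem triples {f : α → HybridInstance} (hf : PT f) : PT (fun a => (f a).triples) :=
  snd (matchingTriples hf)

theorem numCircles {f : α → HybridInstance} (hf : PT f) : PT (fun a => (f a).numCircles) :=
  length (occ hf)

theorem circleSize {f : α → HybridInstance} {l : α → ℕ} (hf : PT f) (hl : PT l) :
    PT (fun a => (f a).circleSize (l a)) := by
  have e : ∀ n, 7 * n = n + (n + (n + (n + (n + (n + n))))) := by intro n; omega
  simp only [HybridInstance.circleSize, e]
  have := getD hl (occ hf) 0
  exact add this (add this (add this (add this (add this (add this this)))))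

theorem vars {f : α → HybridInstance} (hf : PT f) : PT (fun a => (f a).vars) := by
  have e : ∀ (H : HybridInstance) (l : ℕ), ((List.range' 1 (H.circleSize l)).map fun i => (l, i)) =
      (List.range (H.circleSize l)).map fun i => (l, i + 1) := by
    intro H l
    rw [List.range'_eq_map_range]
    simp [add_comm]
  simp only [HybridInstance.vars, e]
  exact flatMap (f := fun a l => (List.range ((f a).circleSize l)).map fun i => (l, i + 1))
    (map (f := fun (p : α × ℕ) i => (p.2, i + 1)) (pair (snd (fst id)) (add (snd id) (const 1)))
      (range (circleSize (comp hf (fst id)) (snd id)))) (range (numCircles hf))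

theorem prevVar {f : α → HybridInstance} {x : α → Var} (hf : PT f) (hx : PT x) :
    PT (fun a => (f a).prevVar (x a)) :=
  ite (decEq (snd hx) (const 1)) (pair (fst hx) (circleSize hf (fst hx)))
    (pair (fst hx) (pred (snd hx)))

theorem pin {b : α → Bool} {x : α → Var} (hb : PT b) (hx : PT x) :
    PT (fun a => pin (b a) (x a)) :=
  ite hb (pair (const 3) hx) (pair (const 5) hx)

theorem pout {b : α → Bool} {x : α → Var} (hb : PT b) (hx : PT x) :
    PT (fun a => pout (b a) (x a)) :=
  ite hb (pair (const 5) hx) (pair (const 3) hx)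

theorem bit {t : α → Triple} (ht : PT t) : PT (fun a => (t a).bit) :=
  decEq (comp (g := ZMod.val (n := 2)) (of_eq fun _ => rfl) (snd (snd (snd ht)))) (const 1)

theorem junction {f : α → HybridInstance} {j : α → Var × Bool × Var} (hf : PT f) (hj : PT j) :
    PT (fun a => (f a).junction (j a)) := by
  have hc : PT fun a => (f a).cport (j a).1 := pair (const 2) (prevVar hf (fst hj))
  have hcond : PT fun a => decide ((j a).1.2 = (f a).circleSize (j a).1.1) :=
    decEq (snd (fst hj)) (circleSize hf (fst (fst hj)))
  have hi : PT fun a => (f a).ain (j a).1 := ite hcond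
    (pair (const 8) (pair (add (fst (fst hj)) (const 1)) (const 0))) (pair (const 0) (fst hj))
  have ho : PT fun a => (f a).aout (j a).1 := ite hcond
    (pair (const 8) (pair (fst (fst hj)) (const 0))) (pair (const 0) (fst hj))
  have hp := pin (fst (snd hj)) (snd (snd hj))
  have hq := pout (fst (snd hj)) (snd (snd hj))
  exact ite (fst (snd hj)) (cons (pair hc hp) (cons (pair hq hi) (singleton (pair ho hc))))
    (cons (pair hc hi) (cons (pair ho hp) (singleton (pair hq hc))))

theorem incidences {f : α → HybridInstance} (hf : PT f) : PT (fun a => (f a).incidences) := by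
  have h1 : PT fun p : α × Triple => p.2.1 := fst (snd id)
  have h2 : PT fun p : α × Triple => p.2.2.1 := fst (snd (snd id))
  have h3 : PT fun p : α × Triple => p.2.2.2.1 := fst (snd (snd (snd id)))
  have hb : PT fun p : α × Triple => p.2.bit := bit (snd id)
  have h4 : PT fun p : α × (Var × Var) => p.2.1 := fst (snd id)
  exact append
    (flatMap (f := fun _ e => [(e.1, true, e.1), (e.2, false, e.1)])
      (cons (pair h4 (pair (const _) h4)) (singleton (pair (snd (snd id)) (pair (const _) h4))))
      (matching hf))
    (flatMap (f := fun _ t => [(t.1, Triple.bit t, t.1), (t.2.1, Triple.bit t, t.2.1),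
        (t.2.2.1, Triple.bit t, t.2.2.1)])
      (cons (pair h1 (pair hb h1)) (cons (pair h2 (pair hb h2)) (singleton (pair h3 (pair hb h3)))))
      (triples hf))

theorem coreArcs {t : α → Triple} {g : α → Label} (ht : PT t) (hg : PT g) :
    PT (fun a => coreArcs (t a) (g a)) := by
  have h1 : PT fun a => (t a).1 := fst ht
  have h2 : PT fun a => (t a).2.1 := fst (snd ht)
  have h3 : PT fun a => (t a).2.2.1 := fst (snd (snd ht))
  have hb : PT fun a => (t a).bit := bit ht
  have k : ∀ {x : α → Var} (n : ℕ), PT x → PT fun a => ((n, x a) : Label) :=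
    fun n hx => pair (const n) hx
  exact cons (pair (k 6 h1) (pout hb h1)) <| cons (pair (pin hb h1) (k 6 h2)) <|
    cons (pair (k 6 h2) (pout hb h2)) <| cons (pair (pin hb h2) (k 6 h3)) <|
    cons (pair (k 6 h3) (pout hb h3)) <| cons (pair (pin hb h3) (k 6 h1)) <|
    cons (pair (k 6 h1) (k 6 h3)) <| cons (pair (k 6 h3) (k 6 h2)) <|
    cons (pair (k 6 h2) (k 6 h1)) <| cons (pair (k 7 h1) (k 6 h1)) <|
    cons (pair (k 7 h1) (k 6 h2)) <| cons (pair (k 7 h1) (k 6 h3)) <|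
    cons (pair (k 6 h1) hg) <| cons (pair (k 6 h2) hg) <| singleton (pair (k 6 h3) hg)

theorem targets {f : α → HybridInstance} (hf : PT f) : PT (fun a => (f a).targets) :=
  append (map (f := fun _ t => ((7, t.1) : Label)) (pair (const _) (fst (snd id))) (triples hf))
    (const _)

theorem arcs {f : α → HybridInstance} (hf : PT f) : PT (fun a => (f a).arcs) := by
  refine append (append ?_ ?_) (cons ?_ ?_)
  · exact flatMap (f := fun a j => (f a).junction j) (junction (comp hf (fst id)) (snd id))
      (incidences hf)
  · have h1 : PT fun p : α × ℕ => ((0, p.2, (f p.1).circleSize p.2) : Label) :=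
      pair (const _) (pair (snd id) (circleSize (comp hf (fst id)) (snd id)))
    exact flatMap (f := fun a l => [((8, l, 0), (0, l, (f a).circleSize l)),
        ((0, l, (f a).circleSize l), (8, l + 1, 0))])
      (cons (pair (pair (const _) (pair (snd id) (const _))) h1)
        (singleton (pair h1 (pair (const _) (pair (add (snd id) (const _)) (const _))))))
      (range (numCircles hf))
  · exact pair (pair (const _) (pair (numCircles hf) (const _))) (getD (const _) (targets hf) _)
  · exact flatMap (f := fun _ p => HybridATSP.coreArcs p.1 p.2)
      (coreArcs (fst (snd id)) (snd (snd id))) (zip (triples hf) (drop (const _) (targets hf)))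

theorem path (k : ℕ) {x : α → Var} (hx : PT x) : PT (fun a => path k (x a)) :=
  cons (pair (const _) hx) (cons (pair (const _) hx) (singleton (pair (const _) hx)))

theorem labels {f : α → HybridInstance} (hf : PT f) : PT (fun a => (f a).labels) := by
  refine append (append (append ?_ ?_) ?_) ?_
  · exact map (f := fun _ l => ((8, l, 0) : Label)) (pair (const _) (pair (snd id) (const _)))
      (range (add (numCircles hf) (const _)))
  · exact flatMap (f := fun _ x => HybridATSP.path 0 x) (path 0 (snd id)) (vars hf)
  · refine flatMap (f := fun _ x => HybridATSP.path 3 x) (path 3 (snd id)) (append ?_ ?_)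
    · exact map (f := fun _ e => e.1) (fst (snd id)) (matching hf)
    · exact flatMap (f := fun _ t => [t.1, t.2.1, t.2.2.1]) (cons (fst (snd id))
        (cons (fst (snd (snd id))) (singleton (fst (snd (snd (snd id))))))) (triples hf)
  · exact flatMap (f := fun _ t => [((7, t.1) : Label), (6, t.1), (6, t.2.1), (6, t.2.2.1)])
      (cons (pair (const _) (fst (snd id))) (cons (pair (const _) (fst (snd id)))
        (cons (pair (const _) (fst (snd (snd id))))
          (singleton (pair (const _) (fst (snd (snd (snd id))))))))) (triples hf)

theorem sameGadget {v w : α → Label} (hv : PT v) (hw : PT w) :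
    PT (fun a => sameGadget (v a) (w a)) :=
  and (decEq (snd hv) (snd hw)) (or (and (decLe (fst hv) (const _)) (decLe (fst hw) (const _)))
    (and (and (decLe (const _) (fst hv)) (decLe (fst hv) (const _)))
      (and (decLe (const _) (fst hw)) (decLe (fst hw) (const _)))))

theorem isMid {v : α → Label} (hv : PT v) : PT (fun a => isMid (v a)) :=
  or (decEq (fst hv) (const _)) (decEq (fst hv) (const _))

theorem dist₂ {f : α → HybridInstance} {v w : α → Label} (hf : PT f) (hv : PT v) (hw : PT w) :
    PT (fun a => (f a).dist₂ (v a) (w a)) :=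
  ite (decEq hv hw) (const _) (ite (or (and (sameGadget hv hw) (or (isMid hv) (isMid hw)))
    (mem (pair hv hw) (arcs hf))) (const _) (const _))

theorem dist₄ {f : α → HybridInstance} {v w : α → Label} (hf : PT f) (hv : PT v) (hw : PT w) :
    PT (fun a => (f a).dist₄ (v a) (w a)) :=
  ite (decEq hv hw) (const _) (ite (sameGadget hv hw)
    (ite (or (isMid hv) (isMid hw)) (const _) (const _))
    (ite (mem (pair hv hw) (arcs hf)) (const _)
      (ite (xor (isMid hv) (isMid hw)) (const _) (const _))))

theorem toATSP {d : HybridInstance → Label → Label → ℕ}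
    (hd : PT fun p : (HybridInstance × Label) × Label => d p.1.1 p.1.2 p.2) :
    PT (fun H : HybridInstance => H.toATSP (d H)) := by
  have h : PT fun H : HybridInstance => H.labels.map fun v => H.labels.map fun w => d H v w :=
    map (f := fun H v => H.labels.map fun w => d H v w)
      (map (f := fun (p : HybridInstance × Label) w => d p.1 p.2 w) hd (labels (fst id)))
      (labels id)
  -- An instance is represented by its matrix, so it suffices to run over the labels themselves
  -- instead of their indices.
  have e : ∀ {γ : Type} (l : List Label) (g : Label → γ),
      (List.range l.length).map (fun i => g (l.getD i (0, 0, 0))) = l.map g := by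
    intro γ l g
    apply List.ext_getElem
    · simp
    · intro i h1 h2
      have : i < l.length := by simpa using h2
      simp [this]
  have key : ∀ H : HybridInstance, ToData.toData (H.toATSP (d H)) =
      ToData.toData (H.labels.map fun v => H.labels.map fun w => d H v w) := by
    intro H
    rw [← e H.labels (fun v => H.labels.map fun w => d H v w)]
    simp only [← e H.labels (d H _)]
    rfl
  obtain ⟨p, T, hp⟩ := h
  refine ⟨p, T, fun H => ?_⟩
  rw [key]
  exact hp H

theorem usedArcs {f : α → HybridInstance} {σ : α → List ℕ} (hf : PT f) (hσ : PT σ) :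
    PT (fun a => (f a).usedArcs (σ a)) := by
  have h : PT fun a => (σ a).map fun i => (f a).labels.getD i (0, 0, 0) :=
    map (f := fun a i => (f a).labels.getD i (0, 0, 0))
      (getD (snd id) (labels (comp hf (fst id))) _) hσ
  have h2 := zip h (append (drop (const 1) h) (singleton (getD (const 0) h (0, 0, 0))))
  exact filter (f := fun a b => decide (b ∈ ((σ a).map fun i => (f a).labels.getD i (0, 0, 0)).zip
      (((σ a).map fun i => (f a).labels.getD i (0, 0, 0)).drop 1 ++
        [((σ a).map fun i => (f a).labels.getD i (0, 0, 0)).getD 0 (0, 0, 0)])))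
    (mem (snd id) (comp h2 (fst id))) (arcs hf)

variable {U : α → List (Label × Label)}

theorem inUsed {v : α → Label} (hU : PT U) (hv : PT v) : PT (fun a => inUsed (U a) (v a)) :=
  any (f := fun a (b : Label × Label) => decide (b.2 = v a))
    (decEq (snd (snd id)) (comp hv (fst id))) hU

theorem outUsed {v : α → Label} (hU : PT U) (hv : PT v) : PT (fun a => outUsed (U a) (v a)) :=
  any (f := fun a (b : Label × Label) => decide (b.1 = v a))
    (decEq (fst (snd id)) (comp hv (fst id))) hU

theorem gadgetVal (k : ℕ) {x : α → Var} (hU : PT U) (hx : PT x) :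
    PT (fun a => gadgetVal (U a) k (x a)) :=
  decLe (add (toNat (outUsed hU (pair (const _) hx))) (toNat (inUsed hU (pair (const _) hx))))
    (add (toNat (inUsed hU (pair (const _) hx))) (toNat (outUsed hU (pair (const _) hx))))

theorem wild {b : α → Bool} {p : α → Var} (hU : PT U) (hb : PT b) (hp : PT p) :
    PT (fun a => wild (U a) (b a) (p a)) :=
  and (xor (gadgetVal 3 hU hp) hb) (or (inUsed hU (pin hb hp)) (outUsed hU (pout hb hp)))

theorem tripleOn {t : α → Triple} (hU : PT U) (ht : PT t) :
    PT (fun a => tripleOn (U a) (t a)) := by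
  have h1 : PT fun a => (t a).1 := fst ht
  have h2 : PT fun a => (t a).2.1 := fst (snd ht)
  have h3 : PT fun a => (t a).2.2.1 := fst (snd (snd ht))
  have hb : PT fun a => (t a).bit := bit ht
  have hok : PT fun a => parityOk (U a) (t a) :=
    not (xor (gadgetVal 3 hU h1) (xor (gadgetVal 3 hU h2) (xor (gadgetVal 3 hU h3) hb)))
  have w1 := wild hU hb h1
  have w2 := wild hU hb h2
  have w3 := wild hU hb h3
  exact append (ite (xor (gadgetVal 3 hU h1) (and (not hok) w1)) (singleton h1) (const []))
    (append (ite (xor (gadgetVal 3 hU h2) (and (and (not hok) (not w1)) w2)) (singleton h2)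
        (const []))
      (ite (xor (gadgetVal 3 hU h3) (and (and (not hok) (not w1)) (and (not w2) w3)))
        (singleton h3) (const [])))

theorem decode {f : α → HybridInstance} (hU : PT U) (hf : PT f) :
    PT (fun a => (f a).decode (U a)) := by
  have he : PT fun p : α × (Var × Var) => HybridATSP.gadgetVal (U p.1) 3 p.2.1 :=
    gadgetVal 3 (comp hU (fst id)) (fst (snd id))
  have hm : PT fun p : α × (Var × Var) =>
      if HybridATSP.gadgetVal (U p.1) 3 p.2.1 then [p.2.1, p.2.2] else [] :=
    ite he (cons (fst (snd id)) (singleton (snd (snd id)))) (const [])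
  have ht : PT fun p : α × Triple => HybridATSP.tripleOn (U p.1) p.2 :=
    tripleOn (comp hU (fst id)) (snd id)
  have hon : PT fun a => (f a).parityOn (U a) := append
    (flatMap (f := fun a (e : Var × Var) =>
      if HybridATSP.gadgetVal (U a) 3 e.1 then [e.1, e.2] else []) hm (matching hf))
    (flatMap (f := fun a t => HybridATSP.tripleOn (U a) t) ht (triples hf))
  have h1 : PT fun p : α × Var => HybridATSP.gadgetVal (U p.1) 0 ((f p.1).prevVar p.2) :=
    gadgetVal 0 (comp hU (fst id)) (prevVar (comp hf (fst id)) (snd id))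
  have h2 : PT fun p : α × Var => HybridATSP.gadgetVal (U p.1) 0 p.2 :=
    gadgetVal 0 (comp hU (fst id)) (snd id)
  have h3 : PT fun p : α × Var => decide (p.2 ∈ (f p.1).parityOn (U p.1)) :=
    mem (snd id) (comp hon (fst id))
  have h4 := or (and h1 h2) (and h3 (or h1 h2))
  have h5 := filter (f := fun a x => (HybridATSP.gadgetVal (U a) 0 ((f a).prevVar x) &&
    HybridATSP.gadgetVal (U a) 0 x) || (decide (x ∈ (f a).parityOn (U a)) &&
    (HybridATSP.gadgetVal (U a) 0 ((f a).prevVar x) || HybridATSP.gadgetVal (U a) 0 x)))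
    h4 (vars hf)
  simpa only [HybridInstance.decode, maj] using h5

end PT

/-! ### Hybrid instances of Berman--Karpinski type -/

theorem _root_.List.eq_of_mem_of_nodup_flatMap {α β : Type*} {l : List α} {f : α → List β}
    (h : (l.flatMap f).Nodup) {a b : α} (ha : a ∈ l) (hb : b ∈ l) {x : β} (hxa : x ∈ f a)
    (hxb : x ∈ f b) : a = b := by
  by_contra hne
  have : Std.Symm (Function.onFun List.Disjoint f) := ⟨fun _ _ h => List.Disjoint.symm h⟩
  exact (List.nodup_flatMap.1 h).2.forall ha hb hne hxa hxb

theorem _root_.List.sum_map_flatMap {α β M : Type*} [AddCommMonoid M] (l : List α)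
    (f : α → List β) (g : β → M) :
    ((l.flatMap f).map g).sum = (l.map fun a => ((f a).map g).sum).sum := by
  induction l with
  | nil => rfl
  | cons a l ih => simp [ih]

namespace HybridInstance

variable {H : HybridInstance}

/-- The variables of a triple. -/
def _root_.HybridATSP.Triple.vars (t : Triple) : List Var := [t.1, t.2.1, t.2.2.1]

theorem mem_vars {x : Var} :
    x ∈ H.vars ↔ x.1 < H.numCircles ∧ 1 ≤ x.2 ∧ x.2 ≤ H.circleSize x.1 := by
  obtain ⟨l, i⟩ := x
  simp only [vars, List.mem_flatMap, List.mem_range, List.mem_map, List.mem_range'_1, Prod.mk.injEq]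
  constructor
  · rintro ⟨l', hl, i', hi, rfl, rfl⟩
    exact ⟨hl, hi.1, by omega⟩
  · rintro ⟨h1, h2, h3⟩
    exact ⟨l, h1, i, ⟨h2, by omega⟩, rfl, rfl⟩

theorem nodup_vars : H.vars.Nodup := by
  refine List.nodup_flatMap.2 ⟨fun l _ => ?_, ?_⟩
  · exact List.Nodup.map (fun i j h => by simpa using h) List.nodup_range'
  · refine List.Pairwise.imp_of_mem ?_ (List.nodup_range (n := H.numCircles))
    intro a b _ _ hab x hx hy
    obtain ⟨i, _, rfl⟩ := List.mem_map.1 hx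
    obtain ⟨j, _, hj⟩ := List.mem_map.1 hy
    exact hab (Prod.ext_iff.1 hj).1.symm

theorem mem_incidences {j : Var × Bool × Var} :
    j ∈ H.incidences ↔ (∃ e ∈ H.matching, j = (e.1, true, e.1) ∨ j = (e.2, false, e.1)) ∨
      ∃ t : Triple, t ∈ H.triples ∧ ∃ x ∈ t.vars, j = (x, t.bit, x) := by
  simp [incidences, Triple.vars]

theorem m₃_eq : H.m₃ = H.triples.length := by
  simp [m₃, threeVarEqs]

theorem length_pnames : H.pnames.length = H.matching.length + 3 * H.triples.length := by
  simp [pnames, List.length_flatMap, mul_comm]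

namespace IsBermanKarpinski

variable (hH : H.IsBermanKarpinski)

include hH

theorem numCircles_pos : 0 < H.numCircles := List.length_pos_iff.2 hH.nonempty

theorem seven_le_circleSize {l : ℕ} (hl : l < H.numCircles) : 7 ≤ H.circleSize l := by
  have hl' : l < H.occ.length := hl
  have := hH.occ_pos H.occ[l] (List.getElem_mem _)
  simp only [circleSize, List.getD_eq_getElem _ _ hl']
  omega

/-- Checkers and contacts partition the variables. Hence every variable occurs in exactly one
matching or three-variable equation, from which all uniqueness statements below are derived. -/
theorem perm_vars : ((H.matching.flatMap fun e => [e.1, e.2]) ++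
    H.triples.flatMap fun t => [t.1, t.2.1, t.2.2.1]).Perm H.vars := by
  refine (hH.matching_perfect.append hH.triples_contacts).trans ?_
  have := List.filter_append_perm (fun x : Var => decide (¬ 7 ∣ x.2)) H.vars
  refine List.Perm.trans (List.Perm.of_eq ?_) this
  simp [checkers, contacts]

theorem nodup_append : ((H.matching.flatMap fun e => [e.1, e.2]) ++
    H.triples.flatMap fun t => [t.1, t.2.1, t.2.2.1]).Nodup :=
  hH.perm_vars.nodup_iff.2 nodup_vars

/-- The regrouping that turns bounds for each variable into bounds for each matching or
three-variable equation. -/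
theorem sum_vars {M : Type*} [AddCommMonoid M] (A : Var → M) :
    (H.vars.map A).sum = (H.matching.map fun e => A e.1 + A e.2).sum +
      (H.triples.map fun t => A t.1 + (A t.2.1 + A t.2.2.1)).sum := by
  rw [← (hH.perm_vars.map A).sum_eq, List.map_append, List.sum_append, List.sum_map_flatMap,
    List.sum_map_flatMap]
  simp

theorem matching_unique {e e' : Var × Var} (he : e ∈ H.matching) (he' : e' ∈ H.matching) {x : Var}
    (hx : x ∈ [e.1, e.2]) (hx' : x ∈ [e'.1, e'.2]) : e = e' :=
  List.eq_of_mem_of_nodup_flatMap (List.nodup_append.1 hH.nodup_append).1 he he' hx hx'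

theorem triple_unique {t t' : Triple} (ht : t ∈ H.triples) (ht' : t' ∈ H.triples) {x : Var}
    (hx : x ∈ t.vars) (hx' : x ∈ t'.vars) : t = t' :=
  List.eq_of_mem_of_nodup_flatMap (List.nodup_append.1 hH.nodup_append).2.1 ht ht' hx hx'

theorem matching_ne {e : Var × Var} (he : e ∈ H.matching) : e.1 ≠ e.2 := by
  have := (List.nodup_flatMap.1 (List.nodup_append.1 hH.nodup_append).1).1 e he
  simpa using this

theorem triple_nodup {t : Triple} (ht : t ∈ H.triples) : t.vars.Nodup :=
  (List.nodup_flatMap.1 (List.nodup_append.1 hH.nodup_append).2.1).1 t ht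

theorem triple_ne {t : Triple} (ht : t ∈ H.triples) :
    t.1 ≠ t.2.1 ∧ t.1 ≠ t.2.2.1 ∧ t.2.1 ≠ t.2.2.1 := by
  have := hH.triple_nodup ht
  simp only [Triple.vars, List.nodup_cons, List.mem_cons, List.not_mem_nil, or_false,
    not_or] at this
  exact ⟨this.1.1, this.1.2, this.2.1⟩

theorem matching_triple_disjoint {e : Var × Var} {t : Triple} (he : e ∈ H.matching)
    (ht : t ∈ H.triples) {x : Var} (hx : x ∈ [e.1, e.2]) (hx' : x ∈ t.vars) : False :=
  (List.nodup_append.1 hH.nodup_append).2.2 x (List.mem_flatMap.2 ⟨e, he, hx⟩) x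
    (List.mem_flatMap.2 ⟨t, ht, hx'⟩) rfl

theorem mem_vars_of_matching {e : Var × Var} (he : e ∈ H.matching) {x : Var}
    (hx : x ∈ [e.1, e.2]) : x ∈ H.vars :=
  hH.perm_vars.subset (List.mem_append_left _ (List.mem_flatMap.2 ⟨e, he, hx⟩))

theorem mem_vars_of_triple {t : Triple} (ht : t ∈ H.triples) {x : Var}
    (hx : x ∈ t.vars) : x ∈ H.vars :=
  hH.perm_vars.subset (List.mem_append_right _ (List.mem_flatMap.2 ⟨t, ht, hx⟩))

theorem incidence_fst_mem {j : Var × Bool × Var} (hj : j ∈ H.incidences) : j.1 ∈ H.vars := by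
  rcases mem_incidences.1 hj with ⟨e, he, rfl | rfl⟩ | ⟨t, ht, x, hx, rfl⟩
  · exact hH.mem_vars_of_matching he (by simp)
  · exact hH.mem_vars_of_matching he (by simp)
  · exact hH.mem_vars_of_triple ht hx

theorem incidence_fst_inj {j j' : Var × Bool × Var} (hj : j ∈ H.incidences)
    (hj' : j' ∈ H.incidences) (h : j.1 = j'.1) : j = j' := by
  rcases mem_incidences.1 hj with ⟨e, he, rfl | rfl⟩ | ⟨t, ht, x, hx, rfl⟩ <;>
  rcases mem_incidences.1 hj' with ⟨e', he', rfl | rfl⟩ | ⟨t', ht', x', hx', rfl⟩ <;>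
  simp only at h
  · rw [hH.matching_unique he he' (x := e.1) (by simp) (by simp [h])]
  · have := hH.matching_unique he he' (x := e.1) (by simp) (by simp [h])
    subst this
    exact absurd h (hH.matching_ne he)
  · exact (hH.matching_triple_disjoint he ht' (x := e.1) (by simp) (h ▸ hx')).elim
  · have := hH.matching_unique he he' (x := e.2) (by simp) (by simp [h])
    subst this
    exact absurd h.symm (hH.matching_ne he)
  · rw [hH.matching_unique he he' (x := e.2) (by simp) (by simp [h])]
  · exact (hH.matching_triple_disjoint he ht' (x := e.2) (by simp) (h ▸ hx')).elim
  · exact (hH.matching_triple_disjoint he' ht (x := e'.1) (by simp) (h ▸ hx)).elim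
  · exact (hH.matching_triple_disjoint he' ht (x := e'.2) (by simp) (h ▸ hx)).elim
  · subst h
    rw [hH.triple_unique ht ht' hx hx']

/-- The gadget of a matching equation is incident to two variables, but in opposite directions; the
direction and the gadget together single out the variable. -/
theorem incidence_snd_inj {j j' : Var × Bool × Var} (hj : j ∈ H.incidences)
    (hj' : j' ∈ H.incidences) (h : j.2 = j'.2) : j = j' := by
  rcases mem_incidences.1 hj with ⟨e, he, rfl | rfl⟩ | ⟨t, ht, x, hx, rfl⟩ <;>
  rcases mem_incidences.1 hj' with ⟨e', he', rfl | rfl⟩ | ⟨t', ht', x', hx', rfl⟩ <;>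
  simp only [Prod.mk.injEq, reduceCtorEq, false_and, true_and] at h
  · rw [hH.matching_unique he he' (x := e.1) (by simp) (by simp [h])]
  · exact (hH.matching_triple_disjoint he ht' (x := e.1) (by simp) (h.2 ▸ hx')).elim
  · rw [hH.matching_unique he he' (x := e.1) (by simp) (by simp [h])]
  · exact (hH.matching_triple_disjoint he ht' (x := e.1) (by simp) (h.2 ▸ hx')).elim
  · exact (hH.matching_triple_disjoint he' ht (x := e'.1) (by simp) (h.2 ▸ hx)).elim
  · exact (hH.matching_triple_disjoint he' ht (x := e'.1) (by simp) (h.2 ▸ hx)).elim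
  · obtain ⟨h1, rfl⟩ := h
    rw [hH.triple_unique ht ht' hx hx']

/-! #### The preceding variable -/

theorem prevVar_mem {x : Var} (hx : x ∈ H.vars) : H.prevVar x ∈ H.vars := by
  obtain ⟨h1, h2, h3⟩ := mem_vars.1 hx
  have := hH.seven_le_circleSize h1
  rw [mem_vars]
  by_cases h : x.2 = 1 <;> simp only [prevVar, h, decide_true, decide_false, if_true] <;>
    simp <;> omega

theorem prevVar_inj {x y : Var} (hx : x ∈ H.vars) (hy : y ∈ H.vars)
    (h : H.prevVar x = H.prevVar y) : x = y := by
  obtain ⟨h1, h2, h3⟩ := mem_vars.1 hx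
  obtain ⟨h1', h2', h3'⟩ := mem_vars.1 hy
  obtain ⟨l, i⟩ := x
  obtain ⟨l', i'⟩ := y
  have := hH.seven_le_circleSize h1
  simp only at *
  by_cases h5 : i = 1 <;> by_cases h6 : i' = 1 <;>
    simp [prevVar, h5, h6] at h ⊢ <;> obtain ⟨rfl, h⟩ := h <;> first | trivial | omega

theorem map_prevVar_perm : (H.vars.map H.prevVar).Perm H.vars := by
  have hn : (H.vars.map H.prevVar).Nodup :=
    List.Nodup.map_on (fun x hx y hy h => hH.prevVar_inj hx hy h) nodup_vars
  refine List.Subperm.perm_of_length_le (List.subperm_of_subset hn ?_) (by simp)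
  intro y hy
  obtain ⟨x, hx, rfl⟩ := List.mem_map.1 hy
  exact hH.prevVar_mem hx

/-- The shift along the circles permutes the variables. It lets the last vertex of a circle gadget
be accounted for at the next variable. -/
theorem sum_prevVar {M : Type*} [AddCommMonoid M] (A : Var → M) :
    (H.vars.map fun x => A (H.prevVar x)).sum = (H.vars.map A).sum := by
  rw [← (hH.map_prevVar_perm.map A).sum_eq, List.map_map]
  rfl

/-! #### Counting equations -/

theorem numUnsat_eq (φ : Var → ZMod 2) :
    H.numUnsat φ = (H.vars.map fun x => if φ (H.prevVar x) = φ x then 0 else 1).sum +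
      (H.matching.map fun e => if φ e.1 = φ e.2 then 0 else 1).sum +
      (H.triples.map fun t => if φ t.1 + (φ t.2.1 + φ t.2.2.1) = t.2.2.2 then 0 else 1).sum := by
  have hc : ∀ {α : Type} (l : List α) (p : α → Prop) [DecidablePred p],
      l.countP (fun a => ¬ p a) = (l.map fun a => if p a then 0 else 1).sum := by
    intro α l p _
    induction l with
    | nil => rfl
    | cons a l ih =>
      by_cases h : p a
      · simp [h] at ih ⊢; exact ih
      · simp [h] at ih ⊢; omega
  have h2 : ∀ a b : ZMod 2, a + b = 0 ↔ a = b := by decide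
  unfold numUnsat
  rw [hc _ (fun e : LinEq => e.Sat φ), List.map_append, List.sum_append]
  congr 1
  · simp only [twoVarEqs, List.map_append, List.sum_append, List.map_map, LinEq.Sat,
      List.sum_map_flatMap, Function.comp_def, List.map_cons, List.map_nil, List.sum_cons,
      List.sum_nil, add_zero, h2, vars]
    congr 1
    rw [← List.sum_map_add]
    refine congrArg List.sum (List.map_congr_left fun l hl => ?_)
    have h7 := hH.seven_le_circleSize (List.mem_range.1 hl)
    obtain ⟨k, hk⟩ : ∃ k, H.circleSize l = k + 1 := ⟨H.circleSize l - 1, by omega⟩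
    -- The circle equations are indexed by their second variable; the first variable of the circle
    -- is then left for the border equation.
    rw [hk, Nat.add_sub_cancel, List.range'_succ, List.map_cons, List.sum_cons, add_comm]
    congr 1
    · simp [prevVar, hk, eq_comm]
    · rw [List.range'_eq_map_range, List.range'_eq_map_range, List.map_map, List.map_map]
      refine congrArg List.sum (List.map_congr_left fun i _ => ?_)
      have : 1 + 1 + i ≠ 1 := by omega
      have h3 : 1 + 1 + i - 1 = 1 + i := by omega
      have h4 : 1 + i + 1 = 1 + 1 + i := by omega
      simp only [Function.comp_apply, prevVar, this, decide_false, h3, h4]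
      rfl
  · simp [threeVarEqs, LinEq.Sat, Function.comp_def]

theorem m₂_eq : H.m₂ = H.vars.length + H.matching.length := by
  simp only [m₂, twoVarEqs, List.length_append, List.length_map, vars]
  congr 1
  simp only [List.length_flatMap, List.length_map, List.length_range', List.length_range]
  have : H.numCircles = ((List.range H.numCircles).map fun _ => 1).sum := by simp
  conv_lhs => enter [2]; rw [this]
  rw [← List.sum_map_add]
  refine congrArg List.sum (List.map_congr_left fun l hl => ?_)
  have h7 := hH.seven_le_circleSize (List.mem_range.1 hl)
  omega

/-- There are `m₂ + 3 m₃` gadgets with three vertices each, namely one for each variable, matching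
equation and contact variable. In addition there are four vertices in every core and `n + 1` hubs.
-/
theorem length_labels : H.labels.length = 3 * H.m₂ + 13 * H.m₃ + H.numCircles + 1 := by
  rw [hH.m₂_eq, m₃_eq]
  simp only [labels, List.length_append, List.length_map, List.length_range, List.length_flatMap,
    path, List.length_cons, List.length_nil, List.map_const', List.sum_replicate, smul_eq_mul,
    length_pnames]
  omega

end IsBermanKarpinski

end HybridInstance

/-! ### Vertices and arcs of the construction -/

namespace HybridInstance

variable {H : HybridInstance}

theorem mem_path {k : ℕ} {x : Var} {v : Label} :
    v ∈ path k x ↔ (v.1 = k ∨ v.1 = k + 1 ∨ v.1 = k + 2) ∧ v.2 = x := by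
  obtain ⟨i, y⟩ := v
  simp only [path, List.mem_cons, List.not_mem_nil, or_false, Prod.mk.injEq]
  tauto

theorem mem_pnames {p : Var} : p ∈ H.pnames ↔ (∃ e ∈ H.matching, p = e.1) ∨
    ∃ t : Triple, t ∈ H.triples ∧ p ∈ t.vars := by
  simp [pnames, Triple.vars, eq_comm]

theorem mem_labels {v : Label} : v ∈ H.labels ↔
    (v.1 = 8 ∧ v.2.1 ≤ H.numCircles ∧ v.2.2 = 0) ∨ (v.1 ≤ 2 ∧ v.2 ∈ H.vars) ∨
    ((3 ≤ v.1 ∧ v.1 ≤ 5) ∧ v.2 ∈ H.pnames) ∨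
    ∃ t : Triple, t ∈ H.triples ∧ ((v.1 = 7 ∧ v.2 = t.1) ∨ (v.1 = 6 ∧ v.2 ∈ t.vars)) := by
  simp only [labels, List.mem_append, or_assoc]
  refine or_congr ?_ (or_congr ?_ (or_congr ?_ ?_))
  · obtain ⟨k, l, i⟩ := v
    simp only [List.mem_map, List.mem_range, Prod.mk.injEq]
    constructor
    · rintro ⟨a, ha, rfl, rfl, rfl⟩
      exact ⟨rfl, by omega, rfl⟩
    · rintro ⟨rfl, h, rfl⟩
      exact ⟨l, by omega, rfl, rfl, rfl⟩
  · simp only [List.mem_flatMap, mem_path]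
    constructor
    · rintro ⟨x, hx, h, rfl⟩
      exact ⟨by omega, hx⟩
    · rintro ⟨h, hx⟩
      exact ⟨_, hx, by omega, rfl⟩
  · simp only [List.mem_flatMap, mem_path]
    constructor
    · rintro ⟨x, hx, h, rfl⟩
      exact ⟨by omega, hx⟩
    · rintro ⟨h, hx⟩
      exact ⟨_, hx, by omega, rfl⟩
  · simp only [List.mem_flatMap]
    refine exists_congr fun t => and_congr_right fun _ => ?_
    obtain ⟨k, x⟩ := v
    simp only [Triple.vars, List.mem_cons, List.not_mem_nil, or_false, Prod.mk.injEq]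
    tauto

theorem pin_inj {b b' : Bool} {p p' : Var} (h : pin b p = pin b' p') : b = b' ∧ p = p' := by
  revert h; cases b <;> cases b' <;> simp [pin]

theorem pout_inj {b b' : Bool} {p p' : Var} (h : pout b p = pout b' p') : b = b' ∧ p = p' := by
  revert h; cases b <;> cases b' <;> simp [pout]

theorem pin_eq_pout {b b' : Bool} {p p' : Var} (h : pin b p = pout b' p') : b ≠ b' ∧ p = p' := by
  revert h; cases b <;> cases b' <;> simp [pout, pin]

theorem pin_fst (b : Bool) (p : Var) : (pin b p).1 = 3 ∨ (pin b p).1 = 5 := by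
  cases b <;> simp [pin]

theorem pout_fst (b : Bool) (p : Var) : (pout b p).1 = 3 ∨ (pout b p).1 = 5 := by
  cases b <;> simp [pout]

theorem ain_fst (x : Var) : (H.ain x).1 = 0 ∨ (H.ain x).1 = 8 := by
  unfold ain; split <;> simp

theorem aout_fst (x : Var) : (H.aout x).1 = 0 ∨ (H.aout x).1 = 8 := by
  unfold aout; split <;> simp

theorem cport_fst (x : Var) : (H.cport x).1 = 2 := rfl

/-- The vertex after the last vertex of the preceding circle gadget. -/
def afterC (H : HybridInstance) (j : Var × Bool × Var) : Label :=
  if j.2.1 then pin j.2.1 j.2.2 else H.ain j.1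

/-- The vertex after the last vertex of the parity gadget. -/
def afterP (H : HybridInstance) (j : Var × Bool × Var) : Label :=
  if j.2.1 then H.ain j.1 else H.cport j.1

/-- The vertex after the first vertex of the following circle gadget. -/
def afterA (H : HybridInstance) (j : Var × Bool × Var) : Label :=
  if j.2.1 then H.cport j.1 else pin j.2.1 j.2.2

theorem mem_junction {j : Var × Bool × Var} {v w : Label} : (v, w) ∈ H.junction j ↔
    (v = H.cport j.1 ∧ w = H.afterC j) ∨ (v = pout j.2.1 j.2.2 ∧ w = H.afterP j) ∨
    (v = H.aout j.1 ∧ w = H.afterA j) := by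
  obtain ⟨x, b, p⟩ := j
  cases b <;> simp [junction, afterC, afterP, afterA, or_comm, or_left_comm]

theorem mem_arcs {v w : Label} : (v, w) ∈ H.arcs ↔
    (∃ j ∈ H.incidences, (v = H.cport j.1 ∧ w = H.afterC j) ∨
      (v = pout j.2.1 j.2.2 ∧ w = H.afterP j) ∨ (v = H.aout j.1 ∧ w = H.afterA j)) ∨
    (∃ l < H.numCircles, (v = (8, l, 0) ∧ w = (0, l, H.circleSize l)) ∨
      (v = (0, l, H.circleSize l) ∧ w = (8, l + 1, 0))) ∨
    (v = (8, H.numCircles, 0) ∧ w = H.targets.getD 0 (8, 0, 0)) ∨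
    ∃ (t : Triple) (g : Label), (t, g) ∈ H.triples.zip (H.targets.drop 1) ∧
      (v, w) ∈ coreArcs t g := by
  simp only [arcs, List.mem_append, List.mem_flatMap, List.mem_cons, mem_junction, List.mem_range,
    List.not_mem_nil, or_false, Prod.mk.injEq, or_assoc, Prod.exists]

theorem mem_coreArcs {t : Triple} {g v w : Label} : (v, w) ∈ coreArcs t g ↔
    (v = (6, t.1) ∧ w = pout t.bit t.1) ∨ (v = pin t.bit t.1 ∧ w = (6, t.2.1)) ∨
    (v = (6, t.2.1) ∧ w = pout t.bit t.2.1) ∨ (v = pin t.bit t.2.1 ∧ w = (6, t.2.2.1)) ∨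
    (v = (6, t.2.2.1) ∧ w = pout t.bit t.2.2.1) ∨ (v = pin t.bit t.2.2.1 ∧ w = (6, t.1)) ∨
    (v = (6, t.1) ∧ w = (6, t.2.2.1)) ∨ (v = (6, t.2.2.1) ∧ w = (6, t.2.1)) ∨
    (v = (6, t.2.1) ∧ w = (6, t.1)) ∨ (v = (7, t.1) ∧ w = (6, t.1)) ∨
    (v = (7, t.1) ∧ w = (6, t.2.1)) ∨ (v = (7, t.1) ∧ w = (6, t.2.2.1)) ∨
    (v = (6, t.1) ∧ w = g) ∨ (v = (6, t.2.1) ∧ w = g) ∨ (v = (6, t.2.2.1) ∧ w = g) := by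
  simp only [coreArcs, List.mem_cons, Prod.mk.injEq, List.not_mem_nil, or_false]

theorem mem_targets_fst {g : Label} (h : g ∈ H.targets) : g.1 = 7 ∨ g.1 = 8 := by
  simp only [targets, List.mem_append, List.mem_map, List.mem_cons, List.not_mem_nil,
    or_false] at h
  rcases h with ⟨t, _, rfl⟩ | rfl <;> simp

theorem zip_fst {t : Triple} {g : Label} (h : (t, g) ∈ H.triples.zip (H.targets.drop 1)) :
    t ∈ H.triples ∧ g ∈ H.targets :=
  ⟨(List.of_mem_zip h).1, List.mem_of_mem_drop (List.of_mem_zip h).2⟩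

theorem zip_target {t : Triple} {g : Label} (h : (t, g) ∈ H.triples.zip (H.targets.drop 1)) :
    t ∈ H.triples ∧ (g = (8, 0, 0) ∨ ∃ t' : Triple, t' ∈ H.triples ∧ g = (7, t'.1)) := by
  obtain ⟨h1, h2⟩ := zip_fst h
  refine ⟨h1, ?_⟩
  simp only [targets, List.mem_append, List.mem_map, List.mem_cons, List.not_mem_nil,
    or_false] at h2
  rcases h2 with ⟨t, ht, rfl⟩ | rfl
  · exact Or.inr ⟨t, ht, rfl⟩
  · exact Or.inl rfl

theorem zip_fst_inj {t : Triple} {g g' : Label} (hn : H.triples.Nodup)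
    (h : (t, g) ∈ H.triples.zip (H.targets.drop 1))
    (h' : (t, g') ∈ H.triples.zip (H.targets.drop 1)) : g = g' := by
  obtain ⟨i, hi, h⟩ := List.mem_iff_getElem.1 h
  obtain ⟨i', hi', h'⟩ := List.mem_iff_getElem.1 h'
  simp only [List.getElem_zip, Prod.mk.injEq] at h h'
  have := (hn.getElem_inj_iff).1 (h.1.trans h'.1.symm)
  subst this
  rw [← h.2, ← h'.2]

theorem zip_snd_inj {t t' : Triple} {g : Label} (hn : H.targets.Nodup)
    (h : (t, g) ∈ H.triples.zip (H.targets.drop 1))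
    (h' : (t', g) ∈ H.triples.zip (H.targets.drop 1)) : t = t' := by
  obtain ⟨i, hi, h⟩ := List.mem_iff_getElem.1 h
  obtain ⟨i', hi', h'⟩ := List.mem_iff_getElem.1 h'
  simp only [List.getElem_zip, Prod.mk.injEq, List.getElem_drop] at h h'
  have := (hn.getElem_inj_iff).1 (h.2.trans h'.2.symm)
  have : i = i' := by omega
  subst this
  rw [← h.1, ← h'.1]

theorem map_fst_zip : (H.triples.zip (H.targets.drop 1)).map Prod.fst = H.triples := by
  rw [List.map_fst_zip]
  simp [targets]

namespace IsBermanKarpinski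

variable (hH : H.IsBermanKarpinski)

include hH

theorem exists_incidence {x : Var} (hx : x ∈ H.vars) : ∃ b p, (x, b, p) ∈ H.incidences := by
  rcases List.mem_append.1 (hH.perm_vars.symm.subset hx) with h | h
  · obtain ⟨e, he, hx⟩ := List.mem_flatMap.1 h
    simp only [List.mem_cons, List.not_mem_nil, or_false] at hx
    rcases hx with rfl | rfl
    · exact ⟨_, _, mem_incidences.2 (Or.inl ⟨e, he, Or.inl rfl⟩)⟩
    · exact ⟨_, _, mem_incidences.2 (Or.inl ⟨e, he, Or.inr rfl⟩)⟩
  · obtain ⟨t, ht, hx⟩ := List.mem_flatMap.1 h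
    exact ⟨_, _, mem_incidences.2 (Or.inr ⟨t, ht, x, hx, rfl⟩)⟩

theorem nodup_triples : H.triples.Nodup := by
  have h := (List.nodup_append.1 hH.nodup_append).2.1
  refine List.Nodup.of_map (fun t : Triple => t.1) (h.sublist ?_)
  induction H.triples with
  | nil => simp
  | cons t l ih =>
    simp only [List.map_cons, List.flatMap_cons, List.cons_append, List.nil_append]
    exact ((ih.cons _).cons _).cons_cons _

theorem nodup_matching_fst : (H.matching.map fun e => e.1).Nodup := by
  have h := (List.nodup_append.1 hH.nodup_append).1
  refine h.sublist ?_
  induction H.matching with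
  | nil => simp
  | cons t l ih =>
    simp only [List.map_cons, List.flatMap_cons, List.cons_append, List.nil_append]
    exact (ih.cons _).cons_cons _

theorem nodup_targets : H.targets.Nodup := by
  refine List.Nodup.append ?_ (List.nodup_singleton _) ?_
  · refine List.Nodup.map_on (fun t ht t' ht' h => ?_) hH.nodup_triples
    have h2 : t.1 = t'.1 := (Prod.ext_iff.1 h).2
    exact hH.triple_unique ht ht' (x := t.1) (by simp [Triple.vars]) (by simp [Triple.vars, h2])
  · intro v hv hv'
    obtain ⟨t, _, rfl⟩ := List.mem_map.1 hv
    simp at hv'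

theorem nodup_pnames : H.pnames.Nodup := by
  refine List.Nodup.append hH.nodup_matching_fst (List.nodup_append.1 hH.nodup_append).2.1 ?_
  intro x hx hx'
  obtain ⟨e, he, rfl⟩ := List.mem_map.1 hx
  obtain ⟨t, ht, hx'⟩ := List.mem_flatMap.1 hx'
  exact hH.matching_triple_disjoint he ht (by simp) hx'

theorem nodup_labels : H.labels.Nodup := by
  have hp : ∀ (k : ℕ) (l : List Var), l.Nodup → (l.flatMap (path k)).Nodup := by
    intro k l hl
    refine List.nodup_flatMap.2 ⟨fun x _ => by simp [path], hl.imp ?_⟩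
    intro x y hxy v hv hv'
    exact hxy ((mem_path.1 hv).2.symm.trans (mem_path.1 hv').2)
  refine List.Nodup.append (List.Nodup.append (List.Nodup.append ?_ (hp 0 _ nodup_vars) ?_)
    (hp 3 _ hH.nodup_pnames) ?_) ?_ ?_
  · exact List.Nodup.map (fun i j h => by simpa using h) List.nodup_range
  · intro v hv hv'
    obtain ⟨l, _, rfl⟩ := List.mem_map.1 hv
    obtain ⟨x, _, h⟩ := List.mem_flatMap.1 hv'
    simp [mem_path] at h
  · intro v hv hv'
    obtain ⟨x, _, h⟩ := List.mem_flatMap.1 hv'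
    rcases List.mem_append.1 hv with hv | hv
    · obtain ⟨l, _, rfl⟩ := List.mem_map.1 hv
      simp [mem_path] at h
    · obtain ⟨y, _, h'⟩ := List.mem_flatMap.1 hv
      have := (mem_path.1 h).1
      have := (mem_path.1 h').1
      omega
  · refine List.nodup_flatMap.2 ⟨fun t ht => ?_, ?_⟩
    · have := hH.triple_ne ht
      simp [this.1, this.2.1, this.2.2]
    · refine List.Pairwise.imp_of_mem ?_ hH.nodup_triples
      intro t t' ht ht' hne v hv hv'
      refine hne (hH.triple_unique ht ht' (x := v.2) ?_ ?_)
      · simp only [List.mem_cons, List.not_mem_nil, or_false] at hv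
        rcases hv with rfl | rfl | rfl | rfl <;> simp [Triple.vars]
      · simp only [List.mem_cons, List.not_mem_nil, or_false] at hv'
        rcases hv' with rfl | rfl | rfl | rfl <;> simp [Triple.vars]
  · intro v hv hv'
    have h6 : v.1 = 6 ∨ v.1 = 7 := by
      obtain ⟨t, _, h⟩ := List.mem_flatMap.1 hv'
      simp only [List.mem_cons, List.not_mem_nil, or_false] at h
      rcases h with rfl | rfl | rfl | rfl <;> simp
    rcases List.mem_append.1 hv with hv | hv
    · rcases List.mem_append.1 hv with hv | hv
      · obtain ⟨l, _, rfl⟩ := List.mem_map.1 hv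
        simp at h6
      · obtain ⟨y, _, h'⟩ := List.mem_flatMap.1 hv
        have := (mem_path.1 h').1
        omega
    · obtain ⟨y, _, h'⟩ := List.mem_flatMap.1 hv
      have := (mem_path.1 h').1
      omega

theorem cport_inj {x y : Var} (hx : x ∈ H.vars) (hy : y ∈ H.vars)
    (h : H.cport x = H.cport y) : x = y :=
  hH.prevVar_inj hx hy (Prod.ext_iff.1 h).2

omit hH in
theorem _root_.HybridATSP.HybridInstance.ain_inj {x y : Var}
    (h : H.ain x = H.ain y) : x = y := by
  obtain ⟨l, i⟩ := x
  obtain ⟨m, j⟩ := y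
  by_cases h1 : i = H.circleSize l <;> by_cases h2 : j = H.circleSize m <;>
    simp [ain, h1, h2] at h ⊢
  · subst h; simp
  · exact h

omit hH in
theorem _root_.HybridATSP.HybridInstance.aout_inj {x y : Var}
    (h : H.aout x = H.aout y) : x = y := by
  obtain ⟨l, i⟩ := x
  obtain ⟨m, j⟩ := y
  by_cases h1 : i = H.circleSize l <;> by_cases h2 : j = H.circleSize m <;>
    simp [aout, h1, h2] at h ⊢
  · subst h; simp
  · exact h

end IsBermanKarpinski

/-! #### The arcs at a vertex -/

/-- The families of short arcs are mostly told apart by the kinds of their ends alone; this lemma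
and the next ones collect the kinds that can occur. -/
theorem afterC_fst (j : Var × Bool × Var) : (H.afterC j).1 ≠ 1 ∧ (H.afterC j).1 ≠ 2 ∧
    (H.afterC j).1 ≠ 4 ∧ (H.afterC j).1 ≠ 6 ∧ (H.afterC j).1 ≠ 7 := by
  have h1 := pin_fst j.2.1 j.2.2
  have h2 := H.ain_fst j.1
  unfold afterC; split <;> omega

theorem afterP_fst (j : Var × Bool × Var) : (H.afterP j).1 ≠ 1 ∧ (H.afterP j).1 ≠ 3 ∧
    (H.afterP j).1 ≠ 4 ∧ (H.afterP j).1 ≠ 5 ∧ (H.afterP j).1 ≠ 6 ∧ (H.afterP j).1 ≠ 7 := by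
  have h1 := H.cport_fst j.1
  have h2 := H.ain_fst j.1
  unfold afterP; split <;> omega

theorem afterA_fst (j : Var × Bool × Var) : (H.afterA j).1 ≠ 0 ∧ (H.afterA j).1 ≠ 1 ∧
    (H.afterA j).1 ≠ 4 ∧ (H.afterA j).1 ≠ 6 ∧ (H.afterA j).1 ≠ 7 ∧ (H.afterA j).1 ≠ 8 := by
  have h1 := pin_fst j.2.1 j.2.2
  have h2 := H.cport_fst j.1
  unfold afterA; split <;> omega

theorem core_fst {t : Triple} {g v w : Label} (h : (v, w) ∈ coreArcs t g) :
    (v.1 = 6 ∧ (w.1 = 3 ∨ w.1 = 5 ∨ w.1 = 6)) ∨ (v.1 = 6 ∧ w = g) ∨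
    ((v.1 = 3 ∨ v.1 = 5) ∧ w.1 = 6) ∨ (v.1 = 7 ∧ w.1 = 6) := by
  have h1 := fun y => pin_fst t.bit y
  have h2 := fun y => pout_fst t.bit y
  rcases mem_coreArcs.1 h with ⟨rfl, rfl⟩ | ⟨rfl, rfl⟩ | ⟨rfl, rfl⟩ | ⟨rfl, rfl⟩ | ⟨rfl, rfl⟩ |
    ⟨rfl, rfl⟩ | ⟨rfl, rfl⟩ | ⟨rfl, rfl⟩ | ⟨rfl, rfl⟩ | ⟨rfl, rfl⟩ | ⟨rfl, rfl⟩ | ⟨rfl, rfl⟩ |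
    ⟨rfl, rfl⟩ | ⟨rfl, rfl⟩ | ⟨rfl, rfl⟩ <;> simp [h1] <;> have := h2 t.1 <;>
    have := h2 t.2.1 <;> have := h2 t.2.2.1 <;> omega

theorem first_target_fst : (H.targets.getD 0 (8, 0, 0)).1 = 7 ∨
    H.targets.getD 0 (8, 0, 0) = (8, 0, 0) := by
  unfold targets
  cases H.triples <;> simp

theorem arcs_cases {v w : Label} (h : (v, w) ∈ H.arcs) :
    (∃ j ∈ H.incidences, v = H.cport j.1 ∧ w = H.afterC j) ∨
    (∃ j ∈ H.incidences, v = pout j.2.1 j.2.2 ∧ w = H.afterP j) ∨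
    (∃ j ∈ H.incidences, v = H.aout j.1 ∧ w = H.afterA j) ∨
    (∃ l < H.numCircles, v = (8, l, 0) ∧ w = (0, l, H.circleSize l)) ∨
    (∃ l < H.numCircles, v = (0, l, H.circleSize l) ∧ w = (8, l + 1, 0)) ∨
    (v = (8, H.numCircles, 0) ∧ (w.1 = 7 ∨ w = (8, 0, 0))) ∨
    ∃ (t : Triple) (g : Label), (t, g) ∈ H.triples.zip (H.targets.drop 1) ∧
      (v, w) ∈ coreArcs t g := by
  rcases mem_arcs.1 h with ⟨j, hj, h | h | h⟩ | ⟨l, hl, h | h⟩ | ⟨hv, hw⟩ | h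
  · exact Or.inl ⟨j, hj, h⟩
  · exact Or.inr (Or.inl ⟨j, hj, h⟩)
  · exact Or.inr (Or.inr (Or.inl ⟨j, hj, h⟩))
  · exact Or.inr (Or.inr (Or.inr (Or.inl ⟨l, hl, h⟩)))
  · exact Or.inr (Or.inr (Or.inr (Or.inr (Or.inl ⟨l, hl, h⟩))))
  · exact Or.inr (Or.inr (Or.inr (Or.inr (Or.inr (Or.inl ⟨hv, hw ▸ first_target_fst⟩)))))
  · exact Or.inr (Or.inr (Or.inr (Or.inr (Or.inr (Or.inr h)))))

namespace IsBermanKarpinski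

variable (hH : H.IsBermanKarpinski) {x p : Var} {b : Bool} (hj : (x, b, p) ∈ H.incidences)

include hH

theorem border_mem {l : ℕ} (hl : l < H.numCircles) : (l, H.circleSize l) ∈ H.vars := by
  have := hH.seven_le_circleSize hl
  rw [mem_vars]
  exact ⟨hl, by simp only; omega, le_rfl⟩

include hj

/-- The circle enters such a gadget at `pin t.bit y` and leaves at `pout t.bit y`, whereas the core
enters at `pout t.bit y` and leaves at `pin t.bit y`. So circle arcs and core arcs are never
confused at a gadget. -/
theorem core_pin {t : Triple} {y : Var} (ht : t ∈ H.triples) (hy : y ∈ t.vars)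
    (hp : p = y) : b = t.bit := by
  subst hp
  rcases mem_incidences.1 hj with ⟨e, he, h⟩ | ⟨t', ht', x', hx', h⟩
  · have : p = e.1 := by rcases h with h | h <;> simp_all
    exact (hH.matching_triple_disjoint he ht (x := p) (by simp [this]) hy).elim
  · simp only [Prod.mk.injEq] at h
    obtain ⟨rfl, rfl, rfl⟩ := h
    rw [hH.triple_unique ht ht' hy hx']

theorem eq_of_incidence {j : Var × Bool × Var} (h : j ∈ H.incidences) (h' : x = j.1) :
    j = (x, b, p) := hH.incidence_fst_inj h hj h'.symm

/-- Apart from the hubs, a vertex at a junction has a single short arc of each orientation there.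
Each use of a short arc can therefore be expressed by one indicator at both of its ends. -/
theorem out_cport {w : Label} : (H.cport x, w) ∈ H.arcs ↔ w = H.afterC (x, b, p) := by
  constructor
  · intro h
    have h0 := H.cport_fst x
    rcases arcs_cases h with ⟨j, hj', hv, hw⟩ | ⟨j, hj', hv, hw⟩ | ⟨j, hj', hv, hw⟩ |
      ⟨l, hl, hv, hw⟩ | ⟨l, hl, hv, hw⟩ | ⟨hv, hw⟩ | ⟨t, g, hz, hc⟩
    · have := hH.eq_of_incidence hj hj'
        (hH.cport_inj (hH.incidence_fst_mem hj) (hH.incidence_fst_mem hj') hv)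
      rw [hw, this]
    · have := pout_fst j.2.1 j.2.2
      rw [hv] at h0; omega
    · have := H.aout_fst j.1
      rw [hv] at h0; omega
    · rw [hv] at h0; simp at h0
    · rw [hv] at h0; simp at h0
    · rw [hv] at h0; simp at h0
    · have := core_fst hc; omega
  · rintro rfl
    exact mem_arcs.2 (Or.inl ⟨_, hj, Or.inl ⟨rfl, rfl⟩⟩)

theorem out_pout {w : Label} : (pout b p, w) ∈ H.arcs ↔ w = H.afterP (x, b, p) := by
  constructor
  · intro h
    have h0 := pout_fst b p
    rcases arcs_cases h with ⟨j, hj', hv, hw⟩ | ⟨j, hj', hv, hw⟩ | ⟨j, hj', hv, hw⟩ |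
      ⟨l, hl, hv, hw⟩ | ⟨l, hl, hv, hw⟩ | ⟨hv, hw⟩ | ⟨t, g, hz, hc⟩
    · have := H.cport_fst j.1
      rw [hv] at h0; omega
    · obtain ⟨h1, h2⟩ := pout_inj hv
      rw [hw, hH.incidence_snd_inj hj' hj (Prod.ext h1.symm h2.symm)]
    · have := H.aout_fst j.1
      rw [hv] at h0; omega
    · rw [hv] at h0; simp at h0
    · rw [hv] at h0; simp at h0
    · rw [hv] at h0; simp at h0
    · exfalso
      have ht := (zip_fst hz).1
      have key : ∀ y ∈ t.vars, pout b p = pin t.bit y → False := by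
        intro y hy he
        have h1 := pin_eq_pout he.symm
        exact h1.1 (hH.core_pin hj ht hy h1.2.symm).symm
      rcases mem_coreArcs.1 hc with h | h | h | h | h | h | h | h | h | h | h | h | h | h | h
      all_goals first
        | exact key _ (by simp [Triple.vars]) h.1
        | rw [h.1] at h0; simp at h0
  · rintro rfl
    exact mem_arcs.2 (Or.inl ⟨_, hj, Or.inr (Or.inl ⟨rfl, rfl⟩)⟩)

theorem in_cport {v : Label} :
    (v, H.cport x) ∈ H.arcs ↔ v = if b then H.aout x else pout b p := by
  constructor
  · intro h
    have h0 := H.cport_fst x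
    rcases arcs_cases h with ⟨j, hj', hv, hw⟩ | ⟨j, hj', hv, hw⟩ | ⟨j, hj', hv, hw⟩ |
      ⟨l, hl, hv, hw⟩ | ⟨l, hl, hv, hw⟩ | ⟨hv, hw⟩ | ⟨t, g, hz, hc⟩
    · have := H.afterC_fst j
      rw [hw] at h0; omega
    · cases hb : j.2.1
      · simp only [afterP, hb, Bool.false_eq_true, if_false] at hw
        have := hH.eq_of_incidence hj hj'
          (hH.cport_inj (hH.incidence_fst_mem hj) (hH.incidence_fst_mem hj') hw)
        subst this
        simp only at hb
        subst hb
        exact hv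
      · simp only [afterP, hb, if_true] at hw
        have := H.ain_fst j.1
        rw [hw] at h0; omega
    · cases hb : j.2.1
      · simp only [afterA, hb, Bool.false_eq_true, if_false] at hw
        have := pin_fst false j.2.2
        rw [hw] at h0; simp [pin] at h0
      · simp only [afterA, hb, if_true] at hw
        have := hH.eq_of_incidence hj hj'
          (hH.cport_inj (hH.incidence_fst_mem hj) (hH.incidence_fst_mem hj') hw)
        subst this
        simp only at hb
        subst hb
        exact hv
    · rw [hw] at h0; simp at h0
    · rw [hw] at h0; simp at h0
    · rcases hw with hw | hw
      · omega
      · rw [hw] at h0; simp at h0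
    · have h1 := mem_targets_fst (zip_fst hz).2
      have := core_fst hc
      by_cases hg : H.cport x = g
      · rw [hg] at h0; omega
      · simp only [hg, and_false, false_or] at this; omega
  · rintro rfl
    cases b
    · exact mem_arcs.2 (Or.inl ⟨_, hj, Or.inr (Or.inl ⟨rfl, rfl⟩)⟩)
    · exact mem_arcs.2 (Or.inl ⟨_, hj, Or.inr (Or.inr ⟨rfl, rfl⟩)⟩)

theorem in_pin {v : Label} :
    (v, pin b p) ∈ H.arcs ↔ v = if b then H.cport x else H.aout x := by
  constructor
  · intro h
    have h0 := pin_fst b p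
    rcases arcs_cases h with ⟨j, hj', hv, hw⟩ | ⟨j, hj', hv, hw⟩ | ⟨j, hj', hv, hw⟩ |
      ⟨l, hl, hv, hw⟩ | ⟨l, hl, hv, hw⟩ | ⟨hv, hw⟩ | ⟨t, g, hz, hc⟩
    · cases hb : j.2.1
      · simp only [afterC, hb, Bool.false_eq_true, if_false] at hw
        have := H.ain_fst j.1
        rw [hw] at h0; omega
      · simp only [afterC, hb, if_true] at hw
        obtain ⟨h1, h2⟩ := pin_inj hw
        have := hH.incidence_snd_inj hj' hj (Prod.ext (hb.trans h1.symm) h2.symm)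
        subst this
        simp only at hb
        subst hb
        exact hv
    · have := H.afterP_fst j
      rw [hw] at h0; omega
    · cases hb : j.2.1
      · simp only [afterA, hb, Bool.false_eq_true, if_false] at hw
        obtain ⟨h1, h2⟩ := pin_inj hw
        have := hH.incidence_snd_inj hj' hj (Prod.ext (hb.trans h1.symm) h2.symm)
        subst this
        simp only at hb
        subst hb
        exact hv
      · simp only [afterA, hb, if_true] at hw
        have := H.cport_fst j.1
        rw [hw] at h0; omega
    · rw [hw] at h0; simp at h0
    · rw [hw] at h0; simp at h0
    · rcases hw with hw | hw
      · omega
      · rw [hw] at h0; simp at h0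
    · exfalso
      have ht := (zip_fst hz).1
      have hg := mem_targets_fst (zip_fst hz).2
      have key : ∀ y ∈ t.vars, pin b p = pout t.bit y → False := by
        intro y hy he
        have h1 := pin_eq_pout he
        exact h1.1 (hH.core_pin hj ht hy h1.2)
      rcases mem_coreArcs.1 hc with h | h | h | h | h | h | h | h | h | h | h | h | h | h | h
      all_goals first
        | exact key _ (by simp [Triple.vars]) h.2
        | (rw [h.2] at h0; simp at h0)
        | (rw [h.2] at h0; omega)
  · rintro rfl
    cases b
    · exact mem_arcs.2 (Or.inl ⟨_, hj, Or.inr (Or.inr ⟨rfl, rfl⟩)⟩)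
    · exact mem_arcs.2 (Or.inl ⟨_, hj, Or.inl ⟨rfl, rfl⟩⟩)

/-- The arcs that leave `x` in backward direction. -/
theorem out_aout {w : Label} : (H.aout x, w) ∈ H.arcs ↔ w = H.afterA (x, b, p) ∨
    (x.2 = H.circleSize x.1 ∧ w = (0, x)) := by
  have hx := mem_vars.1 (hH.incidence_fst_mem hj)
  simp only at hx
  constructor
  · intro h
    have h0 := H.aout_fst x
    rcases arcs_cases h with ⟨j, hj', hv, hw⟩ | ⟨j, hj', hv, hw⟩ | ⟨j, hj', hv, hw⟩ |
      ⟨l, hl, hv, hw⟩ | ⟨l, hl, hv, hw⟩ | ⟨hv, hw⟩ | ⟨t, g, hz, hc⟩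
    · have := H.cport_fst j.1
      rw [hv] at h0; omega
    · have := pout_fst j.2.1 j.2.2
      rw [hv] at h0; omega
    · rw [hw, hH.eq_of_incidence hj hj' (H.aout_inj hv)]
      exact Or.inl rfl
    · by_cases hb : x.2 = H.circleSize x.1
      · simp only [aout, hb, decide_true, if_true, Prod.mk.injEq, and_true, true_and] at hv
        refine Or.inr ⟨hb, ?_⟩
        rw [hw, ← hv, ← hb]
      · simp [aout, hb] at hv
    · by_cases hb : x.2 = H.circleSize x.1
      · simp [aout, hb] at hv
      · simp only [aout, hb, decide_false, Bool.false_eq_true, if_false, Prod.mk.injEq,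
          true_and] at hv
        rw [hv] at hb; simp at hb
    · by_cases hb : x.2 = H.circleSize x.1
      · simp [aout, hb] at hv; omega
      · simp [aout, hb] at hv
    · have := core_fst hc; omega
  · rintro (rfl | ⟨hb, rfl⟩)
    · exact mem_arcs.2 (Or.inl ⟨_, hj, Or.inr (Or.inr ⟨rfl, rfl⟩)⟩)
    · refine mem_arcs.2 (Or.inr (Or.inl ⟨x.1, hx.1, Or.inl ⟨by simp [aout, hb], ?_⟩⟩))
      rw [← hb]

/-- The arcs that leave `x` in forward direction. -/
theorem in_ain {v : Label} : (v, H.ain x) ∈ H.arcs ↔ v = (if b then pout b p else H.cport x) ∨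
    (x.2 = H.circleSize x.1 ∧ v = (0, x)) := by
  have hx := mem_vars.1 (hH.incidence_fst_mem hj)
  simp only at hx
  constructor
  · intro h
    have h0 := H.ain_fst x
    rcases arcs_cases h with ⟨j, hj', hv, hw⟩ | ⟨j, hj', hv, hw⟩ | ⟨j, hj', hv, hw⟩ |
      ⟨l, hl, hv, hw⟩ | ⟨l, hl, hv, hw⟩ | ⟨hv, hw⟩ | ⟨t, g, hz, hc⟩
    · cases hb : j.2.1
      · simp only [afterC, hb, Bool.false_eq_true, if_false] at hw
        have := hH.eq_of_incidence hj hj' (H.ain_inj hw)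
        subst this
        simp only at hb
        subst hb
        exact Or.inl hv
      · simp only [afterC, hb, if_true] at hw
        have := pin_fst true j.2.2
        rw [hw] at h0; omega
    · cases hb : j.2.1
      · simp only [afterP, hb, Bool.false_eq_true, if_false] at hw
        have := H.cport_fst j.1
        rw [hw] at h0; omega
      · simp only [afterP, hb, if_true] at hw
        have := hH.eq_of_incidence hj hj' (H.ain_inj hw)
        subst this
        simp only at hb
        subst hb
        exact Or.inl hv
    · have := H.afterA_fst j
      rw [hw] at h0; omega
    · by_cases hb : x.2 = H.circleSize x.1
      · simp [ain, hb] at hw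
      · simp only [ain, hb, decide_false, Bool.false_eq_true, if_false, Prod.mk.injEq,
          true_and] at hw
        rw [hw] at hb; simp at hb
    · by_cases hb : x.2 = H.circleSize x.1
      · simp only [ain, hb, decide_true, if_true, Prod.mk.injEq, and_true, true_and] at hw
        refine Or.inr ⟨hb, ?_⟩
        have : l = x.1 := by omega
        rw [hv, this, ← hb]
      · simp [ain, hb] at hw
    · rcases hw with hw | hw
      · omega
      · by_cases hb : x.2 = H.circleSize x.1 <;> simp [ain, hb] at hw
    · have := core_fst hc
      by_cases hg : H.ain x = g
      · rcases (zip_target hz).2 with h1 | ⟨t', _, h1⟩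
        · rw [h1] at hg
          by_cases hb : x.2 = H.circleSize x.1 <;> simp [ain, hb] at hg
        · rw [hg, h1] at h0; simp at h0
      · simp only [hg, and_false, false_or] at this; omega
  · rintro (rfl | ⟨hb, rfl⟩)
    · cases b
      · exact mem_arcs.2 (Or.inl ⟨_, hj, Or.inl ⟨rfl, rfl⟩⟩)
      · exact mem_arcs.2 (Or.inl ⟨_, hj, Or.inr (Or.inl ⟨rfl, rfl⟩)⟩)
    · refine mem_arcs.2 (Or.inr (Or.inl ⟨x.1, hx.1, Or.inr ⟨?_, by simp [ain, hb]⟩⟩))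
      rw [← hb]

omit hH hj in
theorem _root_.HybridATSP.HybridInstance.out_border {l : ℕ} (hl : l < H.numCircles) {w : Label} :
    ((0, l, H.circleSize l), w) ∈ H.arcs ↔ w = (8, l + 1, 0) := by
  constructor
  · intro h
    rcases arcs_cases h with ⟨j, hj', hv, hw⟩ | ⟨j, hj', hv, hw⟩ | ⟨j, hj', hv, hw⟩ |
      ⟨l, hl, hv, hw⟩ | ⟨l, hl, hv, hw⟩ | ⟨hv, hw⟩ | ⟨t, g, hz, hc⟩
    · simp [cport] at hv
    · have := pout_fst j.2.1 j.2.2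
      rw [← hv] at this; simp at this
    · by_cases hb : j.1.2 = H.circleSize j.1.1
      · simp [aout, hb] at hv
      · simp only [aout, hb, decide_false, Bool.false_eq_true, if_false, Prod.mk.injEq,
          true_and] at hv
        rw [← hv] at hb; simp at hb
    · simp at hv
    · simp only [Prod.mk.injEq, true_and] at hv
      rw [hw, hv.1]
    · simp at hv
    · have := core_fst hc
      simp at this
  · rintro rfl
    exact mem_arcs.2 (Or.inr (Or.inl ⟨l, hl, Or.inr ⟨rfl, rfl⟩⟩))

omit hH hj in
theorem _root_.HybridATSP.HybridInstance.in_border {l : ℕ} (hl : l < H.numCircles) {v : Label} :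
    (v, (0, l, H.circleSize l)) ∈ H.arcs ↔ v = (8, l, 0) := by
  constructor
  · intro h
    rcases arcs_cases h with ⟨j, hj', hv, hw⟩ | ⟨j, hj', hv, hw⟩ | ⟨j, hj', hv, hw⟩ |
      ⟨l, hl, hv, hw⟩ | ⟨l, hl, hv, hw⟩ | ⟨hv, hw⟩ | ⟨t, g, hz, hc⟩
    · have h1 : ∀ y, (0, l, H.circleSize l) ≠ H.ain y := by
        intro y hw
        by_cases hb : y.2 = H.circleSize y.1
        · simp [ain, hb] at hw
        · simp only [ain, hb, decide_false, Bool.false_eq_true, if_false, Prod.mk.injEq,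
            true_and] at hw
          rw [← hw] at hb; simp at hb
      unfold afterC at hw
      split at hw
      · have := pin_fst j.2.1 j.2.2
        rw [← hw] at this; simp at this
      · exact (h1 _ hw).elim
    · have h1 : ∀ y, (0, l, H.circleSize l) ≠ H.ain y := by
        intro y hw
        by_cases hb : y.2 = H.circleSize y.1
        · simp [ain, hb] at hw
        · simp only [ain, hb, decide_false, Bool.false_eq_true, if_false, Prod.mk.injEq,
            true_and] at hw
          rw [← hw] at hb; simp at hb
      unfold afterP at hw
      split at hw
      · exact (h1 _ hw).elim
      · simp [cport] at hw
    · have := H.afterA_fst j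
      rw [← hw] at this; simp at this
    · simp only [Prod.mk.injEq, true_and] at hw
      rw [hv, hw.1]
    · simp at hw
    · simp at hw
    · have := core_fst hc
      have h2 := mem_targets_fst (zip_fst hz).2
      by_cases hg : (0, l, H.circleSize l) = g
      · rw [← hg] at h2; simp at h2
      · simp [hg] at this
  · rintro rfl
    exact mem_arcs.2 (Or.inr (Or.inl ⟨l, hl, Or.inl ⟨rfl, rfl⟩⟩))

/-! #### The arcs at a core -/

section Core

omit hj

variable {t : Triple} {g : Label} (hz : (t, g) ∈ H.triples.zip (H.targets.drop 1))

include hz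

/-- Different equations share no variables, so a short arc at a vertex of this core can only belong
to this core. The same reason is behind the companions of this lemma. -/
theorem core_of_out {v w : Label} (h : (v, w) ∈ H.arcs) (h6 : v.1 = 6) (hv : v.2 ∈ t.vars) :
    (v, w) ∈ coreArcs t g := by
  rcases arcs_cases h with ⟨j, hj', hv', hw⟩ | ⟨j, hj', hv', hw⟩ | ⟨j, hj', hv', hw⟩ |
    ⟨l, hl, hv', hw⟩ | ⟨l, hl, hv', hw⟩ | ⟨hv', hw⟩ | ⟨t', g', hz', hc⟩
  · rw [hv'] at h6; simp [cport] at h6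
  · have := pout_fst j.2.1 j.2.2
    rw [hv'] at h6; omega
  · have := H.aout_fst j.1
    rw [hv'] at h6; omega
  · rw [hv'] at h6; simp at h6
  · rw [hv'] at h6; simp at h6
  · rw [hv'] at h6; simp at h6
  · have hv' : v.2 ∈ t'.vars := by
      have h1 := fun y => pin_fst t'.bit y
      rcases mem_coreArcs.1 hc with h | h | h | h | h | h | h | h | h | h | h | h | h | h | h
      all_goals first
        | (rw [h.1]; simp [Triple.vars]; done)
        | (have := h1 t'.1; have := h1 t'.2.1; have := h1 t'.2.2.1; rw [h.1] at h6; omega)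
    have := hH.triple_unique (zip_fst hz).1 (zip_fst hz').1 hv hv'
    subst this
    rwa [zip_fst_inj hH.nodup_triples hz hz']

theorem core_of_start {w : Label} (h : ((7, t.1), w) ∈ H.arcs) :
    ((7, t.1), w) ∈ coreArcs t g := by
  rcases arcs_cases h with ⟨j, hj', hv', hw⟩ | ⟨j, hj', hv', hw⟩ | ⟨j, hj', hv', hw⟩ |
    ⟨l, hl, hv', hw⟩ | ⟨l, hl, hv', hw⟩ | ⟨hv', hw⟩ | ⟨t', g', hz', hc⟩
  · simp [cport] at hv'
  · have := pout_fst j.2.1 j.2.2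
    rw [← hv'] at this; simp at this
  · have := H.aout_fst j.1
    rw [← hv'] at this; simp at this
  · simp at hv'
  · simp at hv'
  · simp at hv'
  · have hv' : t.1 = t'.1 := by
      have h1 := fun y => pin_fst t'.bit y
      rcases mem_coreArcs.1 hc with h | h | h | h | h | h | h | h | h | h | h | h | h | h | h
      all_goals first
        | exact (Prod.ext_iff.1 h.1).2
        | (have h2 := h.1; simp at h2)
        | (have h3 := h1 t'.1; rw [← h.1] at h3; simp at h3)
        | (have h3 := h1 t'.2.1; rw [← h.1] at h3; simp at h3)
        | (have h3 := h1 t'.2.2.1; rw [← h.1] at h3; simp at h3)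
    have := hH.triple_unique (zip_fst hz).1 (zip_fst hz').1 (x := t.1) (by simp [Triple.vars])
      (by simp [Triple.vars, hv'])
    subst this
    rwa [zip_fst_inj hH.nodup_triples hz hz']

theorem core_of_in {v w : Label} (h : (v, w) ∈ H.arcs) (h6 : w.1 = 6) (hw : w.2 ∈ t.vars) :
    (v, w) ∈ coreArcs t g := by
  rcases arcs_cases h with ⟨j, hj', hv', hw'⟩ | ⟨j, hj', hv', hw'⟩ | ⟨j, hj', hv', hw'⟩ |
    ⟨l, hl, hv', hw'⟩ | ⟨l, hl, hv', hw'⟩ | ⟨hv', hw'⟩ | ⟨t', g', hz', hc⟩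
  · have := H.afterC_fst j
    rw [hw'] at h6; omega
  · have := H.afterP_fst j
    rw [hw'] at h6; omega
  · have := H.afterA_fst j
    rw [hw'] at h6; omega
  · rw [hw'] at h6; simp at h6
  · rw [hw'] at h6; simp at h6
  · rcases hw' with hw' | hw'
    · omega
    · rw [hw'] at h6; simp at h6
  · have hv' : w.2 ∈ t'.vars := by
      have h1 := fun y => pout_fst t'.bit y
      have h2 := mem_targets_fst (zip_fst hz').2
      rcases mem_coreArcs.1 hc with h | h | h | h | h | h | h | h | h | h | h | h | h | h | h
      all_goals first
        | (rw [h.2]; simp [Triple.vars]; done)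
        | (have := h1 t'.1; have := h1 t'.2.1; have := h1 t'.2.2.1; rw [h.2] at h6; omega)
    have := hH.triple_unique (zip_fst hz).1 (zip_fst hz').1 hw hv'
    subst this
    rwa [zip_fst_inj hH.nodup_triples hz hz']

/-- The last hub is excluded because it leads to the first target. `not_arc_target` shows later that
it does not lead to any other one. -/
theorem core_of_target {v : Label} (h : (v, g) ∈ H.arcs) (hv : v ≠ (8, H.numCircles, 0)) :
    (v, g) ∈ coreArcs t g := by
  have h0 := mem_targets_fst (zip_fst hz).2
  have h8 : ∀ y, g ≠ H.ain y := by
    intro y hg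
    rcases (zip_target hz).2 with h1 | ⟨t', _, h1⟩
    · rw [h1] at hg
      by_cases hb : y.2 = H.circleSize y.1 <;> simp [ain, hb] at hg
    · have := H.ain_fst y
      rw [← hg, h1] at this; simp at this
  rcases arcs_cases h with ⟨j, hj', hv', hw'⟩ | ⟨j, hj', hv', hw'⟩ | ⟨j, hj', hv', hw'⟩ |
    ⟨l, hl, hv', hw'⟩ | ⟨l, hl, hv', hw'⟩ | ⟨hv', hw'⟩ | ⟨t', g', hz', hc⟩
  · unfold afterC at hw'
    split at hw'
    · have := pin_fst j.2.1 j.2.2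
      rw [hw'] at h0; omega
    · exact (h8 _ hw').elim
  · unfold afterP at hw'
    split at hw'
    · exact (h8 _ hw').elim
    · rw [hw'] at h0; simp [cport] at h0
  · have := H.afterA_fst j
    rw [hw'] at h0; omega
  · rw [hw'] at h0; simp at h0
  · rcases (zip_target hz).2 with h1 | ⟨t', _, h1⟩ <;> rw [h1] at hw' <;> simp at hw'
  · exact (hv hv').elim
  · have hg : g = g' := by
      rcases core_fst hc with h1 | h1 | h1 | h1
      · omega
      · exact h1.2
      · omega
      · omega
    subst hg
    rwa [zip_snd_inj hH.nodup_targets hz hz']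

theorem core_of_pin {y : Var} (hy : y ∈ t.vars) {w : Label} (h : (pin t.bit y, w) ∈ H.arcs) :
    (pin t.bit y, w) ∈ coreArcs t g := by
  have ht := (zip_fst hz).1
  have h0 := pin_fst t.bit y
  rcases arcs_cases h with ⟨j, hj', hv, hw⟩ | ⟨j, hj', hv, hw⟩ | ⟨j, hj', hv, hw⟩ |
    ⟨l, hl, hv, hw⟩ | ⟨l, hl, hv, hw⟩ | ⟨hv, hw⟩ | ⟨t', g', hz', hc⟩
  · rw [hv] at h0; simp [cport] at h0
  · have h1 := pin_eq_pout hv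
    exact (h1.1 (hH.core_pin hj' ht hy h1.2.symm).symm).elim
  · have := H.aout_fst j.1
    rw [hv] at h0; omega
  · rw [hv] at h0; simp at h0
  · rw [hv] at h0; simp at h0
  · rw [hv] at h0; simp at h0
  · have hv' : y ∈ t'.vars := by
      rcases mem_coreArcs.1 hc with h | h | h | h | h | h | h | h | h | h | h | h | h | h | h
      all_goals first
        | (rw [(pin_inj h.1).2]; simp [Triple.vars])
        | (rw [h.1] at h0; simp at h0)
    have := hH.triple_unique (zip_fst hz).1 (zip_fst hz').1 hy hv'
    subst this
    rwa [zip_fst_inj hH.nodup_triples hz hz']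

theorem core_of_pout {y : Var} (hy : y ∈ t.vars) {v : Label} (h : (v, pout t.bit y) ∈ H.arcs) :
    (v, pout t.bit y) ∈ coreArcs t g := by
  have ht := (zip_fst hz).1
  have h0 := pout_fst t.bit y
  rcases arcs_cases h with ⟨j, hj', hv, hw⟩ | ⟨j, hj', hv, hw⟩ | ⟨j, hj', hv, hw⟩ |
    ⟨l, hl, hv, hw⟩ | ⟨l, hl, hv, hw⟩ | ⟨hv, hw⟩ | ⟨t', g', hz', hc⟩
  · unfold afterC at hw
    split at hw
    · have h1 := pin_eq_pout hw.symm
      exact (h1.1 (hH.core_pin hj' ht hy h1.2)).elim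
    · have := H.ain_fst j.1
      rw [hw] at h0; omega
  · have := H.afterP_fst j
    rw [hw] at h0; omega
  · unfold afterA at hw
    split at hw
    · rw [hw] at h0; simp [cport] at h0
    · have h1 := pin_eq_pout hw.symm
      exact (h1.1 (hH.core_pin hj' ht hy h1.2)).elim
  · rw [hw] at h0; simp at h0
  · rw [hw] at h0; simp at h0
  · rcases hw with hw | hw
    · omega
    · rw [hw] at h0; simp at h0
  · have hv' : y ∈ t'.vars := by
      have h2 := mem_targets_fst (zip_fst hz').2
      rcases mem_coreArcs.1 hc with h | h | h | h | h | h | h | h | h | h | h | h | h | h | h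
      all_goals first
        | (rw [(pout_inj h.2).2]; simp [Triple.vars])
        | (rw [h.2] at h0; simp at h0)
        | (rw [h.2] at h0; omega)
    have := hH.triple_unique (zip_fst hz).1 (zip_fst hz').1 hy hv'
    subst this
    rwa [zip_fst_inj hH.nodup_triples hz hz']

end Core

end IsBermanKarpinski

end HybridInstance

/-! ### Short arcs run between different gadgets and avoid middle vertices -/

namespace HybridInstance

variable {H : HybridInstance}

theorem arcs_fst_ne {v w : Label} (h : (v, w) ∈ H.arcs) :
    v.1 ≠ 1 ∧ v.1 ≠ 4 ∧ w.1 ≠ 1 ∧ w.1 ≠ 4 := by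
  rcases arcs_cases h with ⟨j, hj, rfl, rfl⟩ | ⟨j, hj, rfl, rfl⟩ | ⟨j, hj, rfl, rfl⟩ |
    ⟨l, hl, rfl, rfl⟩ | ⟨l, hl, rfl, rfl⟩ | ⟨rfl, hw⟩ | ⟨t, g, hz, hc⟩
  · have := H.afterC_fst j
    have := H.cport_fst j.1
    omega
  · have := H.afterP_fst j
    have := pout_fst j.2.1 j.2.2
    omega
  · have := H.afterA_fst j
    have := H.aout_fst j.1
    omega
  · simp
  · simp
  · rcases hw with hw | rfl
    · simp only; omega
    · simp
  · have h1 := core_fst hc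
    have h2 := mem_targets_fst (zip_fst hz).2
    rcases h1 with h1 | ⟨h1, rfl⟩ | h1 | h1 <;> omega

theorem isMid_of_arc {v w : Label} (h : (v, w) ∈ H.arcs) : isMid v = false ∧ isMid w = false := by
  obtain ⟨h1, h2, h3, h4⟩ := arcs_fst_ne h
  simp [isMid, h1, h2, h3, h4]

theorem IsBermanKarpinski.prevVar_ne (hH : H.IsBermanKarpinski) {x : Var} (hx : x ∈ H.vars) :
    H.prevVar x ≠ x := by
  obtain ⟨l, i⟩ := x
  obtain ⟨h1, h2, h3⟩ := mem_vars.1 hx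
  have := hH.seven_le_circleSize h1
  by_cases h : i = 1 <;> simp [prevVar, h] at h2 ⊢ <;> simp only at this <;> omega

theorem IsBermanKarpinski.sameGadget_of_arc (hH : H.IsBermanKarpinski) {v w : Label}
    (h : (v, w) ∈ H.arcs) : sameGadget v w = false := by
  have key : ∀ j ∈ H.incidences, ∀ y, (y = H.ain j.1 ∨ y = H.aout j.1) →
      sameGadget (H.cport j.1) y = false ∧ sameGadget y (H.cport j.1) = false := by
    intro j hj y hy
    have h1 := hH.prevVar_ne (hH.incidence_fst_mem hj)
    rcases hy with rfl | rfl
    · by_cases hb : j.1.2 = H.circleSize j.1.1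
      · simp [sameGadget, ain, cport, hb]
      · simp [sameGadget, ain, cport, hb, h1, h1.symm]
    · by_cases hb : j.1.2 = H.circleSize j.1.1
      · simp [sameGadget, aout, cport, hb]
      · simp [sameGadget, aout, cport, hb, h1, h1.symm]
  have key2 : ∀ v w : Label, (v.1 ≤ 2 → 3 ≤ w.1) → (3 ≤ v.1 → v.1 ≤ 5 → w.1 < 3 ∨ 5 < w.1) →
      sameGadget v w = false := by
    intro v w h1 h2
    simp only [sameGadget, Bool.and_eq_false_iff, Bool.or_eq_false_iff, decide_eq_false_iff_not]
    right
    omega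
  rcases arcs_cases h with ⟨j, hj, rfl, rfl⟩ | ⟨j, hj, rfl, rfl⟩ | ⟨j, hj, rfl, rfl⟩ |
    ⟨l, hl, rfl, rfl⟩ | ⟨l, hl, rfl, rfl⟩ | ⟨rfl, hw⟩ | ⟨t, g, hz, hc⟩
  · unfold afterC
    split
    · have := pin_fst j.2.1 j.2.2
      have := H.cport_fst j.1
      exact key2 _ _ (by omega) (by omega)
    · exact (key j hj _ (Or.inl rfl)).1
  · have := H.afterP_fst j
    have := pout_fst j.2.1 j.2.2
    exact key2 _ _ (by omega) (by omega)
  · unfold afterA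
    split
    · exact (key j hj _ (Or.inr rfl)).2
    · have := pin_fst j.2.1 j.2.2
      have := H.aout_fst j.1
      exact key2 _ _ (by omega) (by omega)
  · exact key2 _ _ (by simp) (by simp)
  · exact key2 _ _ (by simp) (by simp)
  · exact key2 _ _ (by simp) (by simp)
  · have h1 := core_fst hc
    have h2 := mem_targets_fst (zip_fst hz).2
    rcases h1 with h1 | ⟨h1, rfl⟩ | h1 | h1 <;> exact key2 _ _ (by omega) (by omega)

end HybridInstance

/-! ### Lengths of tours from below -/

/-- In a gadget with path `a, b, c`, where `ab` tells whether the arc from `a` to `b` is used, and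
`ia`, `oa` whether `a` is entered and left by a short arc outside the path. -/
theorem gadget_bound {ab ba bc cb ac ca ia oa ic oc : ℤ}
    (h1 : 0 ≤ ab) (h2 : 0 ≤ ba) (h3 : 0 ≤ bc) (h4 : 0 ≤ cb) (h5 : 0 ≤ ac) (h6 : 0 ≤ ca)
    (oA : ab + ac + oa ≤ 1) (oB : ba + bc ≤ 1) (oC : ca + cb + oc ≤ 1)
    (iA : ba + ca + ia ≤ 1) (iB : ab + cb ≤ 1) (iC : ac + bc + ic ≤ 1)
    (c1 : ab + ba ≤ 1) (c2 : bc + cb ≤ 1)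
    (c4 : ab + bc + ca ≤ 2) (c5 : ac + cb + ba ≤ 2)
    {e : ℤ} (he : 6 - 2 * (ab + ba + bc + cb) - 2 * (ac + ca) - (ia + oa + ic + oc) ≤ e) :
    (oa + ic ≤ ia + oc → 2 - (ia + oc - oa - ic) ≤ e) ∧
    (ia + oc ≤ oa + ic → 2 + (ia + oc - oa - ic) ≤ e) ∧
    (ia = 1 → oc = 1 → e ≤ 1 → oa = 0 → ic = 0 → ab = 1 ∧ bc = 1) ∧
    (ic = 1 → oa = 1 → e ≤ 1 → oc = 0 → ia = 0 → cb = 1 ∧ ba = 1) := by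
  refine ⟨?_, ?_, ?_, ?_⟩ <;> omega

/-- Here `s` stands for the arcs from the start, `r` for the direct arcs, `u` and `t` for the arcs
into and out of the parity gadgets, `e` for the exits; `b` marks the gadgets left to the core, and
`p` is what they pay. If an odd number of gadgets is left to the core and the price is below 2, the
counts of arcs force a closed pattern: the triangle of direct arcs, one gadget with the direct arc
back, or the round through all three gadgets. -/
theorem core_bound {s1 s2 s3 r1 r2 r3 u1 u2 u3 t1 t2 t3 e1 e2 e3 : ℤ}
    (hs1 : 0 ≤ s1) (hs2 : 0 ≤ s2) (hs3 : 0 ≤ s3) (hr1 : 0 ≤ r1) (hr2 : 0 ≤ r2) (hr3 : 0 ≤ r3)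
    (hu1 : 0 ≤ u1) (hu2 : 0 ≤ u2) (hu3 : 0 ≤ u3) (ht1 : 0 ≤ t1) (ht2 : 0 ≤ t2) (ht3 : 0 ≤ t3)
    (he1 : 0 ≤ e1) (he2 : 0 ≤ e2) (he3 : 0 ≤ e3)
    (hs : s1 + s2 + s3 ≤ 1) (ho1 : u1 + r1 + e1 ≤ 1) (ho2 : u2 + r2 + e2 ≤ 1)
    (ho3 : u3 + r3 + e3 ≤ 1) (hi1 : t3 + s1 + r2 ≤ 1) (hi2 : t1 + s2 + r3 ≤ 1)
    (hi3 : t2 + s3 + r1 ≤ 1) (he : e1 + e2 + e3 ≤ 1) (ht1' : t1 ≤ 1) (ht2' : t2 ≤ 1)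
    (ht3' : t3 ≤ 1)
    {p1 p2 p3 : ℤ} {b1 b2 b3 : Bool} (hb : (b1 ^^ (b2 ^^ b3)) = true)
    (hp1 : (if b1 then 2 - u1 - t1 else u1 + t1) ≤ p1)
    (hp2 : (if b2 then 2 - u2 - t2 else u2 + t2) ≤ p2)
    (hp3 : (if b3 then 2 - u3 - t3 else u3 + t3) ≤ p3)
    (hK : p1 + p2 + p3 + (1 - (s1 + s2 + s3)) + (2 - (u1 + r1 + e1) - (t3 + s1 + r2)) +
      (2 - (u2 + r2 + e2) - (t1 + s2 + r3)) + (2 - (u3 + r3 + e3) - (t2 + s3 + r1)) +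
      (1 - (e1 + e2 + e3)) ≤ 1) :
    (r1 = 1 ∧ r2 = 1 ∧ r3 = 1) ∨ (b1 = true ∧ u1 = 1 ∧ t1 = 1 ∧ r2 = 1) ∨
    (b2 = true ∧ u2 = 1 ∧ t2 = 1 ∧ r3 = 1) ∨ (b3 = true ∧ u3 = 1 ∧ t3 = 1 ∧ r1 = 1) ∨
    (b1 = true ∧ b2 = true ∧ b3 = true ∧ u1 = 1 ∧ t1 = 1 ∧ u2 = 1 ∧ t2 = 1 ∧ u3 = 1 ∧ t3 = 1) := by
  cases b1 <;> cases b2 <;> cases b3 <;> simp at hb hp1 hp2 hp3 ⊢ <;> omega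

/-- The permutation `π` follows a cycle through all vertices. -/
structure HybridInstance.IsTourPerm (H : HybridInstance) (π : Equiv.Perm Label) : Prop where
  mem : ∀ v ∈ H.labels, π v ∈ H.labels
  cycle : ∀ S : Set Label, (∀ v ∈ S, π v ∈ S) → (∃ v ∈ S, v ∈ H.labels) → (8, 0, 0) ∈ S

/-! ### Excess and direction of the gadgets for a tour given as a permutation -/

section Flow

variable (H : HybridInstance) (π : Equiv.Perm Label)

/-- Whether `w` follows on `v`. -/
def used (v w : Label) : ℤ := if π v = w then 1 else 0

/-- Whether `v` is left by a short arc outside the paths. -/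
def outArc (v : Label) : ℤ := if (v, π v) ∈ H.arcs then 1 else 0

/-- Whether `v` is entered by a short arc outside the paths. -/
def inArc (v : Label) : ℤ := if (π⁻¹ v, v) ∈ H.arcs then 1 else 0

/-- The excess length at the gadget with first vertex `(k, x)`. -/
def excess (k : ℕ) (x : Var) : ℤ :=
  6 - 2 * (used π (k, x) (k + 1, x) + used π (k + 1, x) (k, x) + used π (k + 1, x) (k + 2, x) +
      used π (k + 2, x) (k + 1, x)) -
    2 * (used π (k, x) (k + 2, x) + used π (k + 2, x) (k, x)) -
    (inArc H π (k, x) + outArc H π (k, x) + inArc H π (k + 2, x) + outArc H π (k + 2, x))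

/-- The direction in which a gadget is traversed. -/
def direction (k : ℕ) (x : Var) : Bool :=
  decide (outArc H π (k, x) + inArc H π (k + 2, x) ≤ inArc H π (k, x) + outArc H π (k + 2, x))

variable {H π}

theorem used_nonneg (v w : Label) : 0 ≤ used π v w := by
  unfold used; split <;> simp

theorem used_le_one (v w : Label) : used π v w ≤ 1 := by
  unfold used; split <;> simp

theorem used_eq_one {v w : Label} : used π v w = 1 ↔ π v = w := by
  unfold used; split <;> simp_all

theorem outArc_nonneg (v : Label) : 0 ≤ outArc H π v := by
  unfold outArc; split <;> simp

theorem outArc_le_one (v : Label) : outArc H π v ≤ 1 := by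
  unfold outArc; split <;> simp

theorem inArc_nonneg (v : Label) : 0 ≤ inArc H π v := by
  unfold inArc; split <;> simp

theorem inArc_le_one (v : Label) : inArc H π v ≤ 1 := by
  unfold inArc; split <;> simp

theorem used_add_outArc_le {v w w' : Label} (hw : w ≠ w') (h : (v, w) ∉ H.arcs)
    (h' : (v, w') ∉ H.arcs) : used π v w + used π v w' + outArc H π v ≤ 1 := by
  unfold used outArc
  split_ifs <;> simp_all

theorem used_add_inArc_le {v v' w : Label} (hv : v ≠ v') (h : (v, w) ∉ H.arcs)
    (h' : (v', w) ∉ H.arcs) : used π v w + used π v' w + inArc H π w ≤ 1 := by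
  have e : ∀ v, π v = w ↔ π⁻¹ w = v := fun v => by rw [Equiv.Perm.inv_eq_iff_eq, eq_comm]
  unfold used inArc
  simp only [e]
  split_ifs <;> simp_all

theorem outArc_eq {v w : Label} (h : ∀ w', (v, w') ∈ H.arcs ↔ w' = w) :
    outArc H π v = used π v w := by
  simp only [outArc, used, h]

theorem inArc_eq {v w : Label} (h : ∀ v', (v', w) ∈ H.arcs ↔ v' = v) :
    inArc H π w = used π v w := by
  have e : π v = w ↔ π⁻¹ w = v := by rw [Equiv.Perm.inv_eq_iff_eq, eq_comm]
  simp only [inArc, used, h, e]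

theorem outArc_eq_add {v w₁ w₂ : Label} (h : ∀ w', (v, w') ∈ H.arcs ↔ w' = w₁ ∨ w' = w₂)
    (hw : w₁ ≠ w₂) : outArc H π v = used π v w₁ + used π v w₂ := by
  simp only [outArc, used, h]
  split_ifs <;> simp_all

theorem inArc_eq_add {v₁ v₂ w : Label} (h : ∀ v', (v', w) ∈ H.arcs ↔ v' = v₁ ∨ v' = v₂)
    (hv : v₁ ≠ v₂) : inArc H π w = used π v₁ w + used π v₂ w := by
  have e : ∀ v, π v = w ↔ π⁻¹ w = v := fun v => by rw [Equiv.Perm.inv_eq_iff_eq, eq_comm]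
  simp only [inArc, used, h, e]
  split_ifs <;> simp_all

end Flow

namespace HybridInstance

variable {H : HybridInstance} {π : Equiv.Perm Label}

/-- The form in which subtours are ruled out: a finite set of vertices without the first hub is
never closed under `π`. -/
theorem IsTourPerm.not_closed (hπ : H.IsTourPerm π) (l : List Label) (hl : ∀ v ∈ l, π v ∈ l)
    {v : Label} (hv : v ∈ l) (hm : v ∈ H.labels) (h8 : ((8, 0, 0) : Label) ∉ l) : False :=
  h8 (hπ.cycle {v | v ∈ l} hl ⟨v, hv, hm⟩)

/-- A gadget of the construction. -/
def IsGadget (H : HybridInstance) (k : ℕ) (x : Var) : Prop :=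
  (k = 0 ∧ x ∈ H.vars) ∨ (k = 3 ∧ x ∈ H.pnames)

theorem IsGadget.mem_labels {k : ℕ} {x : Var} (h : H.IsGadget k x) {v : Label}
    (hv : v ∈ path k x) : v ∈ H.labels := by
  simp only [labels, List.mem_append, List.mem_flatMap]
  rcases h with ⟨rfl, h⟩ | ⟨rfl, h⟩
  · exact Or.inl (Or.inl (Or.inr ⟨x, h, hv⟩))
  · exact Or.inl (Or.inr ⟨x, h, hv⟩)

/-- Supplies `gadget_bound` with its hypotheses. Every vertex is entered and left once, and cycles
of two or three vertices inside a gadget would be subtours. -/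
theorem IsGadget.path_bound (hH : H.IsBermanKarpinski) (hπ : H.IsTourPerm π) {k : ℕ} {x : Var}
    (h : H.IsGadget k x) {e : ℤ} (he : excess H π k x ≤ e) :
    (outArc H π (k, x) + inArc H π (k + 2, x) ≤ inArc H π (k, x) + outArc H π (k + 2, x) →
      2 - (inArc H π (k, x) + outArc H π (k + 2, x) - outArc H π (k, x) - inArc H π (k + 2, x))
        ≤ e) ∧
    (inArc H π (k, x) + outArc H π (k + 2, x) ≤ outArc H π (k, x) + inArc H π (k + 2, x) →
      2 + (inArc H π (k, x) + outArc H π (k + 2, x) - outArc H π (k, x) - inArc H π (k + 2, x))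
        ≤ e) ∧
    (inArc H π (k, x) = 1 → outArc H π (k + 2, x) = 1 → e ≤ 1 → outArc H π (k, x) = 0 →
      inArc H π (k + 2, x) = 0 →
      used π (k, x) (k + 1, x) = 1 ∧ used π (k + 1, x) (k + 2, x) = 1) ∧
    (inArc H π (k + 2, x) = 1 → outArc H π (k, x) = 1 → e ≤ 1 → outArc H π (k + 2, x) = 0 →
      inArc H π (k, x) = 0 →
      used π (k + 2, x) (k + 1, x) = 1 ∧ used π (k + 1, x) (k, x) = 1) := by
  have hk : k = 0 ∨ k = 3 := by rcases h with h | h <;> simp [h.1]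
  have hab : ∀ v ∈ path k x, ∀ w ∈ path k x, (v, w) ∉ H.arcs := by
    intro v hv w hw ha
    have := hH.sameGadget_of_arc ha
    simp only [path, List.mem_cons, List.not_mem_nil, or_false] at hv hw
    rcases hk with rfl | rfl <;> rcases hv with rfl | rfl | rfl <;>
      rcases hw with rfl | rfl | rfl <;> simp [sameGadget] at this
  have ma : (k, x) ∈ path k x := by simp [path]
  have mb : (k + 1, x) ∈ path k x := by simp [path]
  have mc : (k + 2, x) ∈ path k x := by simp [path]
  have nab : ((k, x) : Label) ≠ (k + 1, x) := by simp
  have nac : ((k, x) : Label) ≠ (k + 2, x) := by simp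
  have nbc : ((k + 1, x) : Label) ≠ (k + 2, x) := by simp
  have hk8 : k ≠ 8 ∧ k + 1 ≠ 8 ∧ k + 2 ≠ 8 := by omega
  have two : ∀ v ∈ path k x, ∀ w ∈ path k x, used π v w + used π w v ≤ 1 := by
    intro v hv w hw
    by_contra hc
    have l1 := used_le_one (π := π) v w
    have l2 := used_le_one (π := π) w v
    have e1 : π v = w := used_eq_one.1 (by omega)
    have e2 : π w = v := used_eq_one.1 (by omega)
    refine hπ.not_closed [v, w] (by simp [e1, e2]) (v := v) (by simp) (h.mem_labels hv) ?_
    rw [mem_path] at hv hw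
    simp only [List.mem_cons, List.not_mem_nil, or_false, not_or]
    constructor <;> rintro rfl <;> simp at hv hw <;> omega
  have three : ∀ u ∈ path k x, ∀ v ∈ path k x, ∀ w ∈ path k x,
      used π u v + used π v w + used π w u ≤ 2 := by
    intro u hu v hv w hw
    by_contra hc
    have l1 := used_le_one (π := π) u v
    have l2 := used_le_one (π := π) v w
    have l3 := used_le_one (π := π) w u
    have e1 : π u = v := used_eq_one.1 (by omega)
    have e2 : π v = w := used_eq_one.1 (by omega)
    have e3 : π w = u := used_eq_one.1 (by omega)
    refine hπ.not_closed [u, v, w] (by simp [e1, e2, e3]) (v := u) (by simp) (h.mem_labels hu) ?_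
    rw [mem_path] at hu hv hw
    simp only [List.mem_cons, List.not_mem_nil, or_false, not_or]
    refine ⟨?_, ?_, ?_⟩ <;> rintro rfl <;> simp at hu hv hw <;> omega
  have oB := used_add_outArc_le (π := π) nac (hab _ mb _ ma) (hab _ mb _ mc)
  have iB := used_add_inArc_le (π := π) nac (hab _ ma _ mb) (hab _ mc _ mb)
  have := outArc_nonneg (H := H) (π := π) (k + 1, x)
  have := inArc_nonneg (H := H) (π := π) (k + 1, x)
  refine gadget_bound (used_nonneg _ _) (used_nonneg _ _) (used_nonneg _ _) (used_nonneg _ _)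
    (used_nonneg (k, x) (k + 2, x)) (used_nonneg (k + 2, x) (k, x))
    (used_add_outArc_le nbc (hab _ ma _ mb) (hab _ ma _ mc)) (by omega)
    (used_add_outArc_le nab (hab _ mc _ ma) (hab _ mc _ mb))
    (used_add_inArc_le nbc (hab _ mb _ ma) (hab _ mc _ ma)) (by omega)
    (used_add_inArc_le nab (hab _ ma _ mc) (hab _ mb _ mc))
    (two _ ma _ mb) (two _ mb _ mc) (three _ ma _ mb _ mc) (three _ ma _ mc _ mb) ?_
  unfold excess at he
  linarith

end HybridInstance

/-- The sign of a truth value. -/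
def sgn (b : Bool) : ℤ := if b then 1 else -1

/-! ### Sharing the excess out among junctions and ports -/

section Terms

variable (H : HybridInstance) (π : Equiv.Perm Label)

/-- The excess length at the circle gadgets on both sides of `x`, and at the vertices between the
circles. -/
def circleTerm (x : Var) : ℤ :=
  (1 - sgn (direction H π 0 (H.prevVar x)) *
    (outArc H π (2, H.prevVar x) - inArc H π (2, H.prevVar x))) +
  (1 - sgn (direction H π 0 x) * (inArc H π (0, x) - outArc H π (0, x))) +
  if x.2 = H.circleSize x.1 then
    (1 - outArc H π (8, x.1, 0)) + (1 - inArc H π (8, x.1 + 1, 0)) else 0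

/-- The excess length at the parity gadget `p` that is charged to its visit by a circle. -/
def portTerm (b : Bool) (p : Var) : ℤ :=
  1 + sgn (direction H π 3 p == b) -
    sgn (direction H π 3 p == b) * (inArc H π (pin b p) + outArc H π (pout b p))

end Terms

namespace HybridInstance.IsBermanKarpinski

variable {H : HybridInstance} {π : Equiv.Perm Label}

/-- Away from the border, every short arc of the junction is counted at both of its ends, so its
coefficient is, up to sign, the sum of the signs of the two gadgets that it joins. It vanishes if
they disagree, and otherwise it is 2 or −2; at most one arc can then still lower the sum, and at
least 2 remains. At the border the two hubs take the place of one vertex, and their defects are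
included in the term. -/
theorem junction_bound (hH : H.IsBermanKarpinski) {x p : Var} {b : Bool}
    (hj : (x, b, p) ∈ H.incidences) :
    (if direction H π 0 (H.prevVar x) = direction H π 0 x ∧ direction H π 0 x = direction H π 3 p
      then 0 else 2) ≤ circleTerm H π x + portTerm H π b p ∧
    (direction H π 3 p ≠ b → 1 ≤ inArc H π (pin b p) + outArc H π (pout b p) →
      2 ≤ circleTerm H π x + portTerm H π b p) := by
  have hx := mem_vars.1 (hH.incidence_fst_mem hj)
  have oc := outArc_eq (π := π) fun w => hH.out_cport hj (w := w)
  have ic := inArc_eq (π := π) fun v => hH.in_cport hj (v := v)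
  have ip := inArc_eq (π := π) fun v => hH.in_pin hj (v := v)
  have op := outArc_eq (π := π) fun w => hH.out_pout hj (w := w)
  unfold circleTerm portTerm
  simp only [cport] at oc ic ip op
  rw [oc, ic, ip, op]
  by_cases hb : x.2 = H.circleSize x.1
  · have ex : x = (x.1, H.circleSize x.1) := by rw [← hb]
    have oh := outArc_eq_add (π := π) (v := H.aout x) (w₁ := H.afterA (x, b, p)) (w₂ := (0, x))
      (fun w => by rw [hH.out_aout hj]; simp [hb])
      (fun h => (H.afterA_fst (x, b, p)).1 (by rw [h]))
    have ih := inArc_eq_add (π := π) (w := H.ain x) (v₁ := if b then pout b p else H.cport x)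
      (v₂ := (0, x)) (fun v => by rw [hH.in_ain hj]; simp [hb]) (by
        have := pout_fst b p
        intro h
        cases b
        · simp [cport] at h
        · simp only [if_true] at h; rw [h] at this; simp at this)
    have oa := outArc_eq (π := π) (v := (0, x)) (w := (8, x.1 + 1, 0)) (fun w => by
      rw [ex]; exact out_border hx.1)
    have ia := inArc_eq (π := π) (w := (0, x)) (v := (8, x.1, 0)) (fun v => by
      rw [ex]; exact in_border hx.1)
    simp only [ain, aout, hb, decide_true, if_true] at oh ih
    rw [if_pos hb, oh, ih, oa, ia]
    simp only [afterA, afterC, afterP, ain, aout, hb, decide_true, if_true]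
    generalize direction H π 0 (H.prevVar x) = d₁
    generalize direction H π 0 x = d₂
    generalize direction H π 3 p = d₃
    have n1 := used_nonneg (π := π) (8, x.1, 0) (0, x)
    have n2 := used_nonneg (π := π) (0, x) (8, x.1 + 1, 0)
    have n3 := used_le_one (π := π) (8, x.1, 0) (0, x)
    have n4 := used_le_one (π := π) (0, x) (8, x.1 + 1, 0)
    have o1 := outArc_le_one (H := H) (π := π) (8, x.1, 0)
    have o2 := inArc_le_one (H := H) (π := π) (8, x.1 + 1, 0)
    rw [oh] at o1
    rw [ih] at o2
    simp only [afterA] at o1 o2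
    cases b
    · have m1 := used_nonneg (π := π) (8, x.1, 0) (pin false p)
      have m2 := used_nonneg (π := π) (pout false p) (2, H.prevVar x)
      have m3 := used_nonneg (π := π) (2, H.prevVar x) (8, x.1 + 1, 0)
      have m4 := used_le_one (π := π) (pout false p) (2, H.prevVar x)
      simp [cport, -sub_nonneg] at o1 o2 ⊢
      cases d₁ <;> cases d₂ <;> cases d₃ <;> simp [sgn, -sub_nonneg] <;> omega
    · have m1 := used_nonneg (π := π) (8, x.1, 0) (2, H.prevVar x)
      have m2 := used_nonneg (π := π) (pout true p) (8, x.1 + 1, 0)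
      have m3 := used_nonneg (π := π) (2, H.prevVar x) (pin true p)
      have m4 := used_le_one (π := π) (2, H.prevVar x) (pin true p)
      simp [cport, -sub_nonneg] at o1 o2 ⊢
      cases d₁ <;> cases d₂ <;> cases d₃ <;> simp [sgn, -sub_nonneg] <;> omega
  · have oa := outArc_eq (π := π) (v := H.aout x) (w := H.afterA (x, b, p))
      (fun w => by rw [hH.out_aout hj]; simp [hb])
    have ia := inArc_eq (π := π) (w := H.ain x) (v := if b then pout b p else H.cport x)
      (fun v => by rw [hH.in_ain hj]; simp [hb])
    simp only [ain, aout, hb, decide_false, Bool.false_eq_true, if_false] at oa ia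
    rw [if_neg hb, oa, ia]
    simp only [afterA, afterC, afterP, ain, aout, hb, decide_false, Bool.false_eq_true, if_false,
      cport]
    generalize direction H π 0 (H.prevVar x) = d₁
    generalize direction H π 0 x = d₂
    generalize direction H π 3 p = d₃
    cases b
    · have m1 := used_nonneg (π := π) (2, H.prevVar x) (0, x)
      have m2 := used_nonneg (π := π) (pout false p) (2, H.prevVar x)
      have m3 := used_nonneg (π := π) (0, x) (pin false p)
      have m4 := used_le_one (π := π) (2, H.prevVar x) (0, x)
      have m5 := used_le_one (π := π) (pout false p) (2, H.prevVar x)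
      have m6 := used_le_one (π := π) (0, x) (pin false p)
      simp [-sub_nonneg]
      cases d₁ <;> cases d₂ <;> cases d₃ <;> simp [sgn, -sub_nonneg] <;> omega
    · have m1 := used_nonneg (π := π) (2, H.prevVar x) (pin true p)
      have m2 := used_nonneg (π := π) (pout true p) (0, x)
      have m3 := used_nonneg (π := π) (0, x) (2, H.prevVar x)
      have m4 := used_le_one (π := π) (2, H.prevVar x) (pin true p)
      have m5 := used_le_one (π := π) (pout true p) (0, x)
      have m6 := used_le_one (π := π) (0, x) (2, H.prevVar x)
      simp [-sub_nonneg]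
      cases d₁ <;> cases d₂ <;> cases d₃ <;> simp [sgn, -sub_nonneg] <;> omega

end HybridInstance.IsBermanKarpinski

/-- The excess length at the core of the equation `t`; `g` is the vertex that follows. -/
def coreTerm (H : HybridInstance) (π : Equiv.Perm Label) (t : Triple) (g : Label) : ℤ :=
  (1 - outArc H π (7, t.1)) + (2 - outArc H π (6, t.1) - inArc H π (6, t.1)) +
    (2 - outArc H π (6, t.2.1) - inArc H π (6, t.2.1)) +
    (2 - outArc H π (6, t.2.2.1) - inArc H π (6, t.2.2.1)) + (1 - inArc H π g)

/-! ### Balance at the cores -/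

section

variable {H : HybridInstance} {π : Equiv.Perm Label}

theorem outArc_le_of {v w₁ w₂ w₃ : Label}
    (h : ∀ w, (v, w) ∈ H.arcs → w = w₁ ∨ w = w₂ ∨ w = w₃) :
    outArc H π v ≤ used π v w₁ + used π v w₂ + used π v w₃ := by
  have h' := h (π v)
  unfold outArc used
  split_ifs <;> simp_all

theorem inArc_le_of {v₁ v₂ v₃ w : Label}
    (h : ∀ v, (v, w) ∈ H.arcs → v = v₁ ∨ v = v₂ ∨ v = v₃) :
    inArc H π w ≤ used π v₁ w + used π v₂ w + used π v₃ w := by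
  have h' := h (π⁻¹ w)
  have e : ∀ v, π v = w ↔ π⁻¹ w = v := fun v => by rw [Equiv.Perm.inv_eq_iff_eq, eq_comm]
  simp only [inArc, used, e]
  clear h e
  split_ifs <;> simp_all

theorem used_out_le {v w₁ w₂ w₃ : Label} (h₁ : w₁ ≠ w₂) (h₂ : w₁ ≠ w₃) (h₃ : w₂ ≠ w₃) :
    used π v w₁ + used π v w₂ + used π v w₃ ≤ 1 := by
  unfold used
  split_ifs <;> simp_all

theorem used_in_le {v₁ v₂ v₃ w : Label} (h₁ : v₁ ≠ v₂) (h₂ : v₁ ≠ v₃) (h₃ : v₂ ≠ v₃) :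
    used π v₁ w + used π v₂ w + used π v₃ w ≤ 1 := by
  have e : ∀ v, π v = w ↔ π⁻¹ w = v := fun v => by rw [Equiv.Perm.inv_eq_iff_eq, eq_comm]
  simp only [used, e]
  split_ifs <;> simp_all

end

namespace HybridInstance

variable {H : HybridInstance} {π : Equiv.Perm Label} (hH : H.IsBermanKarpinski)
  (hπ : H.IsTourPerm π)

include hH hπ

theorem IsGadget.le_excess {k : ℕ} {x : Var} (h : H.IsGadget k x) :
    2 - sgn (direction H π k x) * (inArc H π (k, x) + outArc H π (k + 2, x) -
      outArc H π (k, x) - inArc H π (k + 2, x)) ≤ excess H π k x := by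
  obtain ⟨h1, h2, -, -⟩ := h.path_bound hH hπ le_rfl
  by_cases hd : outArc H π (k, x) + inArc H π (k + 2, x) ≤ inArc H π (k, x) + outArc H π (k + 2, x)
  · have := h1 hd
    simp only [direction, hd, decide_true, sgn, if_true]
    linarith
  · have := h2 (by linarith)
    simp only [direction, hd, decide_false, sgn]
    simp only [Bool.false_eq_true, if_false]
    linarith

/-- A parity gadget has two users, one for each direction, and its excess is divided between them. A
user pays for arcs missing in the direction of the gadget, and for arcs used against that direction.
-/
theorem port_le_excess {p : Var} (h : p ∈ H.pnames) (b : Bool) :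
    portTerm H π b p + portTerm H π (!b) p ≤ excess H π 3 p := by
  have := IsGadget.le_excess hH hπ (Or.inr ⟨rfl, h⟩)
  unfold portTerm
  generalize direction H π 3 p = d at this ⊢
  cases b <;> cases d <;> simp [sgn, pin, pout, -sub_nonneg] at this ⊢ <;> linarith

/-- The share of the core: a gadget left to the core pays for each of its two core arcs that is
missing, any other gadget for each one that is used. -/
theorem tick_le_excess {p : Var} (h : p ∈ H.pnames) (b : Bool) :
    (if direction H π 3 p ^^ b then 2 - inArc H π (pout b p) - outArc H π (pin b p)
      else inArc H π (pout b p) + outArc H π (pin b p)) ≤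
      excess H π 3 p - portTerm H π b p := by
  have := port_le_excess hH hπ h b
  refine le_sub_iff_add_le'.2 (le_trans (le_of_eq ?_) this)
  unfold portTerm
  generalize direction H π 3 p = d at this ⊢
  cases b <;> cases d <;> simp [sgn, pin, pout, -sub_nonneg] <;> ring

/-- A gadget that only the core touches, at a cost below 2, is really run through. Thus the core
arcs at its two ends are linked inside it, which `core_flow` needs in order to close a subtour. -/
theorem traversed {p : Var} (h : p ∈ H.pnames) {b : Bool} (hd : (direction H π 3 p ^^ b) = true)
    (h0 : inArc H π (pin b p) + outArc H π (pout b p) ≤ 0) (hi : inArc H π (pout b p) = 1)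
    (ho : outArc H π (pin b p) = 1) (he : excess H π 3 p - portTerm H π b p ≤ 1) :
    π (pout b p) = (4, p) ∧ π (4, p) = pin b p := by
  obtain ⟨-, -, h3, h4⟩ := IsGadget.path_bound hH hπ (Or.inr ⟨rfl, h⟩) le_rfl (k := 3)
  have n1 := inArc_nonneg (H := H) (π := π) (pin b p)
  have n2 := outArc_nonneg (H := H) (π := π) (pout b p)
  have e1 : inArc H π (pin b p) = 0 := by omega
  have e2 : outArc H π (pout b p) = 0 := by omega
  unfold portTerm at he
  rw [e1, e2] at he
  generalize direction H π 3 p = d at hd he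
  cases b <;> cases d <;> simp [sgn, pin, pout] at *
  · exact (h3 hi ho he e2 e1).imp used_eq_one.1 used_eq_one.1
  · exact (h4 hi ho he e2 e1).imp used_eq_one.1 used_eq_one.1

omit hπ in
theorem not_arc_target {t : Triple} {g : Label} (hz : (t, g) ∈ H.triples.zip (H.targets.drop 1)) :
    ((8, H.numCircles, 0), g) ∉ H.arcs := by
  intro h
  have hn := hH.nodup_targets
  have hg : g ∈ H.targets.drop 1 := (List.of_mem_zip hz).2
  rcases mem_arcs.1 h with ⟨j, hj, ⟨hv, _⟩ | ⟨hv, _⟩ | ⟨hv, _⟩⟩ | ⟨l, hl, ⟨hv, _⟩ | ⟨hv, _⟩⟩ |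
    ⟨-, hfirst⟩ | ⟨t', g', hz', hc⟩
  · simp [cport] at hv
  · have := pout_fst j.2.1 j.2.2; rw [← hv] at this; simp at this
  · have hx := (mem_vars.1 (hH.incidence_fst_mem hj)).1
    unfold aout at hv
    split at hv
    · simp only [Prod.mk.injEq, true_and, and_true] at hv; omega
    · simp at hv
  · simp only [Prod.mk.injEq, true_and, and_true] at hv; omega
  · simp at hv
  · cases ht : H.targets with
    | nil => rw [ht] at hg; simp at hg
    | cons a l =>
      rw [ht] at hg hfirst hn
      simp only [List.getD_cons_zero, List.drop_succ_cons, List.drop_zero] at hg hfirst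
      rw [List.nodup_cons] at hn
      exact hn.1 (hfirst ▸ hg)
  · have := core_fst hc; simp at this

end HybridInstance

namespace HybridInstance

variable {H : HybridInstance} {π : Equiv.Perm Label}

/-- Flow conservation at a core with vertices `x, y, z`, whose short arcs are the given ones. -/
theorem core_flow (hπ : H.IsTourPerm π) {x y z : Var} {b : Bool} {g s : Label} (hs : s.1 = 7)
    (nxy : x ≠ y) (nxz : x ≠ z) (nyz : y ≠ z) (hg : g.1 = 7 ∨ g.1 = 8)
    (mV : ∀ v, v = x ∨ v = y ∨ v = z → ((6, v) : Label) ∈ H.labels)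
    (cS : ∀ w, (s, w) ∈ H.arcs → w = (6, x) ∨ w = (6, y) ∨ w = (6, z))
    (cg : ∀ v, (v, g) ∈ H.arcs → v = (6, x) ∨ v = (6, y) ∨ v = (6, z))
    (cox : ∀ w, ((6, x), w) ∈ H.arcs → w = pout b x ∨ w = (6, z) ∨ w = g)
    (coy : ∀ w, ((6, y), w) ∈ H.arcs → w = pout b y ∨ w = (6, x) ∨ w = g)
    (coz : ∀ w, ((6, z), w) ∈ H.arcs → w = pout b z ∨ w = (6, y) ∨ w = g)
    (cix : ∀ v, (v, (6, x)) ∈ H.arcs → v = pin b z ∨ v = s ∨ v = (6, y))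
    (ciy : ∀ v, (v, (6, y)) ∈ H.arcs → v = pin b x ∨ v = s ∨ v = (6, z))
    (ciz : ∀ v, (v, (6, z)) ∈ H.arcs → v = pin b y ∨ v = s ∨ v = (6, x))
    (ipx : inArc H π (pout b x) = used π (6, x) (pout b x))
    (ipy : inArc H π (pout b y) = used π (6, y) (pout b y))
    (ipz : inArc H π (pout b z) = used π (6, z) (pout b z))
    (oqx : outArc H π (pin b x) = used π (pin b x) (6, y))
    (oqy : outArc H π (pin b y) = used π (pin b y) (6, z))
    (oqz : outArc H π (pin b z) = used π (pin b z) (6, x))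
    {b1 b2 b3 : Bool} {p1 p2 p3 : ℤ}
    (kx : (if b1 then 2 - inArc H π (pout b x) - outArc H π (pin b x)
      else inArc H π (pout b x) + outArc H π (pin b x)) ≤ p1)
    (ky : (if b2 then 2 - inArc H π (pout b y) - outArc H π (pin b y)
      else inArc H π (pout b y) + outArc H π (pin b y)) ≤ p2)
    (kz : (if b3 then 2 - inArc H π (pout b z) - outArc H π (pin b z)
      else inArc H π (pout b z) + outArc H π (pin b z)) ≤ p3) :
    0 ≤ p1 + p2 + p3 + ((1 - outArc H π s) + (2 - outArc H π (6, x) - inArc H π (6, x)) +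
        (2 - outArc H π (6, y) - inArc H π (6, y)) +
        (2 - outArc H π (6, z) - inArc H π (6, z)) + (1 - inArc H π g)) ∧
      ((b1 ^^ (b2 ^^ b3)) = true →
        (b1 = true → inArc H π (pout b x) = 1 → outArc H π (pin b x) = 1 → p1 ≤ 1 →
          π (pout b x) = (4, x) ∧ π (4, x) = pin b x) →
        (b2 = true → inArc H π (pout b y) = 1 → outArc H π (pin b y) = 1 → p2 ≤ 1 →
          π (pout b y) = (4, y) ∧ π (4, y) = pin b y) →
        (b3 = true → inArc H π (pout b z) = 1 → outArc H π (pin b z) = 1 → p3 ≤ 1 →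
          π (pout b z) = (4, z) ∧ π (4, z) = pin b z) →
        2 ≤ p1 + p2 + p3 + ((1 - outArc H π s) + (2 - outArc H π (6, x) - inArc H π (6, x)) +
          (2 - outArc H π (6, y) - inArc H π (6, y)) +
          (2 - outArc H π (6, z) - inArc H π (6, z)) + (1 - inArc H π g))) := by
  have q8 : ∀ y, (pin b y).1 ≠ 6 ∧ (pin b y).1 ≠ 7 ∧ (pin b y).1 ≠ 8 ∧ (pout b y).1 ≠ 6 ∧
      (pout b y).1 ≠ 7 ∧ (pout b y).1 ≠ 8 := by
    intro y; have := pin_fst b y; have := pout_fst b y; omega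
  have n6 : ∀ x p, pin b p ≠ ((6, x) : Label) := fun x p h => (q8 p).1 (by rw [h])
  have n6' : ∀ x p, pout b p ≠ ((6, x) : Label) := fun x p h => (q8 p).2.2.2.1 (by rw [h])
  have n7 : ∀ p, pin b p ≠ s := fun p h => (q8 p).2.1 (by rw [h, hs])
  have gp : ∀ p, pout b p ≠ g := fun p h => by have := q8 p; rw [h] at this; omega
  have g6 : ∀ x, ((6, x) : Label) ≠ g := fun x h => by rw [← h] at hg; simp at hg
  have e4 : ∀ v, s ≠ ((6, v) : Label) := fun v h => by rw [h] at hs; simp at hs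
  have e1 : ((6, x) : Label) ≠ (6, y) := by simpa using nxy
  have e2 : ((6, x) : Label) ≠ (6, z) := by simpa using nxz
  have e3 : ((6, y) : Label) ≠ (6, z) := by simpa using nyz
  have oS := outArc_le_of (π := π) cS
  have ig := inArc_le_of (π := π) cg
  have ox := outArc_le_of (π := π) cox
  have oy := outArc_le_of (π := π) coy
  have oz := outArc_le_of (π := π) coz
  have ix := inArc_le_of (π := π) cix
  have iy := inArc_le_of (π := π) ciy
  have iz := inArc_le_of (π := π) ciz
  have bS := used_out_le (π := π) (v := s) e1 e2 e3
  have bg := used_in_le (π := π) (w := g) e1 e2 e3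
  have box := used_out_le (π := π) (v := (6, x)) (n6' z x) (gp x) (g6 z)
  have boy := used_out_le (π := π) (v := (6, y)) (n6' x y) (gp y) (g6 x)
  have boz := used_out_le (π := π) (v := (6, z)) (n6' y z) (gp z) (g6 y)
  have bix := used_in_le (π := π) (w := (6, x)) (n7 z) (n6 y z) (e4 y)
  have biy := used_in_le (π := π) (w := (6, y)) (n7 x) (n6 z x) (e4 z)
  have biz := used_in_le (π := π) (w := (6, z)) (n7 y) (n6 x y) (e4 x)
  rw [ipx, oqx] at kx ⊢
  rw [ipy, oqy] at ky ⊢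
  rw [ipz, oqz] at kz ⊢
  clear cS cg cox coy coz cix ciy ciz ipx ipy ipz oqx oqy oqz
  have nn : ∀ v w, 0 ≤ used π v w := used_nonneg
  have pos : ∀ {b : Bool} {u t p : ℤ}, 0 ≤ u → 0 ≤ t → u ≤ 1 → t ≤ 1 →
      (if b then 2 - u - t else u + t) ≤ p → 0 ≤ p := by
    intro b u t p h1 h2 h3 h4 h
    split_ifs at h <;> omega
  have q1 := pos (nn _ _) (nn _ _) (used_le_one _ _) (used_le_one _ _) kx
  have q2 := pos (nn _ _) (nn _ _) (used_le_one _ _) (used_le_one _ _) ky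
  have q3 := pos (nn _ _) (nn _ _) (used_le_one _ _) (used_le_one _ _) kz
  refine ⟨by clear kx ky kz; linarith, fun hpar nwx nwy nwz => ?_⟩
  by_contra hlt
  have closed : ∀ (l : List Label), (∀ v ∈ l, π v ∈ l) → (∀ v ∈ l, v.1 ≠ 8) →
      (∃ v, (v = x ∨ v = y ∨ v = z) ∧ (6, v) ∈ l) → False := by
    rintro l hl h8 ⟨v, hv, hv'⟩
    exact hπ.not_closed l hl hv' (mV v hv) (fun h => h8 _ h rfl)
  have r1 : p1 ≤ 1 := by clear kx ky kz; linarith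
  have r2 : p2 ≤ 1 := by clear kx ky kz; linarith
  have r3 : p3 ≤ 1 := by clear kx ky kz; linarith
  -- Each of the five patterns is a cycle of `π` inside the core and its gadgets. It contains no
  -- hub, so it would be a subtour.
  rcases core_bound (nn _ _) (nn _ _) (nn _ _) (nn _ _) (nn _ _) (nn _ _) (nn _ _) (nn _ _)
    (nn _ _) (nn _ _) (nn _ _) (nn _ _) (nn _ _) (nn _ _) (nn _ _) bS box boy boz bix biy biz bg
    (used_le_one _ _) (used_le_one _ _) (used_le_one _ _) hpar
    (le_trans (le_of_eq (by split_ifs <;> ring)) kx) (le_trans (le_of_eq (by split_ifs <;> ring)) ky)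
    (le_trans (le_of_eq (by split_ifs <;> ring)) kz) (by clear kx ky kz; linarith) with
    ⟨h1, h2, h3⟩ | ⟨hb, h1, h2, h3⟩ | ⟨hb, h1, h2, h3⟩ | ⟨hb, h1, h2, h3⟩ |
    ⟨hb1, hb2, hb3, h1, h2, h3, h4, h5, h6⟩
  · rw [used_eq_one] at h1 h2 h3
    exact closed [(6, x), (6, z), (6, y)] (by simp [h1, h2, h3]) (by simp) ⟨x, by simp, by simp⟩
  · obtain ⟨q1, q2⟩ := nwx hb h1 h2 r1
    rw [used_eq_one] at h1 h2 h3
    exact closed [(6, x), pout b x, (4, x), pin b x, (6, y)] (by simp [h1, h2, h3, q1, q2])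
      (by simp [q8]) ⟨x, by simp, by simp⟩
  · obtain ⟨q1, q2⟩ := nwy hb h1 h2 r2
    rw [used_eq_one] at h1 h2 h3
    exact closed [(6, y), pout b y, (4, y), pin b y, (6, z)] (by simp [h1, h2, h3, q1, q2])
      (by simp [q8]) ⟨y, by simp, by simp⟩
  · obtain ⟨q1, q2⟩ := nwz hb h1 h2 r3
    rw [used_eq_one] at h1 h2 h3
    exact closed [(6, z), pout b z, (4, z), pin b z, (6, x)] (by simp [h1, h2, h3, q1, q2])
      (by simp [q8]) ⟨x, by simp, by simp⟩
  · obtain ⟨q1, q2⟩ := nwx hb1 h1 h2 r1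
    obtain ⟨q3, q4⟩ := nwy hb2 h3 h4 r2
    obtain ⟨q5, q6⟩ := nwz hb3 h5 h6 r3
    rw [used_eq_one] at h1 h2 h3 h4 h5 h6
    exact closed [(6, x), pout b x, (4, x), pin b x, (6, y), pout b y, (4, y), pin b y, (6, z),
      pout b z, (4, z), pin b z] (by simp [h1, h2, h3, h4, h5, h6, q1, q2, q3, q4, q5, q6])
      (by simp [q8]) ⟨x, by simp, by simp⟩

/-- Translates the arc lists into the hypotheses of `core_flow`. The price 2 for a wrong parity is
claimed only if no gadget of the core is also touched by its circle; the other case is paid for in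
`junction_bound`. -/
theorem core_lower_bound (hH : H.IsBermanKarpinski) (hπ : H.IsTourPerm π) {t : Triple} {g : Label}
    (hz : (t, g) ∈ H.triples.zip (H.targets.drop 1)) :
    0 ≤ (excess H π 3 t.1 - portTerm H π t.bit t.1) +
        (excess H π 3 t.2.1 - portTerm H π t.bit t.2.1) +
        (excess H π 3 t.2.2.1 - portTerm H π t.bit t.2.2.1) + coreTerm H π t g ∧
      ((direction H π 3 t.1 ^^ (direction H π 3 t.2.1 ^^ (direction H π 3 t.2.2.1 ^^ t.bit))) =
          true →
        (∀ y ∈ t.vars, direction H π 3 y ≠ t.bit →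
          inArc H π (pin t.bit y) + outArc H π (pout t.bit y) ≤ 0) →
        2 ≤ (excess H π 3 t.1 - portTerm H π t.bit t.1) +
          (excess H π 3 t.2.1 - portTerm H π t.bit t.2.1) +
          (excess H π 3 t.2.2.1 - portTerm H π t.bit t.2.2.1) + coreTerm H π t g) := by
  have ht := (zip_fst hz).1
  have hg := mem_targets_fst (zip_fst hz).2
  have hng := not_arc_target hH hz
  obtain ⟨nxy, nxz, nyz⟩ := hH.triple_ne ht
  have hvars : ∀ y ∈ t.vars, y ∈ H.pnames := fun y hy => mem_pnames.2 (Or.inr ⟨t, ht, hy⟩)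
  have mx : t.1 ∈ t.vars := by simp [Triple.vars]
  have my : t.2.1 ∈ t.vars := by simp [Triple.vars]
  have mz : t.2.2.1 ∈ t.vars := by simp [Triple.vars]
  have kx := tick_le_excess hH hπ (hvars _ mx) t.bit
  have ky := tick_le_excess hH hπ (hvars _ my) t.bit
  have kz := tick_le_excess hH hπ (hvars _ mz) t.bit
  have n6 : ∀ x b p, ((6, x) : Label) ≠ pin b p := by
    intro x b p h; have := pin_fst b p; rw [← h] at this; simp at this
  have n6' : ∀ x b p, ((6, x) : Label) ≠ pout b p := by
    intro x b p h; have := pout_fst b p; rw [← h] at this; simp at this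
  have n7 : ∀ x b p, ((7, x) : Label) ≠ pin b p := by
    intro x b p h; have := pin_fst b p; rw [← h] at this; simp at this
  have g6 : ∀ x, g ≠ (6, x) := by
    intro x h; rw [h] at hg; simp at hg
  have gp : ∀ b p, g ≠ pout b p := by
    intro b p h; have := pout_fst b p; rw [← h] at this; omega
  have npp : ∀ b p p', pin b p ≠ pout b p' := by
    intro b p p' h; exact (pin_eq_pout h).1 rfl
  have npi : ∀ b p p', pin b p = pin b p' ↔ p = p' :=
    fun b p p' => ⟨fun h => (pin_inj h).2, fun h => by rw [h]⟩
  have npo : ∀ b p p', pout b p = pout b p' ↔ p = p' :=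
    fun b p p' => ⟨fun h => (pout_inj h).2, fun h => by rw [h]⟩
  have mV : ∀ y ∈ t.vars, ((6, y) : Label) ∈ H.labels := fun y hy =>
    mem_labels.2 (Or.inr (Or.inr (Or.inr ⟨t, ht, Or.inr ⟨rfl, hy⟩⟩)))
  have nwild : ∀ y ∈ t.vars, (∀ y ∈ t.vars, direction H π 3 y ≠ t.bit →
      inArc H π (pin t.bit y) + outArc H π (pout t.bit y) ≤ 0) →
      inArc H π (pout t.bit y) = 1 → outArc H π (pin t.bit y) = 1 →
      excess H π 3 y - portTerm H π t.bit y ≤ 1 → (direction H π 3 y ^^ t.bit) = true →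
      π (pout t.bit y) = (4, y) ∧ π (4, y) = pin t.bit y := by
    intro y hy hw hi ho he hd
    exact traversed hH hπ (hvars y hy) hd (hw y hy (by simpa using hd)) hi ho he
  have nwx := nwild _ mx
  have nwy := nwild _ my
  have nwz := nwild _ mz
  have mVx := mV _ mx
  have mVy := mV _ my
  have mVz := mV _ mz
  have cS := fun w (h : ((7, t.1), w) ∈ H.arcs) =>
    mem_coreArcs.1 (hH.core_of_start hz h)
  have cg := fun v (h : (v, g) ∈ H.arcs) =>
    mem_coreArcs.1 (hH.core_of_target hz h (fun e => hng (e ▸ h)))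
  have cox := fun w (h : ((6, t.1), w) ∈ H.arcs) => mem_coreArcs.1 (hH.core_of_out hz h rfl mx)
  have coy := fun w (h : ((6, t.2.1), w) ∈ H.arcs) => mem_coreArcs.1 (hH.core_of_out hz h rfl my)
  have coz := fun w (h : ((6, t.2.2.1), w) ∈ H.arcs) => mem_coreArcs.1 (hH.core_of_out hz h rfl mz)
  have cix := fun v (h : (v, (6, t.1)) ∈ H.arcs) => mem_coreArcs.1 (hH.core_of_in hz h rfl mx)
  have ciy := fun v (h : (v, (6, t.2.1)) ∈ H.arcs) => mem_coreArcs.1 (hH.core_of_in hz h rfl my)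
  have ciz := fun v (h : (v, (6, t.2.2.1)) ∈ H.arcs) => mem_coreArcs.1 (hH.core_of_in hz h rfl mz)
  have cpx := fun v => (⟨fun h => mem_coreArcs.1 (hH.core_of_pout hz mx h), fun h =>
    mem_arcs.2 (Or.inr (Or.inr (Or.inr ⟨t, g, hz, mem_coreArcs.2 h⟩)))⟩ :
    (v, pout t.bit t.1) ∈ H.arcs ↔ _)
  have cpy := fun v => (⟨fun h => mem_coreArcs.1 (hH.core_of_pout hz my h), fun h =>
    mem_arcs.2 (Or.inr (Or.inr (Or.inr ⟨t, g, hz, mem_coreArcs.2 h⟩)))⟩ :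
    (v, pout t.bit t.2.1) ∈ H.arcs ↔ _)
  have cpz := fun v => (⟨fun h => mem_coreArcs.1 (hH.core_of_pout hz mz h), fun h =>
    mem_arcs.2 (Or.inr (Or.inr (Or.inr ⟨t, g, hz, mem_coreArcs.2 h⟩)))⟩ :
    (v, pout t.bit t.2.2.1) ∈ H.arcs ↔ _)
  have cqx := fun w => (⟨fun h => mem_coreArcs.1 (hH.core_of_pin hz mx h), fun h =>
    mem_arcs.2 (Or.inr (Or.inr (Or.inr ⟨t, g, hz, mem_coreArcs.2 h⟩)))⟩ :
    (pin t.bit t.1, w) ∈ H.arcs ↔ _)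
  have cqy := fun w => (⟨fun h => mem_coreArcs.1 (hH.core_of_pin hz my h), fun h =>
    mem_arcs.2 (Or.inr (Or.inr (Or.inr ⟨t, g, hz, mem_coreArcs.2 h⟩)))⟩ :
    (pin t.bit t.2.1, w) ∈ H.arcs ↔ _)
  have cqz := fun w => (⟨fun h => mem_coreArcs.1 (hH.core_of_pin hz mz h), fun h =>
    mem_arcs.2 (Or.inr (Or.inr (Or.inr ⟨t, g, hz, mem_coreArcs.2 h⟩)))⟩ :
    (pin t.bit t.2.2.1, w) ∈ H.arcs ↔ _)
  -- Adding `b` to each of three terms is adding it once.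
  have hxor : ∀ b d1 d2 d3 : Bool, (d1 ^^ (d2 ^^ (d3 ^^ b))) = true →
      ((d1 ^^ b) ^^ ((d2 ^^ b) ^^ (d3 ^^ b))) = true := by decide
  unfold coreTerm
  generalize t.1 = x at *
  generalize t.2.1 = y at *
  generalize t.2.2.1 = z at *
  generalize t.bit = b at *
  simp only [Prod.mk.injEq, true_and, n6, n6', n7, (n6 _ _ _).symm, (n6' _ _ _).symm,
    (n7 _ _ _).symm, nxy, nxz, nyz, nxy.symm, nxz.symm, nyz.symm, g6, gp, (g6 _).symm,
    (gp _ _).symm, npi, npo, false_and, and_false, false_or, or_false,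
    and_true, Nat.reduceEqDiff] at cS cg cox coy coz cix ciy ciz cpx cpy cpz cqx cqy cqz
  obtain ⟨h1, h2⟩ := core_flow hπ (s := (7, x)) rfl nxy nxz nyz hg
    (fun v hv => by rcases hv with h | h | h <;> rw [h] <;> assumption)
    cS cg cox coy coz (fun w h => (cix w h).imp_right Or.symm)
    (fun w h => (ciy w h).imp_right Or.symm) (fun w h => (ciz w h).imp_right Or.symm)
    (inArc_eq cpx) (inArc_eq cpy) (inArc_eq cpz) (outArc_eq cqx) (outArc_eq cqy) (outArc_eq cqz)
    kx ky kz
  refine ⟨h1, fun hpar hw => h2 (hxor _ _ _ _ hpar) (fun a b c d => nwx hw b c d a)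
    (fun a b c d => nwy hw b c d a) (fun a b c d => nwz hw b c d a)⟩

end HybridInstance

/-! ### Charging the lengths of arcs to their ends -/

section

variable (H : HybridInstance) (π : Equiv.Perm Label)

/-- The part of the length of an arc that is charged to its first vertex. -/
def outCost (v w : Label) : ℤ :=
  if isMid v then 1 else if sameGadget v w then (if isMid w then 0 else 1)
  else if (v, w) ∈ H.arcs then 1 else 2

/-- The part of the length of an arc that is charged to its last vertex. -/
def inCost (v w : Label) : ℤ :=
  if isMid w then 1 else if sameGadget v w then (if isMid v then 0 else 1)
  else if (v, w) ∈ H.arcs then 1 else 2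

/-- The number of neighbours that are not reached by short arcs. -/
def defect (v : Label) : ℤ := (1 - outArc H π v) + (1 - inArc H π v)

/-- The excess length of a tour over a tour without defects. -/
def totalExcess : ℤ :=
  ((List.range (H.numCircles + 1)).map fun l => defect H π (8, l, 0)).sum +
  (H.vars.map fun x => excess H π 0 x).sum + (H.pnames.map fun p => excess H π 3 p).sum +
  (H.triples.map fun t => defect H π (7, t.1) + (defect H π (6, t.1) +
    (defect H π (6, t.2.1) + defect H π (6, t.2.2.1)))).sum

end

namespace HybridInstance

variable {H : HybridInstance} {π : Equiv.Perm Label}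

theorem IsTourPerm.apply_ne (hπ : H.IsTourPerm π) {v : Label} (hv : v ∈ H.labels)
    (h8 : v ≠ (8, 0, 0)) : π v ≠ v := fun h =>
  hπ.not_closed [v] (by simp [h]) (List.mem_singleton_self v) hv (by simp [h8.symm])

theorem sameGadget_iff {k : ℕ} (hk : k = 0 ∨ k = 3) {x : Var} {v w : Label} (hv : v ∈ path k x) :
    sameGadget v w = true ↔ w ∈ path k x := by
  rw [mem_path] at hv ⊢
  obtain ⟨i, y⟩ := v
  obtain ⟨j, z⟩ := w
  simp only [sameGadget, Bool.and_eq_true, Bool.or_eq_true, decide_eq_true_eq] at hv ⊢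
  rcases hk with rfl | rfl <;> obtain ⟨hv, rfl⟩ := hv <;> constructor <;> rintro ⟨h1, h2⟩ <;>
    constructor <;> first | omega | (subst h1; rfl) | (subst h2; rfl)

theorem sameGadget_comm (v w : Label) : sameGadget v w = sameGadget w v := by
  simp only [sameGadget, eq_comm (a := v.2)]
  cases decide (w.2 = v.2) <;> simp [Bool.and_comm]

theorem outCost_end (hH : H.IsBermanKarpinski) {k i j : ℕ} (hk : k = 0 ∨ k = 3) {x : Var}
    {w : Label} (hij : i = k ∧ j = k + 2 ∨ i = k + 2 ∧ j = k) (hw : w ≠ (i, x)) :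
    outCost H (i, x) w = 2 - 2 * (if w = (k + 1, x) then 1 else 0) -
      (if w = (j, x) then 1 else 0) - (if ((i, x), w) ∈ H.arcs then 1 else 0) := by
  have hv : (i, x) ∈ path k x := by rw [mem_path]; simp; omega
  have hi : isMid (i, x) = false := by
    simp only [isMid, Bool.or_eq_false_iff, decide_eq_false_iff_not]; omega
  have hj : isMid (j, x) = false := by
    simp only [isMid, Bool.or_eq_false_iff, decide_eq_false_iff_not]; omega
  have hm : isMid (k + 1, x) = true := by
    simp only [isMid, Bool.or_eq_true, decide_eq_true_eq]; omega
  have hs := sameGadget_iff (w := w) hk hv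
  have ha : w ∈ path k x → ((i, x), w) ∉ H.arcs := by
    intro h h'
    rw [hH.sameGadget_of_arc h'] at hs
    simp at hs
    exact hs h
  have hp : w ∈ path k x ↔ w = (k + 1, x) ∨ w = (j, x) := by
    simp only [path, List.mem_cons, List.not_mem_nil, or_false]
    rcases hij with ⟨rfl, rfl⟩ | ⟨rfl, rfl⟩ <;> simp [hw, or_comm]
  have hne : ((k + 1, x) : Label) ≠ (j, x) := by
    simp only [ne_eq, Prod.mk.injEq, and_true]; omega
  unfold outCost
  by_cases h1 : w = (k + 1, x)
  · subst h1
    simp [hi, hm, hs.2 (hp.2 (Or.inl rfl)), ha (hp.2 (Or.inl rfl)), hne]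
  · by_cases h2 : w = (j, x)
    · subst h2
      simp [hi, hj, hs.2 (hp.2 (Or.inr rfl)), ha (hp.2 (Or.inr rfl)), hne.symm]
    · have : sameGadget (i, x) w = false := by
        rw [Bool.eq_false_iff]; intro h; rcases hp.1 (hs.1 h) with h | h <;> contradiction
      by_cases h3 : ((i, x), w) ∈ H.arcs <;> simp [hi, this, h1, h2, h3]

theorem inCost_end (hH : H.IsBermanKarpinski) {k i j : ℕ} (hk : k = 0 ∨ k = 3) {x : Var}
    {w : Label} (hij : i = k ∧ j = k + 2 ∨ i = k + 2 ∧ j = k) (hw : w ≠ (i, x)) :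
    inCost H w (i, x) = 2 - 2 * (if w = (k + 1, x) then 1 else 0) -
      (if w = (j, x) then 1 else 0) - (if (w, (i, x)) ∈ H.arcs then 1 else 0) := by
  have hv : (i, x) ∈ path k x := by rw [mem_path]; simp; omega
  have hi : isMid (i, x) = false := by
    simp only [isMid, Bool.or_eq_false_iff, decide_eq_false_iff_not]; omega
  have hj : isMid (j, x) = false := by
    simp only [isMid, Bool.or_eq_false_iff, decide_eq_false_iff_not]; omega
  have hm : isMid (k + 1, x) = true := by
    simp only [isMid, Bool.or_eq_true, decide_eq_true_eq]; omega
  have hs := sameGadget_iff (w := w) hk hv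
  rw [sameGadget_comm] at hs
  have ha : w ∈ path k x → (w, (i, x)) ∉ H.arcs := by
    intro h h'
    rw [hH.sameGadget_of_arc h'] at hs
    simp at hs
    exact hs h
  have hp : w ∈ path k x ↔ w = (k + 1, x) ∨ w = (j, x) := by
    simp only [path, List.mem_cons, List.not_mem_nil, or_false]
    rcases hij with ⟨rfl, rfl⟩ | ⟨rfl, rfl⟩ <;> simp [hw, or_comm]
  have hne : ((k + 1, x) : Label) ≠ (j, x) := by
    simp only [ne_eq, Prod.mk.injEq, and_true]; omega
  unfold inCost
  by_cases h1 : w = (k + 1, x)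
  · subst h1
    simp [hi, hm, hs.2 (hp.2 (Or.inl rfl)), ha (hp.2 (Or.inl rfl)), hne]
  · by_cases h2 : w = (j, x)
    · subst h2
      simp [hi, hj, hs.2 (hp.2 (Or.inr rfl)), ha (hp.2 (Or.inr rfl)), hne.symm]
    · have : sameGadget w (i, x) = false := by
        rw [Bool.eq_false_iff]; intro h; rcases hp.1 (hs.1 h) with h | h <;> contradiction
      by_cases h3 : (w, (i, x)) ∈ H.arcs <;> simp [hi, this, h1, h2, h3]

/-- A flawless visit costs 4: one unit for each of the two outer arcs, two for the middle vertex,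
nothing for the ends of the path edges at the outer vertices. -/
theorem path_cost (hH : H.IsBermanKarpinski) (hπ : H.IsTourPerm π) {k : ℕ} {x : Var}
    (h : H.IsGadget k x) :
    ((path k x).map fun v => outCost H v (π v) + inCost H (π⁻¹ v) v).sum = 4 + excess H π k x := by
  have hk : k = 0 ∨ k = 3 := by rcases h with h | h <;> simp [h.1]
  have ne : ∀ i, i = k ∨ i = k + 2 → π (i, x) ≠ (i, x) := fun i hi =>
    hπ.apply_ne (h.mem_labels (by rw [mem_path]; simp; omega)) (by simp; omega)
  have ne' : ∀ i, i = k ∨ i = k + 2 → π⁻¹ (i, x) ≠ (i, x) := fun i hi he => by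
    rw [Equiv.Perm.inv_eq_iff_eq] at he; exact ne i hi he.symm
  have hm : isMid (k + 1, x) = true := by
    simp only [isMid, Bool.or_eq_true, decide_eq_true_eq]; omega
  have e : ∀ v w, π⁻¹ w = v ↔ π v = w := fun v w => by rw [Equiv.Perm.inv_eq_iff_eq, eq_comm]
  simp only [path, List.map_cons, List.map_nil, List.sum_cons, List.sum_nil]
  rw [outCost_end hH hk (Or.inl ⟨rfl, rfl⟩) (ne k (by simp)),
    outCost_end hH hk (Or.inr ⟨rfl, rfl⟩) (ne _ (by simp)),
    inCost_end hH hk (Or.inl ⟨rfl, rfl⟩) (ne' k (by simp)),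
    inCost_end hH hk (Or.inr ⟨rfl, rfl⟩) (ne' _ (by simp))]
  have h1 : outCost H (k + 1, x) (π (k + 1, x)) = 1 := by simp [outCost, hm]
  have h2 : inCost H (π⁻¹ (k + 1, x)) (k + 1, x) = 1 := by simp [inCost, hm]
  rw [h1, h2]
  unfold excess used outArc inArc
  simp only [e]
  ring

theorem defect_cost {v : Label} (hv : 6 ≤ v.1) :
    outCost H v (π v) + inCost H (π⁻¹ v) v = 2 + defect H π v := by
  have hm : isMid v = false := by
    simp only [isMid, Bool.or_eq_false_iff, decide_eq_false_iff_not]; omega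
  have hs : ∀ w, sameGadget v w = false := by
    intro w
    simp only [sameGadget, Bool.and_eq_false_iff, Bool.or_eq_false_iff, decide_eq_false_iff_not]
    omega
  unfold outCost inCost defect outArc inArc
  simp only [hm, hs, sameGadget_comm _ v, Bool.false_eq_true, if_false]
  split_ifs <;> rfl

theorem IsTourPerm.perm (hπ : H.IsTourPerm π) (hH : H.IsBermanKarpinski) :
    (H.labels.map π).Perm H.labels := by
  refine List.Subperm.perm_of_length_le (List.subperm_of_subset
    (hH.nodup_labels.map π.injective) ?_) (by simp)
  intro v hv
  obtain ⟨w, hw, rfl⟩ := List.mem_map.1 hv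
  exact hπ.mem w hw

/-- The charge at the head of an arc is moved to that vertex along `π`. The base value is 4 for each
of the `m₂ + 3 m₃` gadgets and 2 for each of the `4 m₃ + n + 1` other vertices. -/
theorem sum_cost (hH : H.IsBermanKarpinski) (hπ : H.IsTourPerm π) :
    (H.labels.map fun v => outCost H v (π v) + inCost H v (π v)).sum =
      4 * H.m₂ + 20 * H.m₃ + 2 * H.numCircles + 2 + totalExcess H π := by
  have e : (H.labels.map fun v => inCost H v (π v)).sum =
      (H.labels.map fun v => inCost H (π⁻¹ v) v).sum := by
    rw [← ((hπ.perm hH).map fun v => inCost H (π⁻¹ v) v).sum_eq, List.map_map]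
    simp [Function.comp_def]
  rw [List.sum_map_add, e, ← List.sum_map_add]
  have h1 : ((List.range (H.numCircles + 1)).map
      fun l => outCost H (8, l, 0) (π (8, l, 0)) + inCost H (π⁻¹ (8, l, 0)) (8, l, 0)).sum =
      2 * (H.numCircles + 1) +
        ((List.range (H.numCircles + 1)).map fun l => defect H π (8, l, 0)).sum := by
    simp only [defect_cost (H := H) (π := π) (v := (8, _, 0)) (by simp), List.sum_map_add]
    simp [mul_comm]
  have h2 : (H.vars.map fun x =>
      ((path 0 x).map fun v => outCost H v (π v) + inCost H (π⁻¹ v) v).sum).sum =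
      4 * H.vars.length + (H.vars.map fun x => excess H π 0 x).sum := by
    rw [List.map_congr_left fun x hx => path_cost hH hπ (Or.inl ⟨rfl, hx⟩), List.sum_map_add]
    simp [mul_comm]
  have h3 : (H.pnames.map fun x =>
      ((path 3 x).map fun v => outCost H v (π v) + inCost H (π⁻¹ v) v).sum).sum =
      4 * H.pnames.length + (H.pnames.map fun x => excess H π 3 x).sum := by
    rw [List.map_congr_left fun x hx => path_cost hH hπ (Or.inr ⟨rfl, hx⟩), List.sum_map_add]
    simp [mul_comm]
  have h4 : (H.triples.map fun t => ([((7, t.1) : Label), (6, t.1), (6, t.2.1), (6, t.2.2.1)].map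
      fun v => outCost H v (π v) + inCost H (π⁻¹ v) v).sum).sum = 8 * H.triples.length +
      (H.triples.map fun t => defect H π (7, t.1) + (defect H π (6, t.1) +
        (defect H π (6, t.2.1) + defect H π (6, t.2.2.1)))).sum := by
    have : ∀ t : Triple, ([((7, t.1) : Label), (6, t.1), (6, t.2.1), (6, t.2.2.1)].map
        fun v => outCost H v (π v) + inCost H (π⁻¹ v) v).sum = 8 + (defect H π (7, t.1) +
          (defect H π (6, t.1) + (defect H π (6, t.2.1) + defect H π (6, t.2.2.1)))) := by
      intro t
      simp only [List.map_cons, List.map_nil, List.sum_cons, List.sum_nil]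
      rw [defect_cost (by simp), defect_cost (by simp), defect_cost (by simp),
        defect_cost (by simp)]
      ring
    rw [List.map_congr_left fun t _ => this t, List.sum_map_add]
    simp [mul_comm]
  unfold labels totalExcess
  rw [List.map_append, List.map_append, List.map_append, List.sum_append, List.sum_append,
    List.sum_append, List.map_map, List.sum_map_flatMap, List.sum_map_flatMap,
    List.sum_map_flatMap, h2, h3, h4, length_pnames, hH.m₂_eq, m₃_eq]
  simp only [Function.comp_def]
  rw [h1]
  push_cast
  ring

end HybridInstance

/-- Used for the hubs: circle `l` takes the outgoing side of hub `l` and the incoming side of hub `l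
+ 1`. The outgoing side of the last hub and the incoming side of the first remain. -/
theorem sum_range_add {M : Type*} [AddCommMonoid M] (a b : ℕ → M) (n : ℕ) :
    ((List.range (n + 1)).map fun l => a l + b l).sum =
      ((List.range n).map fun l => a l + b (l + 1)).sum + (a n + b 0) := by
  induction n with
  | zero => simp
  | succ n ih =>
    rw [List.sum_range_succ, ih, List.sum_range_succ]
    ac_rfl

theorem HybridInstance.sum_border {H : HybridInstance} (hH : H.IsBermanKarpinski) (c : ℕ → ℤ) :
    (H.vars.map fun x => if x.2 = H.circleSize x.1 then c x.1 else 0).sum =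
      ((List.range H.numCircles).map c).sum := by
  unfold vars
  rw [List.sum_map_flatMap]
  refine congrArg List.sum (List.map_congr_left fun l hl => ?_)
  have := hH.seven_le_circleSize (List.mem_range.1 hl)
  obtain ⟨m, hm⟩ : ∃ m, H.circleSize l = m + 1 := ⟨H.circleSize l - 1, by omega⟩
  simp only [List.map_map, Function.comp_def]
  rw [hm, List.range'_concat, List.map_append, List.sum_append]
  have : ((List.range' 1 m).map fun i => if i = m + 1 then c l else 0) =
      (List.range' 1 m).map fun _ => (0 : ℤ) := by
    refine List.map_congr_left fun i hi => if_neg ?_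
    have := List.mem_range'_1.1 hi
    omega
  rw [this]
  simp [add_comm]

namespace HybridInstance

variable {H : HybridInstance} {π : Equiv.Perm Label} (hH : H.IsBermanKarpinski)
  (hπ : H.IsTourPerm π)

include hH hπ

/-- The bound for a circle gadget splits into a part at its first vertex and a part at its last one;
`sum_prevVar` hands the latter to the next variable. The incoming defect of every target except the
first goes to the core before it. Only the incoming defect of the first target and the outgoing
defect of the last hub are dropped, and they are nonnegative. -/
theorem circle_lower_bound :
    (H.vars.map fun x => circleTerm H π x).sum +
        ((H.triples.zip (H.targets.drop 1)).map fun p => 1 - inArc H π p.2).sum ≤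
      ((List.range (H.numCircles + 1)).map fun l => defect H π (8, l, 0)).sum +
        (H.vars.map fun x => excess H π 0 x).sum +
        (H.triples.map fun t => 1 - inArc H π (7, t.1)).sum := by
  have h1 : (H.vars.map fun x => excess H π 0 x).sum ≥
      (H.vars.map fun x => (1 - sgn (direction H π 0 (H.prevVar x)) *
        (outArc H π (2, H.prevVar x) - inArc H π (2, H.prevVar x))) +
      (1 - sgn (direction H π 0 x) * (inArc H π (0, x) - outArc H π (0, x)))).sum := by
    rw [List.sum_map_add, hH.sum_prevVar fun x =>
      1 - sgn (direction H π 0 x) * (outArc H π (2, x) - inArc H π (2, x)), ← List.sum_map_add]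
    refine List.sum_le_sum fun x hx => ?_
    have := IsGadget.le_excess hH hπ (Or.inl ⟨rfl, hx⟩)
    simp only [zero_add] at this
    linarith
  have h2 : ((H.triples.zip (H.targets.drop 1)).map fun p => 1 - inArc H π p.2).sum ≤
      (H.triples.map fun t => 1 - inArc H π (7, t.1)).sum + (1 - inArc H π (8, 0, 0)) := by
    have e1 : ((H.triples.zip (H.targets.drop 1)).map fun p => 1 - inArc H π p.2).sum =
        ((H.targets.drop 1).map fun g => 1 - inArc H π g).sum := by
      conv_rhs => rw [← List.map_snd_zip (l₁ := H.triples) (l₂ := H.targets.drop 1)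
        (by simp [targets])]
      rw [List.map_map]
      rfl
    have e2 : (H.triples.map fun t => 1 - inArc H π (7, t.1)).sum + (1 - inArc H π (8, 0, 0)) =
        (H.targets.map fun g => 1 - inArc H π g).sum := by
      simp [targets, Function.comp_def]
    rw [e1, e2]
    cases H.targets with
    | nil => simp
    | cons a l =>
      have := inArc_le_one (H := H) (π := π) a
      simp only [List.drop_succ_cons, List.drop_zero, List.map_cons, List.sum_cons]
      linarith
  have h3 := sum_range_add (fun l => 1 - outArc H π (8, l, 0)) (fun l => 1 - inArc H π (8, l, 0))
    H.numCircles
  have h4 := sum_border hH fun l => (1 - outArc H π (8, l, 0)) + (1 - inArc H π (8, l + 1, 0))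
  have h5 := outArc_le_one (H := H) (π := π) (8, H.numCircles, 0)
  unfold circleTerm defect
  rw [List.sum_map_add, h4, h3]
  linarith

/-- The regrouping of the whole ledger: every junction, parity gadget and core is assigned to its
matching or three-variable equation, so that the rest of the argument is local to one equation. -/
theorem le_totalExcess :
    (H.matching.map fun e => circleTerm H π e.1 + circleTerm H π e.2 + excess H π 3 e.1).sum +
      ((H.triples.zip (H.targets.drop 1)).map fun p => circleTerm H π p.1.1 +
        (circleTerm H π p.1.2.1 + circleTerm H π p.1.2.2.1) + (excess H π 3 p.1.1 +
          (excess H π 3 p.1.2.1 + excess H π 3 p.1.2.2.1)) + coreTerm H π p.1 p.2).sum ≤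
      totalExcess H π := by
  have hz : ∀ F : Triple → ℤ, ((H.triples.zip (H.targets.drop 1)).map fun p => F p.1).sum =
      (H.triples.map F).sum := by
    intro F
    conv_rhs => rw [← map_fst_zip (H := H), List.map_map]
    rfl
  have h1 := circle_lower_bound hH hπ
  have h2 := hH.sum_vars fun x => circleTerm H π x
  have h3 : (H.pnames.map fun p => excess H π 3 p).sum =
      (H.matching.map fun e => excess H π 3 e.1).sum + (H.triples.map fun t => excess H π 3 t.1 +
        (excess H π 3 t.2.1 + excess H π 3 t.2.2.1)).sum := by
    unfold pnames
    rw [List.map_append, List.sum_append, List.map_map, List.sum_map_flatMap]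
    simp [Function.comp_def]
  have h4 : (H.triples.map fun t : Triple => defect H π (7, t.1) + (defect H π (6, t.1) +
        (defect H π (6, t.2.1) + defect H π (6, t.2.2.1)))).sum =
      (H.triples.map fun t => (1 - inArc H π (7, t.1))).sum +
      (H.triples.map fun t => (1 - outArc H π (7, t.1)) + (defect H π (6, t.1) +
        (defect H π (6, t.2.1) + defect H π (6, t.2.2.1)))).sum := by
    rw [← List.sum_map_add]
    refine congrArg List.sum (List.map_congr_left fun t _ => ?_)
    unfold defect
    ring
  have h5 : ∀ p : Triple × Label, coreTerm H π p.1 p.2 =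
      ((1 - outArc H π (7, p.1.1)) + (defect H π (6, p.1.1) +
        (defect H π (6, p.1.2.1) + defect H π (6, p.1.2.2.1)))) + (1 - inArc H π p.2) := by
    intro p
    unfold coreTerm defect
    ring
  have h6 := hz fun t => circleTerm H π t.1 + (circleTerm H π t.2.1 + circleTerm H π t.2.2.1)
  have h7 := hz fun t => excess H π 3 t.1 + (excess H π 3 t.2.1 + excess H π 3 t.2.2.1)
  have h8 := hz fun t => (1 - outArc H π (7, t.1)) + (defect H π (6, t.1) +
    (defect H π (6, t.2.1) + defect H π (6, t.2.2.1)))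
  have h9 : ((H.triples.zip (H.targets.drop 1)).map fun p => circleTerm H π p.1.1 +
        (circleTerm H π p.1.2.1 + circleTerm H π p.1.2.2.1) + (excess H π 3 p.1.1 +
          (excess H π 3 p.1.2.1 + excess H π 3 p.1.2.2.1)) + coreTerm H π p.1 p.2).sum =
      (H.triples.map fun t => circleTerm H π t.1 +
        (circleTerm H π t.2.1 + circleTerm H π t.2.2.1)).sum +
      (H.triples.map fun t => excess H π 3 t.1 +
        (excess H π 3 t.2.1 + excess H π 3 t.2.2.1)).sum +
      (H.triples.map fun t => (1 - outArc H π (7, t.1)) + (defect H π (6, t.1) +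
        (defect H π (6, t.2.1) + defect H π (6, t.2.2.1)))).sum +
      ((H.triples.zip (H.targets.drop 1)).map fun p => 1 - inArc H π p.2).sum := by
    rw [← h6, ← h7, ← h8, ← List.sum_map_add, ← List.sum_map_add, ← List.sum_map_add]
    exact congrArg List.sum (List.map_congr_left fun p _ => by rw [h5]; ring)
  rw [h9, List.sum_map_add (l := H.matching)]
  unfold totalExcess
  rw [h3, h4]
  linarith

end HybridInstance

/-! ### The majority vote and the number of unsatisfied equations -/

/-- The number of the three votes `a, b, c` against the majority is at most one. -/
theorem maj_le (a b c : Bool) :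
    ((if maj a b c = a then 0 else 1) + (if maj a b c = b then 0 else 1) +
      (if maj a b c = c then 0 else 1) : ℤ) ≤ if a = b ∧ b = c then 0 else 1 := by
  cases a <;> cases b <;> cases c <;> simp [maj]

/-- If all values follow the votes and the votes have the right parity, the equation holds; so a
violated equation has some summand 1 on the right. -/
theorem ite_parity (f₁ f₂ f₃ w₁ w₂ w₃ : Bool) (c : ZMod 2) :
    ((if (if f₁ then 1 else 0) + ((if f₂ then 1 else 0) + (if f₃ then 1 else 0)) = c
      then 0 else 1) : ℤ) ≤
      (if f₁ = w₁ then 0 else 1) + ((if f₂ = w₂ then 0 else 1) + (if f₃ = w₃ then 0 else 1)) +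
      (if (w₁ ^^ (w₂ ^^ w₃)) = decide (c.val = 1) then 0 else 1) := by
  revert f₁ f₂ f₃ w₁ w₂ w₃ c
  decide

namespace HybridInstance

variable {H : HybridInstance}

/-- The vote of the parity gadgets, the number of dissenting votes and the number of violated
parities bound the number of unsatisfied equations. -/
theorem IsBermanKarpinski.numUnsat_le (hH : H.IsBermanKarpinski) (q w : Var → Bool)
    (hw : ∀ e ∈ H.matching, w e.1 = w e.2) {φ : Var → ZMod 2}
    (hφ : ∀ x ∈ H.vars, φ x = if maj (q (H.prevVar x)) (q x) (w x) then 1 else 0) :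
    (H.numUnsat φ : ℤ) ≤
      (H.matching.map fun e =>
        (if q (H.prevVar e.1) = q e.1 ∧ q e.1 = w e.1 then 0 else 1 : ℤ) +
        (if q (H.prevVar e.2) = q e.2 ∧ q e.2 = w e.2 then 0 else 1 : ℤ)).sum +
      (H.triples.map fun t : Triple =>
        (if q (H.prevVar t.1) = q t.1 ∧ q t.1 = w t.1 then 0 else 1 : ℤ) +
        ((if q (H.prevVar t.2.1) = q t.2.1 ∧ q t.2.1 = w t.2.1 then 0 else 1 : ℤ) +
        (if q (H.prevVar t.2.2.1) = q t.2.2.1 ∧ q t.2.2.1 = w t.2.2.1 then 0 else 1 : ℤ)) +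
        (if (w t.1 ^^ (w t.2.1 ^^ w t.2.2.1)) = t.bit then 0 else 1)).sum := by
  set f : Var → Bool := fun x => maj (q (H.prevVar x)) (q x) (w x) with hf
  have hφ' : ∀ x ∈ H.vars, ∀ y ∈ H.vars, φ x = φ y ↔ f x = f y := by
    intro x hx y hy
    rw [hφ x hx, hφ y hy]
    simp only [hf]
    cases maj (q (H.prevVar x)) (q x) (w x) <;> cases maj (q (H.prevVar y)) (q y) (w y) <;> simp
  -- The circle gadget `prevVar x` casts the same vote at both variables of its equation, so a
  -- violated equation has a variable that goes against this vote.
  have h1 : (H.vars.map fun x => (if φ (H.prevVar x) = φ x then 0 else 1 : ℤ)).sum ≤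
      (H.vars.map fun x => (if f x = q (H.prevVar x) then 0 else 1 : ℤ) +
        (if f x = q x then 0 else 1 : ℤ)).sum := by
    rw [List.sum_map_add, ← hH.sum_prevVar fun x => (if f x = q x then 0 else 1 : ℤ),
      ← List.sum_map_add]
    refine List.sum_le_sum fun x hx => ?_
    simp only [hφ' _ (hH.prevVar_mem hx) _ hx]
    cases f (H.prevVar x) <;> cases f x <;> cases q (H.prevVar x) <;> simp
  have h2 : (H.matching.map fun e => (if φ e.1 = φ e.2 then 0 else 1 : ℤ)).sum ≤
      (H.matching.map fun e => (if f e.1 = w e.1 then 0 else 1 : ℤ) +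
        (if f e.2 = w e.2 then 0 else 1 : ℤ)).sum := by
    refine List.sum_le_sum fun e he => ?_
    simp only [hφ' _ (hH.mem_vars_of_matching he (x := e.1) (by simp)) _
      (hH.mem_vars_of_matching he (x := e.2) (by simp)), hw e he]
    cases f e.1 <;> cases f e.2 <;> cases w e.2 <;> simp
  have h3 : (H.triples.map fun t =>
        (if φ t.1 + (φ t.2.1 + φ t.2.2.1) = t.2.2.2 then 0 else 1 : ℤ)).sum ≤
      (H.triples.map fun t : Triple => (if f t.1 = w t.1 then 0 else 1 : ℤ) +
        ((if f t.2.1 = w t.2.1 then 0 else 1 : ℤ) +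
          (if f t.2.2.1 = w t.2.2.1 then 0 else 1 : ℤ)) +
        (if (w t.1 ^^ (w t.2.1 ^^ w t.2.2.1)) = t.bit then 0 else 1)).sum := by
    refine List.sum_le_sum fun t ht => ?_
    rw [hφ _ (hH.mem_vars_of_triple ht (x := t.1) (by simp [Triple.vars])),
      hφ _ (hH.mem_vars_of_triple ht (x := t.2.1) (by simp [Triple.vars])),
      hφ _ (hH.mem_vars_of_triple ht (x := t.2.2.1) (by simp [Triple.vars]))]
    exact ite_parity _ _ _ _ _ _ _
  have h4 : (H.vars.map fun x => (if f x = q (H.prevVar x) then 0 else 1 : ℤ) +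
        (if f x = q x then 0 else 1 : ℤ) + (if f x = w x then 0 else 1 : ℤ)).sum ≤
      (H.vars.map fun x =>
        (if q (H.prevVar x) = q x ∧ q x = w x then 0 else 1 : ℤ)).sum :=
    List.sum_le_sum fun x _ => maj_le _ _ _
  have h5 := hH.sum_vars fun x => (if q (H.prevVar x) = q x ∧ q x = w x then 0 else 1 : ℤ)
  have h6 := hH.sum_vars fun x => (if f x = w x then 0 else 1 : ℤ)
  rw [List.sum_map_add (l := H.vars)] at h4
  rw [List.sum_map_add (l := H.triples)] at h3 ⊢
  rw [hH.numUnsat_eq]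
  push_cast [Nat.cast_list_sum, List.map_map, Function.comp_def]
  linarith

end HybridInstance

section Decode

variable {H : HybridInstance} {π : Equiv.Perm Label} {U : List (Label × Label)}
  (hI : ∀ v ∈ H.labels, inUsed U v = decide (inArc H π v = 1))
  (hO : ∀ v ∈ H.labels, outUsed U v = decide (outArc H π v = 1))

include hI hO

theorem gadgetVal_eq {k : ℕ} {x : Var} (h : H.IsGadget k x) :
    gadgetVal U k x = direction H π k x := by
  have m1 : (k, x) ∈ path k x := by simp [path]
  have m2 : (k + 2, x) ∈ path k x := by simp [path]
  have e : ∀ i : ℤ, 0 ≤ i → i ≤ 1 → ((decide (i = 1)).toNat : ℤ) = i := by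
    intro i h0 h1
    obtain rfl | rfl : i = 0 ∨ i = 1 := by omega
    · simp
    · simp
  unfold gadgetVal direction
  rw [hI _ (h.mem_labels m1), hI _ (h.mem_labels m2), hO _ (h.mem_labels m1),
    hO _ (h.mem_labels m2)]
  congr 1
  rw [← Nat.cast_le (α := ℤ)]
  push_cast
  rw [e _ (outArc_nonneg _) (outArc_le_one _), e _ (outArc_nonneg _) (outArc_le_one _),
    e _ (inArc_nonneg _) (inArc_le_one _), e _ (inArc_nonneg _) (inArc_le_one _)]

theorem wild_iff {b : Bool} {p : Var} (h : p ∈ H.pnames) :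
    wild U b p = true ↔ direction H π 3 p ≠ b ∧
      1 ≤ inArc H π (pin b p) + outArc H π (pout b p) := by
  have hp : HybridInstance.IsGadget H 3 p := Or.inr ⟨rfl, h⟩
  have m1 : pin b p ∈ path 3 p := by cases b <;> simp [path, pin]
  have m2 : pout b p ∈ path 3 p := by cases b <;> simp [path, pout]
  unfold wild
  rw [gadgetVal_eq hI hO hp, hI _ (hp.mem_labels m1), hO _ (hp.mem_labels m2)]
  have n1 := inArc_nonneg (H := H) (π := π) (pin b p)
  have n2 := outArc_nonneg (H := H) (π := π) (pout b p)
  have n3 := inArc_le_one (H := H) (π := π) (pin b p)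
  have n4 := outArc_le_one (H := H) (π := π) (pout b p)
  simp only [Bool.and_eq_true, Bool.or_eq_true, decide_eq_true_eq]
  refine and_congr (by cases direction H π 3 p <;> cases b <;> simp) ?_
  omega

end Decode

/-- Changing one wild vote makes the parity right, and is paid for. -/
theorem parity_repair {n₁ n₂ n₃ : Bool → ℤ} (m₁ : ∀ b, n₁ b ≤ 1) (m₂ : ∀ b, n₂ b ≤ 1)
    (m₃ : ∀ b, n₃ b ≤ 1) {P₁ P₂ P₃ b W₁ W₂ W₃ : Bool} {j₁ j₂ j₃ K : ℤ} (h₁ : 2 * n₁ P₁ ≤ j₁)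
    (h₂ : 2 * n₂ P₂ ≤ j₂) (h₃ : 2 * n₃ P₃ ≤ j₃) (w₁ : W₁ = true → 2 ≤ j₁) (w₂ : W₂ = true → 2 ≤ j₂)
    (w₃ : W₃ = true → 2 ≤ j₃) (hK : 0 ≤ K) (hK' : (P₁ ^^ (P₂ ^^ (P₃ ^^ b))) = true →
      W₁ = false → W₂ = false → W₃ = false → 2 ≤ K) :
    ∀ p, p = (!(P₁ ^^ (P₂ ^^ (P₃ ^^ b)))) → ∀ f₁ f₂ f₃, f₁ = (P₁ ^^ (!p && W₁)) →
      f₂ = (P₂ ^^ ((!p && !W₁) && W₂)) → f₃ = (P₃ ^^ ((!p && !W₁) && (!W₂ && W₃))) →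
      2 * (n₁ f₁ + (n₂ f₂ + n₃ f₃) + (if (f₁ ^^ (f₂ ^^ f₃)) = b then 0 else 1)) ≤
        j₁ + (j₂ + j₃) + K := by
  rintro p rfl f₁ f₂ f₃ rfl rfl rfl
  have a₁ := m₁ (!P₁)
  have a₂ := m₂ (!P₂)
  have a₃ := m₃ (!P₃)
  clear m₁ m₂ m₃
  cases hp : (P₁ ^^ (P₂ ^^ (P₃ ^^ b)))
  · have : (P₁ ^^ (P₂ ^^ P₃)) = b := by
      revert hp; clear * -; revert P₁ P₂ P₃ b; decide
    simp [this]
    omega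
  -- Wrong parity: reversing any one vote repairs it. A reversed vote adds at most one dissent at
  -- its junction, for which the 2 of a wild gadget suffices; if no gadget is wild, the core pays
  -- for the violated parity.
  · have e : ∀ P₁ P₂ P₃ b : Bool, (P₁ ^^ (P₂ ^^ (P₃ ^^ b))) = true →
        ((!P₁) ^^ (P₂ ^^ P₃)) = b ∧ (P₁ ^^ ((!P₂) ^^ P₃)) = b ∧ (P₁ ^^ (P₂ ^^ !P₃)) = b := by
      decide
    obtain ⟨e₁, e₂, e₃⟩ := e _ _ _ _ hp
    simp only [hp, forall_const] at hK'
    cases W₁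
    · cases W₂
      · cases W₃
        · simp only [forall_const] at hK'
          simp only [Bool.and_false, Bool.xor_false]
          split_ifs <;> omega
        · simp only [forall_const] at w₃
          simp only [Bool.and_self, Bool.not_true, Bool.not_false, Bool.and_false, Bool.xor_true,
            Bool.xor_false]
          rw [if_pos e₃]
          omega
      · simp only [forall_const] at w₂
        simp only [Bool.and_self, Bool.not_true, Bool.not_false, Bool.and_false,
          Bool.false_and, Bool.xor_true, Bool.xor_false]
        rw [if_pos e₂]
        omega
    · simp only [forall_const] at w₁
      simp only [Bool.and_self, Bool.not_true, Bool.not_false, Bool.and_false,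
        Bool.false_and, Bool.xor_true, Bool.xor_false]
      rw [if_pos e₁]
      omega

namespace HybridInstance

variable {H : HybridInstance} {π : Equiv.Perm Label} {U : List (Label × Label)}

theorem tripleOn_subset {t : Triple} {x : Var} (h : x ∈ tripleOn U t) : x ∈ t.vars := by
  unfold tripleOn at h
  simp only [List.mem_append, Triple.vars, List.mem_cons, List.not_mem_nil, or_false] at h ⊢
  rcases h with h | h | h <;> split_ifs at h <;> simp at h <;> simp [h]

theorem IsBermanKarpinski.mem_parityOn_matching (hH : H.IsBermanKarpinski) {e : Var × Var}
    (he : e ∈ H.matching) {x : Var} (hx : x ∈ [e.1, e.2]) :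
    x ∈ H.parityOn U ↔ gadgetVal U 3 e.1 = true := by
  unfold parityOn
  simp only [List.mem_append, List.mem_flatMap]
  constructor
  · rintro (⟨e', he', h⟩ | ⟨t, ht, h⟩)
    · split_ifs at h with hv
      · rw [hH.matching_unique he he' hx h]; exact hv
      · simp at h
    · exact (hH.matching_triple_disjoint he ht hx (tripleOn_subset h)).elim
  · exact fun h => Or.inl ⟨e, he, by rw [if_pos h]; exact hx⟩

theorem IsBermanKarpinski.mem_parityOn_triple (hH : H.IsBermanKarpinski) {t : Triple}
    (ht : t ∈ H.triples) {x : Var} (hx : x ∈ t.vars) :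
    x ∈ H.parityOn U ↔ x ∈ tripleOn U t := by
  unfold parityOn
  simp only [List.mem_append, List.mem_flatMap]
  constructor
  · rintro (⟨e', he', h⟩ | ⟨t', ht', h⟩)
    · split_ifs at h with hv
      · exact (hH.matching_triple_disjoint he' ht h hx).elim
      · simp at h
    · rw [hH.triple_unique ht ht' hx (tripleOn_subset h)]
      exact h
  · exact fun h => Or.inr ⟨t, ht, h⟩

theorem IsBermanKarpinski.parityOn_triple (hH : H.IsBermanKarpinski) {t : Triple}
    (ht : t ∈ H.triples) :
    decide (t.1 ∈ H.parityOn U) = (gadgetVal U 3 t.1 ^^ flipFst U t) ∧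
    decide (t.2.1 ∈ H.parityOn U) = (gadgetVal U 3 t.2.1 ^^ flipSnd U t) ∧
    decide (t.2.2.1 ∈ H.parityOn U) = (gadgetVal U 3 t.2.2.1 ^^ flipThd U t) := by
  obtain ⟨h1, h2, h3⟩ := hH.triple_ne ht
  have key : ∀ {p : Prop} [Decidable p] {b : Bool}, (p ↔ b = true) → decide p = b := by
    intro p _ b h
    rw [Bool.eq_iff_iff, decide_eq_true_iff, h]
  suffices h : (t.1 ∈ tripleOn U t ↔ (gadgetVal U 3 t.1 ^^ flipFst U t) = true) ∧
      (t.2.1 ∈ tripleOn U t ↔ (gadgetVal U 3 t.2.1 ^^ flipSnd U t) = true) ∧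
      (t.2.2.1 ∈ tripleOn U t ↔ (gadgetVal U 3 t.2.2.1 ^^ flipThd U t) = true) from
    ⟨key ((hH.mem_parityOn_triple ht (by simp [Triple.vars])).trans h.1),
      key ((hH.mem_parityOn_triple ht (by simp [Triple.vars])).trans h.2.1),
      key ((hH.mem_parityOn_triple ht (by simp [Triple.vars])).trans h.2.2)⟩
  unfold tripleOn
  generalize (gadgetVal U 3 t.1 ^^ flipFst U t) = b1
  generalize (gadgetVal U 3 t.2.1 ^^ flipSnd U t) = b2
  generalize (gadgetVal U 3 t.2.2.1 ^^ flipThd U t) = b3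
  cases b1 <;> cases b2 <;> cases b3 <;> simp [h1, h2, h3, h1.symm, h2.symm, h3.symm]

/-- The combination of the voting bound with the ledger, compared equation by equation. In a
matching equation both variables read the same parity gadget, so only the junctions matter; in a
three-variable equation `parity_repair` decides. -/
theorem IsTourPerm.two_mul_numUnsat_le (hπ : H.IsTourPerm π) (hH : H.IsBermanKarpinski)
    (hI : ∀ v ∈ H.labels, inUsed U v = decide (inArc H π v = 1))
    (hO : ∀ v ∈ H.labels, outUsed U v = decide (outArc H π v = 1)) :
    2 * (H.numUnsat (assignmentOf (H.decode U)) : ℤ) ≤ totalExcess H π := by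
  have hval : ∀ {k x}, H.IsGadget k x → gadgetVal U k x = direction H π k x :=
    fun h => gadgetVal_eq hI hO h
  have hP : ∀ {x}, x ∈ H.pnames → gadgetVal U 3 x = direction H π 3 x :=
    fun h => hval (Or.inr ⟨rfl, h⟩)
  have h := hH.numUnsat_le (direction H π 0) (fun x => decide (x ∈ H.parityOn U))
    (φ := assignmentOf (H.decode U)) (fun e he => by
      rw [decide_eq_decide, hH.mem_parityOn_matching he (by simp),
        hH.mem_parityOn_matching he (by simp)]) (fun x hx => by
      rw [← hval (Or.inl ⟨rfl, hx⟩), ← hval (Or.inl ⟨rfl, hH.prevVar_mem hx⟩)]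
      unfold assignmentOf decode
      simp only [List.mem_filter, hx, true_and])
  refine le_trans ?_ (le_totalExcess hH hπ)
  have hm : 2 * (H.matching.map fun e =>
      (if direction H π 0 (H.prevVar e.1) = direction H π 0 e.1 ∧
        direction H π 0 e.1 = decide (e.1 ∈ H.parityOn U) then 0 else 1 : ℤ) +
      (if direction H π 0 (H.prevVar e.2) = direction H π 0 e.2 ∧
        direction H π 0 e.2 = decide (e.2 ∈ H.parityOn U) then 0 else 1 : ℤ)).sum ≤
      (H.matching.map fun e => circleTerm H π e.1 + circleTerm H π e.2 + excess H π 3 e.1).sum := by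
    rw [← List.sum_map_mul_left]
    refine List.sum_le_sum fun e he => ?_
    have hp : e.1 ∈ H.pnames := mem_pnames.2 (Or.inl ⟨e, he, rfl⟩)
    have e1 : decide (e.1 ∈ H.parityOn U) = direction H π 3 e.1 := by
      rw [← hP hp, Bool.eq_iff_iff, decide_eq_true_iff]
      exact hH.mem_parityOn_matching he (by simp)
    have e2 : decide (e.2 ∈ H.parityOn U) = direction H π 3 e.1 := by
      rw [← hP hp, Bool.eq_iff_iff, decide_eq_true_iff]
      exact hH.mem_parityOn_matching he (by simp)
    have j1 := (hH.junction_bound (π := π) (mem_incidences.2 (Or.inl ⟨e, he, Or.inl rfl⟩))).1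
    have j2 := (hH.junction_bound (π := π) (mem_incidences.2 (Or.inl ⟨e, he, Or.inr rfl⟩))).1
    have j3 := port_le_excess hH hπ hp true
    rw [e1, e2]
    simp only [Bool.not_true] at j3
    split_ifs at j1 j2 ⊢ <;> linarith
  have ht : 2 * (H.triples.map fun t : Triple =>
      (if direction H π 0 (H.prevVar t.1) = direction H π 0 t.1 ∧
        direction H π 0 t.1 = decide (t.1 ∈ H.parityOn U) then 0 else 1 : ℤ) +
      ((if direction H π 0 (H.prevVar t.2.1) = direction H π 0 t.2.1 ∧
        direction H π 0 t.2.1 = decide (t.2.1 ∈ H.parityOn U) then 0 else 1 : ℤ) +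
      (if direction H π 0 (H.prevVar t.2.2.1) = direction H π 0 t.2.2.1 ∧
        direction H π 0 t.2.2.1 = decide (t.2.2.1 ∈ H.parityOn U) then 0 else 1 : ℤ)) +
      (if (decide (t.1 ∈ H.parityOn U) ^^ (decide (t.2.1 ∈ H.parityOn U) ^^
        decide (t.2.2.1 ∈ H.parityOn U))) = t.bit then 0 else 1)).sum ≤
      ((H.triples.zip (H.targets.drop 1)).map fun p => circleTerm H π p.1.1 +
        (circleTerm H π p.1.2.1 + circleTerm H π p.1.2.2.1) + (excess H π 3 p.1.1 +
          (excess H π 3 p.1.2.1 + excess H π 3 p.1.2.2.1)) + coreTerm H π p.1 p.2).sum := by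
    rw [← List.sum_map_mul_left]
    conv_lhs => rw [← map_fst_zip (H := H), List.map_map]
    refine List.sum_le_sum fun p hz => ?_
    obtain ⟨(t : Triple), g⟩ := p
    have ht := (zip_fst hz).1
    have hv : ∀ y ∈ t.vars, y ∈ H.pnames := fun y hy => mem_pnames.2 (Or.inr ⟨t, ht, hy⟩)
    have m1 : t.1 ∈ t.vars := by simp [Triple.vars]
    have m2 : t.2.1 ∈ t.vars := by simp [Triple.vars]
    have m3 : t.2.2.1 ∈ t.vars := by simp [Triple.vars]
    have jj : ∀ y ∈ t.vars, _ := fun y hy =>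
      hH.junction_bound (π := π) (mem_incidences.2 (Or.inr ⟨t, ht, y, hy, rfl⟩))
    have hw : ∀ y ∈ t.vars, _ := fun y hy => wild_iff hI hO (b := t.bit) (hv y hy)
    obtain ⟨f1, f2, f3⟩ := hH.parityOn_triple (U := U) ht
    obtain ⟨c1, c2⟩ := core_lower_bound hH hπ hz
    have hN : ∀ (y : Var) (b : Bool), (if direction H π 0 (H.prevVar y) = direction H π 0 y ∧
        direction H π 0 y = b then 0 else 1 : ℤ) ≤ 1 := by intro y b; split_ifs <;> simp
    have hJ : ∀ y ∈ t.vars, 2 * (if direction H π 0 (H.prevVar y) = direction H π 0 y ∧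
        direction H π 0 y = direction H π 3 y then 0 else 1 : ℤ) ≤
        circleTerm H π y + portTerm H π t.bit y := by
      intro y hy
      refine le_trans (le_of_eq ?_) (jj y hy).1
      split_ifs <;> rfl
    have hW : ∀ y ∈ t.vars, wild U t.bit y = true → 2 ≤ circleTerm H π y + portTerm H π t.bit y :=
      fun y hy h => (jj y hy).2 ((hw y hy).1 h).1 ((hw y hy).1 h).2
    have := parity_repair (hN t.1) (hN t.2.1) (hN t.2.2.1) (hJ _ m1) (hJ _ m2) (hJ _ m3)
      (hW _ m1) (hW _ m2) (hW _ m3) c1 (fun hp w1 w2 w3 => c2 hp fun y hy hd => by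
        by_contra hc
        have : wild U t.bit y = true := (hw y hy).2 ⟨hd, by omega⟩
        simp only [Triple.vars, List.mem_cons, List.not_mem_nil, or_false] at hy
        rcases hy with rfl | rfl | rfl <;> simp_all) (parityOk U t) (by
        unfold parityOk
        rw [hP (hv _ m1), hP (hv _ m2), hP (hv _ m3)])
      _ _ _ (f1.trans (by rw [hP (hv _ m1)]; rfl)) (f2.trans (by rw [hP (hv _ m2)]; rfl))
      (f3.trans (by rw [hP (hv _ m3)]; rfl))
    refine le_trans this (le_of_eq ?_)
    ring
  linarith

end HybridInstance

/-! ### Tours as cyclic permutations, and their lengths -/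

namespace HybridInstance

variable {H : HybridInstance} {π : Equiv.Perm Label}

/-- The vertices of a tour. -/
def tourLabels (H : HybridInstance) (σ : List ℕ) : List Label :=
  σ.map fun i => H.labels.getD i (0, 0, 0)

theorem tourLabels_perm {d : Label → Label → ℕ} {σ : List ℕ} (hσ : (H.toATSP d).IsTour σ) :
    (H.tourLabels σ).Perm H.labels := by
  refine (hσ.map fun i => H.labels.getD i (0, 0, 0)).trans (List.Perm.of_eq ?_)
  apply List.ext_getElem
  · simp [toATSP]
  · intro i h1 h2
    simp [h2]

theorem _root_.List.rotate_one_eq_map_formPerm {α : Type*} [DecidableEq α] {l : List α}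
    (h : l.Nodup) : l.rotate 1 = l.map l.formPerm := by
  apply List.ext_getElem
  · simp
  · intro i h1 h2
    rw [List.getElem_rotate, List.getElem_map, List.formPerm_apply_getElem _ h]

theorem isTourPerm_formPerm {l : List Label} (hl : l.Perm H.labels) (hn : l.Nodup) :
    H.IsTourPerm l.formPerm := by
  refine ⟨fun v hv => hl.subset (List.formPerm_apply_mem_of_mem (hl.symm.subset hv)), ?_⟩
  rintro S hS ⟨v, hv, hm⟩
  have hpow : ∀ k, (l.formPerm ^ k) v ∈ S := by
    intro k
    induction k with
    | zero => simpa using hv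
    | succ k ih => rw [pow_succ', Equiv.Perm.mul_apply]; exact hS _ ih
  have h8 : (8, 0, 0) ∈ l := hl.symm.subset (by
    unfold labels
    simp only [List.mem_append, List.mem_map, List.mem_range]
    exact Or.inl (Or.inl (Or.inl ⟨0, by omega, rfl⟩)))
  obtain ⟨i, hi, rfl⟩ := List.mem_iff_getElem.1 (hl.symm.subset hm)
  obtain ⟨j, hj, hj'⟩ := List.mem_iff_getElem.1 h8
  -- The exponent is `j - i` modulo the length, written without a negative difference.
  have := hpow (l.length - i + j)
  rw [List.formPerm_pow_apply_getElem _ hn] at this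
  have e : (i + (l.length - i + j)) % l.length = j := by
    rw [show i + (l.length - i + j) = l.length + j by omega, Nat.add_mod_left, Nat.mod_eq_of_lt hj]
  simp only [e] at this
  rwa [hj'] at this

theorem tourLength_eq {d : Label → Label → ℕ} {σ : List ℕ} (hH : H.IsBermanKarpinski)
    (hσ : (H.toATSP d).IsTour σ) :
    (H.toATSP d).tourLength σ =
      (H.labels.map fun v => d v ((H.tourLabels σ).formPerm v)).sum := by
  have hp := tourLabels_perm hσ
  have hn := hp.nodup_iff.2 hH.nodup_labels
  rw [← (hp.map fun v => d v ((H.tourLabels σ).formPerm v)).sum_eq]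
  unfold ATSPInstance.tourLength
  have e : (List.zipWith (H.toATSP d).dist σ (σ.rotate 1)) =
      List.zipWith d (H.tourLabels σ) ((H.tourLabels σ).rotate 1) := by
    unfold tourLabels
    rw [← List.map_rotate, List.zipWith_map]
    rfl
  rw [e, List.rotate_one_eq_map_formPerm hn, List.zipWith_map_right, List.zipWith_self]

theorem mem_usedArcs {d : Label → Label → ℕ} {σ : List ℕ} (hH : H.IsBermanKarpinski)
    (hσ : (H.toATSP d).IsTour σ) {v w : Label} :
    (v, w) ∈ H.usedArcs σ ↔ (v, w) ∈ H.arcs ∧ v ∈ H.labels ∧ (H.tourLabels σ).formPerm v = w := by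
  have hp := tourLabels_perm hσ
  have hn := hp.nodup_iff.2 hH.nodup_labels
  have hne : H.tourLabels σ ≠ [] := by
    intro h
    have := hp.length_eq
    rw [h, hH.length_labels] at this
    simp at this
  -- Moving the first vertex to the end yields the list of successors. The default is not reached,
  -- because the tour is not empty.
  have e : (H.tourLabels σ).drop 1 ++ [(H.tourLabels σ).getD 0 (0, 0, 0)] =
      (H.tourLabels σ).map (H.tourLabels σ).formPerm := by
    rw [← List.rotate_one_eq_map_formPerm hn]
    cases hl : H.tourLabels σ with
    | nil => exact (hne hl).elim
    | cons a l => simp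
  unfold usedArcs
  rw [List.mem_filter, decide_eq_true_eq]
  change (v, w) ∈ H.arcs ∧ (v, w) ∈ (H.tourLabels σ).zip ((H.tourLabels σ).drop 1 ++
    [(H.tourLabels σ).getD 0 (0, 0, 0)]) ↔ _
  rw [e]
  refine and_congr_right fun _ => ?_
  rw [← hp.mem_iff, List.zip_map_right, List.mem_map]
  constructor
  · rintro ⟨⟨a, b⟩, h, he⟩
    simp only [Prod.map_apply, id, Prod.mk.injEq] at he
    obtain ⟨rfl, rfl⟩ := he
    have h1 := (List.of_mem_zip h).1
    rw [List.zip_eq_zipWith, List.zipWith_self, List.mem_map] at h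
    obtain ⟨c, _, hc⟩ := h
    simp only [Prod.mk.injEq] at hc
    obtain ⟨rfl, rfl⟩ := hc
    exact ⟨h1, rfl⟩
  · rintro ⟨h, rfl⟩
    refine ⟨(v, v), ?_, rfl⟩
    rw [List.zip_eq_zipWith, List.zipWith_self]
    exact List.mem_map.2 ⟨v, h, rfl⟩

theorem eq_of_isMid {v w : Label} (h1 : isMid v = true) (h2 : isMid w = true)
    (h3 : sameGadget v w = true) : v = w := by
  obtain ⟨i, x⟩ := v
  obtain ⟨j, y⟩ := w
  simp only [isMid, sameGadget, Bool.or_eq_true, Bool.and_eq_true, decide_eq_true_eq] at h1 h2 h3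
  rw [Prod.mk.injEq]
  exact ⟨by omega, h3.1⟩

theorem cost_le_dist₄ (hH : H.IsBermanKarpinski) {v w : Label} (h : v ≠ w) :
    outCost H v w + inCost H v w ≤ H.dist₄ v w := by
  have h1 := @isMid_of_arc H v w
  have h2 := @IsBermanKarpinski.sameGadget_of_arc H hH v w
  unfold outCost inCost dist₄
  by_cases ha : (v, w) ∈ H.arcs
  · simp [h, ha, h1 ha, h2 ha]
  · have h3 := eq_of_isMid (v := v) (w := w)
    revert h3
    cases sameGadget v w <;> cases isMid v <;> cases isMid w <;> simp [h, ha]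

/-- In doubled lengths a path edge counts 2, but the ledger charges 1 for it. The missing unit is
credited for each end that is a middle vertex, a correction with the same sum for all tours. -/
theorem cost_le_dist₂ (hH : H.IsBermanKarpinski) {v w : Label} (h : v ≠ w) :
    outCost H v w + inCost H v w + ((isMid v).toNat + (isMid w).toNat) ≤ 2 * H.dist₂ v w := by
  have h1 := @isMid_of_arc H v w
  have h2 := @IsBermanKarpinski.sameGadget_of_arc H hH v w
  have h3 := eq_of_isMid (v := v) (w := w)
  unfold outCost inCost dist₂
  by_cases ha : (v, w) ∈ H.arcs
  · simp [h, ha, h1 ha, h2 ha]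
  · revert h3
    cases sameGadget v w <;> cases isMid v <;> cases isMid w <;> simp [h, ha]

theorem sum_isMid (hH : H.IsBermanKarpinski) :
    (H.labels.map fun v => (isMid v).toNat).sum = H.m₂ + 3 * H.m₃ := by
  unfold labels
  rw [List.map_append, List.map_append, List.map_append, List.sum_append, List.sum_append,
    List.sum_append, List.map_map, List.sum_map_flatMap, List.sum_map_flatMap,
    List.sum_map_flatMap, hH.m₂_eq, m₃_eq]
  have h := H.length_pnames
  simp [Function.comp_def, path, isMid]
  omega

theorem IsTourPerm.ne (hπ : H.IsTourPerm π) (hH : H.IsBermanKarpinski) {v : Label}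
    (hv : v ∈ H.labels) : π v ≠ v := by
  by_cases h8 : v = (8, 0, 0)
  · subst h8
    intro h
    have h1 : ((8, 1, 0) : Label) ∈ H.labels := by
      unfold labels
      simp only [List.mem_append, List.mem_map, List.mem_range]
      exact Or.inl (Or.inl (Or.inl ⟨1, by have := hH.numCircles_pos; omega, rfl⟩))
    -- If the first hub were fixed, its complement would be a closed set that contains the second
    -- hub but not the first.
    refine hπ.cycle {v | v ≠ (8, 0, 0)} (fun v hv hc => hv ?_) ⟨_, by simp, h1⟩ rfl
    rw [← h] at hc
    exact π.injective hc
  · exact hπ.apply_ne hv h8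

section Tours

variable {d : Label → Label → ℕ} {σ : List ℕ} (hH : H.IsBermanKarpinski)
  (hσ : (H.toATSP d).IsTour σ)

include hH hσ

theorem numUnsat_decode_le : 2 * (H.numUnsat (assignmentOf (H.decode (H.usedArcs σ))) : ℤ) ≤
    totalExcess H (H.tourLabels σ).formPerm := by
  have hp := tourLabels_perm hσ
  have hn := hp.nodup_iff.2 hH.nodup_labels
  have hπ := isTourPerm_formPerm hp hn
  set π := (H.tourLabels σ).formPerm with hπ'
  have hinv : ∀ v ∈ H.labels, π⁻¹ v ∈ H.labels := by
    intro v hv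
    obtain ⟨w, hw, rfl⟩ := List.mem_map.1 ((hπ.perm hH).symm.subset hv)
    simpa using hw
  refine hπ.two_mul_numUnsat_le hH (fun v hv => ?_) (fun v hv => ?_)
  · have : inArc H π v = 1 ↔ (π⁻¹ v, v) ∈ H.arcs := by unfold inArc; split_ifs <;> simp_all
    rw [decide_eq_decide.2 this, Bool.eq_iff_iff, decide_eq_true_iff]
    simp only [inUsed, List.any_eq_true, decide_eq_true_eq]
    constructor
    · rintro ⟨⟨a, b⟩, h, rfl⟩
      obtain ⟨h1, -, h2⟩ := (mem_usedArcs hH hσ).1 h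
      rw [← hπ'] at h2
      rw [← h2] at h1 ⊢
      simpa using h1
    · exact fun h => ⟨(_, v), (mem_usedArcs hH hσ).2 ⟨h, hinv v hv, by simp [← hπ']⟩, rfl⟩
  · have : outArc H π v = 1 ↔ (v, π v) ∈ H.arcs := by unfold outArc; split_ifs <;> simp_all
    rw [decide_eq_decide.2 this, Bool.eq_iff_iff, decide_eq_true_iff]
    simp only [outUsed, List.any_eq_true, decide_eq_true_eq]
    constructor
    · rintro ⟨⟨a, b⟩, h, rfl⟩
      obtain ⟨h1, -, h2⟩ := (mem_usedArcs hH hσ).1 h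
      rw [← hπ'] at h2
      rwa [h2]
    · exact fun h => ⟨(v, _), (mem_usedArcs hH hσ).2 ⟨h, hv, rfl⟩, rfl⟩

theorem le_tourLength₄ (hd : d = H.dist₄) : (4 * H.m₂ + 20 * H.m₃ + 2 * H.numCircles + 2 +
    2 * H.numUnsat (assignmentOf (H.decode (H.usedArcs σ)))) ≤ (H.toATSP d).tourLength σ := by
  have hp := tourLabels_perm hσ
  have hπ := isTourPerm_formPerm hp (hp.nodup_iff.2 hH.nodup_labels)
  have h1 := numUnsat_decode_le hH hσ
  have h2 := sum_cost hH hπ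
  have h3 : (H.labels.map fun v => outCost H v ((H.tourLabels σ).formPerm v) +
      inCost H v ((H.tourLabels σ).formPerm v)).sum ≤ ((H.toATSP d).tourLength σ : ℤ) := by
    rw [tourLength_eq hH hσ, hd]
    push_cast [Nat.cast_list_sum, List.map_map, Function.comp_def]
    exact List.sum_le_sum fun v hv => cost_le_dist₄ hH (hπ.ne hH hv).symm
  zify
  linarith

/-- Each of the `m₂ + 3 m₃` middle vertices is credited once as tail and once as head of an arc;
this adds `2 m₂ + 6 m₃` to the ledger and gives twice the desired bound. -/
theorem le_tourLength₂ (hd : d = H.dist₂) : (3 * H.m₂ + 13 * H.m₃ + H.numCircles + 1 +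
    H.numUnsat (assignmentOf (H.decode (H.usedArcs σ)))) ≤ (H.toATSP d).tourLength σ := by
  have hp := tourLabels_perm hσ
  have hπ := isTourPerm_formPerm hp (hp.nodup_iff.2 hH.nodup_labels)
  have h1 := numUnsat_decode_le hH hσ
  have h2 := sum_cost hH hπ
  have h4 : ((H.labels.map fun v => (isMid v).toNat).sum : ℤ) = H.m₂ + 3 * H.m₃ := by
    exact_mod_cast sum_isMid hH
  have h5 : ((H.labels.map fun v => (isMid ((H.tourLabels σ).formPerm v)).toNat).sum : ℤ) =
      H.m₂ + 3 * H.m₃ := by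
    rw [← h4, ← ((hπ.perm hH).map fun v => (isMid v).toNat).sum_eq, List.map_map]
    rfl
  have h3 : (H.labels.map fun v => outCost H v ((H.tourLabels σ).formPerm v) +
      inCost H v ((H.tourLabels σ).formPerm v)).sum + (2 * H.m₂ + 6 * H.m₃) ≤
      2 * ((H.toATSP d).tourLength σ : ℤ) := by
    rw [tourLength_eq hH hσ, hd]
    push_cast [Nat.cast_list_sum, List.map_map, Function.comp_def] at h4 h5 ⊢
    rw [← List.sum_map_mul_left, show (2 * H.m₂ + 6 * H.m₃ : ℤ) =
      (H.m₂ + 3 * H.m₃) + (H.m₂ + 3 * H.m₃) by ring]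
    nth_rewrite 1 [← h4]
    rw [← h5, ← List.sum_map_add, ← List.sum_map_add]
    exact List.sum_le_sum fun v hv => cost_le_dist₂ hH (hπ.ne hH hv).symm
  zify
  linarith

end Tours

end HybridInstance

/-! ### Arranging blocks on a line -/

section Arrange

variable {α ι : Type*}

/-- The sum of `e` over consecutive elements of a list. -/
def pathSum (e : α → α → ℕ) : List α → ℕ
  | [] => 0
  | [_] => 0
  | a :: b :: l => e a b + pathSum e (b :: l)

variable {e : α → α → ℕ}

theorem pathSum_append_cons (l : List α) (a : α) (l' : List α) :
    pathSum e (l ++ a :: l') = pathSum e (l ++ [a]) + pathSum e (a :: l') := by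
  induction l with
  | nil => simp [pathSum]
  | cons b l ih =>
    cases l with
    | nil => simp [pathSum]
    | cons c l =>
      simp only [List.cons_append, pathSum] at ih ⊢
      rw [ih, add_assoc]

theorem pathSum_append_le {l l' : List α} {c : ℕ}
    (h : ∀ a ∈ l.getLast?, ∀ b ∈ l'.head?, e a b ≤ c) :
    pathSum e (l ++ l') ≤ pathSum e l + c + pathSum e l' := by
  induction l using List.reverseRecOn with
  | nil => simp [pathSum]
  | append_singleton l a _ =>
    cases l' with
    | nil => simp [pathSum]
    | cons b l' =>
      have := h a (by simp) b (by simp)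
      rw [List.append_assoc, List.singleton_append, pathSum_append_cons]
      simp only [pathSum]
      omega

theorem pathSum_reverse (l : List α) : pathSum (fun a b => e b a) l.reverse = pathSum e l := by
  induction l with
  | nil => rfl
  | cons a l ih =>
    cases l with
    | nil => rfl
    | cons b l =>
      rw [List.reverse_cons, List.reverse_cons, List.append_assoc, List.singleton_append,
        pathSum_append_cons, ← List.reverse_cons, ih]
      simp [pathSum, add_comm]

/-- The blocks in the order of the line, except that each run of blocks with value `false` is
reversed. The first list holds the first run. -/
def arrange (val : ι → Bool) (blk : ι → List α) : List ι → List α × List α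
  | [] => ([], [])
  | [x] => (blk x, [])
  | x :: y :: l =>
    if val x = val y then
      if val x then (blk x ++ (arrange val blk (y :: l)).1, (arrange val blk (y :: l)).2)
      else ((arrange val blk (y :: l)).1 ++ blk x, (arrange val blk (y :: l)).2)
    else (blk x, (arrange val blk (y :: l)).1 ++ (arrange val blk (y :: l)).2)

/-- The costs `c` of neighbours on the line bound the costs `e` of moving between their blocks. -/
structure LinkBound (e : α → α → ℕ) (val : ι → Bool) (blk : ι → List α) (c : ι → ι → ℕ)
    (x y : ι) : Prop where
  forward : val x = true → val y = true →
    ∀ a ∈ (blk x).getLast?, ∀ b ∈ (blk y).head?, e a b ≤ c x y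
  backward : val x = false → val y = false →
    ∀ a ∈ (blk y).getLast?, ∀ b ∈ (blk x).head?, e a b ≤ c x y
  change : val x ≠ val y → 1 ≤ c x y

/-- A free path with ends in `good`. -/
structure IsBlock (e : α → α → ℕ) (good : Set α) (l : List α) : Prop where
  ne_nil : l ≠ []
  free : pathSum e l = 0
  head_mem : ∀ a ∈ l.head?, a ∈ good
  last_mem : ∀ a ∈ l.getLast?, a ∈ good

/-- The first run is kept apart, because a preceding block of value `false` has to be put behind it
and not in front of the whole. The break between the two lists, already counted with cost 1, is also
the place where further blocks can be inserted. -/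
structure ArrangeSpec (e : α → α → ℕ) (good : Set α) (val : ι → Bool) (blk : ι → List α)
    (c : ι → ι → ℕ) (x : ι) (l : List ι) (r : List α × List α) : Prop where
  perm : (r.1 ++ r.2).Perm ((x :: l).flatMap blk)
  ne_nil : r.1 ≠ []
  cost : pathSum e r.1 + pathSum e r.2 + (if r.2 = [] then 0 else 1) ≤ pathSum c (x :: l)
  head_eq : val x = true → r.1.head? = (blk x).head?
  last_eq : val x = false → r.1.getLast? = (blk x).getLast?
  end_eq : ∀ y ∈ (x :: l).getLast?, val y = true → (r.1 ++ r.2).getLast? = (blk y).getLast?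
  all_eq : r.2 = [] → ∀ y ∈ l, val y = val x
  head_mem : ∀ a ∈ r.1.head?, a ∈ good
  last_mem : ∀ a ∈ r.1.getLast?, a ∈ good
  head_mem' : ∀ a ∈ r.2.head?, a ∈ good
  last_mem' : ∀ a ∈ r.2.getLast?, a ∈ good

/-- Inside a run, neighbouring blocks are joined in the direction of the run at the cost `c`; at a
change of value one jump between good vertices is enough. -/
theorem arrange_spec {good : Set α} {val : ι → Bool} {blk : ι → List α} {c : ι → ι → ℕ}
    (hg : ∀ a ∈ good, ∀ b, e a b ≤ 1) (l : List ι) (x : ι)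
    (hb : ∀ y ∈ x :: l, IsBlock e good (blk y)) (hc : (x :: l).IsChain (LinkBound e val blk c)) :
    ArrangeSpec e good val blk c x l (arrange val blk (x :: l)) := by
  induction l generalizing x with
  | nil =>
    have h := hb x (by simp)
    simp only [arrange]
    constructor
    · simp
    · exact h.ne_nil
    · simp [pathSum, h.free]
    · simp
    · simp
    · simp
    · simp
    · exact h.head_mem
    · exact h.last_mem
    · simp
    · simp
  | cons y l ih =>
    have h := hb x (by simp)
    rw [List.isChain_cons_cons] at hc
    have ih := ih y (fun z hz => hb z (List.mem_cons_of_mem _ hz)) hc.2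
    simp only [arrange]
    set r := arrange val blk (y :: l) with hr
    have hn : ∀ l' : List α, (l' ++ r.1).getLast? = r.1.getLast? := by
      intro l'; rw [List.getLast?_append_of_ne_nil _ ih.ne_nil]
    have hy := ih.end_eq
    have hgl : (x :: y :: l).getLast? = (y :: l).getLast? := by simp
    by_cases hxy : val x = val y
    · rw [if_pos hxy]
      cases hx : val x
      · rw [hx] at hxy
        simp only [Bool.false_eq_true, if_false]
        have hglue := hc.1.backward hx hxy.symm
        rw [← ih.last_eq hxy.symm] at hglue
        have hcost := pathSum_append_le hglue
        constructor
        · refine List.Perm.trans ?_ (ih.perm.append_left (blk x))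
          simp only
          rw [List.append_assoc]
          refine (List.perm_append_comm_assoc _ _ _)
        · simp [h.ne_nil]
        · have := ih.cost
          have := h.free
          simp only [pathSum] at *
          omega
        · simp [hx]
        · intro _; rw [List.getLast?_append_of_ne_nil _ h.ne_nil]
        · intro z hz hv
          rw [hgl] at hz
          have := hy z hz hv
          by_cases h2 : r.2 = []
          · have h3 := ih.all_eq h2
            have : z ∈ y :: l := List.mem_of_getLast? hz
            rcases List.mem_cons.1 this with rfl | h4
            · rw [hv] at hxy; cases hxy
            · rw [h3 z h4, ← hxy] at hv; cases hv
          · rw [List.getLast?_append_of_ne_nil _ h2] at this ⊢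
            exact this
        · intro h2 z hz
          rcases List.mem_cons.1 hz with rfl | h4
          · exact hxy.symm.trans hx.symm
          · rw [ih.all_eq h2 z h4, ← hxy, hx]
        · rw [List.head?_append_of_ne_nil _ ih.ne_nil]; exact ih.head_mem
        · rw [List.getLast?_append_of_ne_nil _ h.ne_nil]; exact h.last_mem
        · exact ih.head_mem'
        · exact ih.last_mem'
      · rw [hx] at hxy
        simp only [if_true]
        have hglue := hc.1.forward hx hxy.symm
        rw [← ih.head_eq hxy.symm] at hglue
        have hcost := pathSum_append_le hglue
        constructor
        · simp only [List.append_assoc, List.flatMap_cons (x := x)]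
          exact ih.perm.append_left _
        · simp [h.ne_nil]
        · have := ih.cost
          have := h.free
          simp only [pathSum] at *
          omega
        · intro _; rw [List.head?_append_of_ne_nil _ h.ne_nil]
        · simp [hx]
        · intro z hz hv
          rw [hgl] at hz
          rw [← hy z hz hv]
          simp only [List.append_assoc]
          rw [List.getLast?_append_of_ne_nil _ (by simp [ih.ne_nil])]
        · intro h2 z hz
          rcases List.mem_cons.1 hz with rfl | h4
          · exact hxy.symm.trans hx.symm
          · rw [ih.all_eq h2 z h4, ← hxy, hx]
        · rw [List.head?_append_of_ne_nil _ h.ne_nil]; exact h.head_mem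
        · rw [hn]; exact ih.last_mem
        · exact ih.head_mem'
        · exact ih.last_mem'
    · rw [if_neg hxy]
      have hch := hc.1.change hxy
      have hcost : pathSum e (r.1 ++ r.2) ≤
          pathSum e r.1 + pathSum e r.2 + (if r.2 = [] then 0 else 1) := by
        by_cases h2 : r.2 = []
        · simp [h2, pathSum]
        · have := pathSum_append_le (e := e) (l := r.1) (l' := r.2) (c := 1)
            fun a ha b _ => hg a (ih.last_mem a ha) b
          rw [if_neg h2]
          omega
      have hne : r.1 ++ r.2 ≠ [] := by simp [ih.ne_nil]
      constructor
      · simp only [List.flatMap_cons (x := x)]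
        exact ih.perm.append_left _
      · exact h.ne_nil
      · have := ih.cost
        have := h.free
        simp only [pathSum, hne, if_false] at *
        omega
      · intro _; rfl
      · intro _; rfl
      · intro z hz hv
        rw [hgl] at hz
        rw [List.getLast?_append_of_ne_nil _ hne, hy z hz hv]
      · exact fun h => (hne h).elim
      · exact h.head_mem
      · exact h.last_mem
      · rw [List.head?_append_of_ne_nil _ ih.ne_nil]; exact ih.head_mem
      · by_cases h2 : r.2 = []
        · simp only [h2, List.append_nil]; exact ih.last_mem
        · rw [List.getLast?_append_of_ne_nil _ h2]; exact ih.last_mem'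

end Arrange

section Arrange

variable {α ι : Type*} {e : α → α → ℕ} {good : Set α} {val : ι → Bool} {blk : ι → List α}
  {c : ι → ι → ℕ}

theorem pathSum_wrap {h h' : α} {s t : ℕ} {C : List α} (hC : C ≠ []) (hs : ∀ b ∈ C.head?, e h b ≤ s)
    (ht : ∀ a ∈ C.getLast?, e a h' ≤ t) :
    pathSum e (h :: (C ++ [h'])) ≤ s + pathSum e C + t := by
  have h1 := pathSum_append_le (e := e) (l := [h]) (l' := C ++ [h']) (c := s) (by
    rw [List.head?_append_of_ne_nil _ hC]; simpa using hs)
  have h2 := pathSum_append_le (e := e) (l := C) (l' := [h']) (c := t) (by simpa using ht)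
  simp only [List.singleton_append, pathSum] at h1 h2
  omega

theorem pathSum_flatten_append_le (hg : ∀ a ∈ good, ∀ b, e a b ≤ 1) {Os : List (List α)}
    (hO : ∀ o ∈ Os, IsBlock e good o) (l : List α) :
    pathSum e (Os.flatten ++ l) ≤ Os.length + pathSum e l := by
  induction Os with
  | nil => simp
  | cons o Os ih =>
    have h := hO o (by simp)
    have h1 := pathSum_append_le (e := e) (l := o) (l' := Os.flatten ++ l) (c := 1)
      fun a ha b _ => hg a (h.last_mem a ha) b
    have h2 := ih fun o ho => hO o (List.mem_cons_of_mem _ ho)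
    have h3 := h.free
    simp only [List.flatten_cons, List.append_assoc, List.length_cons]
    omega

/-- Blocks inserted into an existing break cost one jump each, since the break itself is paid for.
This needs two different values on the line as soon as there is something to insert. -/
theorem ArrangeSpec.tour (hg : ∀ a ∈ good, ∀ b, e a b ≤ 1) {x : ι} {l : List ι}
    {r : List α × List α} (hr : ArrangeSpec e good val blk c x l r) {Os : List (List α)}
    (hO : ∀ o ∈ Os, IsBlock e good o) (hOs : Os ≠ [] → ∃ y ∈ l, val y ≠ val x) {h h' : α} {s t : ℕ}
    (hs : ∀ b ∈ r.1.head?, e h b ≤ s) (ht : ∀ a ∈ (r.1 ++ r.2).getLast?, e a h' ≤ t) :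
    ∃ C : List α, C.Perm ((x :: l).flatMap blk ++ Os.flatten) ∧
      pathSum e (h :: (C ++ [h'])) ≤ pathSum c (x :: l) + s + t + Os.length := by
  have hcost := hr.cost
  by_cases h2 : r.2 = []
  · have hO' : Os = [] := by
      by_contra hne
      obtain ⟨y, hy, hv⟩ := hOs hne
      exact hv (hr.all_eq h2 y hy)
    have hp := hr.perm
    rw [h2, List.append_nil] at ht hp
    refine ⟨r.1, by simpa [hO'] using hp, ?_⟩
    have := pathSum_wrap hr.ne_nil hs ht
    omega
  · refine ⟨r.1 ++ (Os.flatten ++ r.2), ?_, ?_⟩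
    · refine List.Perm.trans ?_ (hr.perm.append_right _)
      rw [List.append_assoc]
      exact List.perm_append_comm.append_left _
    · have h3 := pathSum_wrap (e := e) (C := r.1 ++ (Os.flatten ++ r.2)) (h := h) (h' := h')
        (s := s) (t := t) (by simp [hr.ne_nil])
        (by rw [List.head?_append_of_ne_nil _ hr.ne_nil]; exact hs)
        (by
          rw [← List.append_assoc, List.getLast?_append_of_ne_nil _ h2]
          rwa [List.getLast?_append_of_ne_nil _ h2] at ht)
      have h4 := pathSum_append_le (e := e) (l := r.1) (l' := Os.flatten ++ r.2) (c := 1)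
        fun a ha b _ => hg a (hr.last_mem a ha) b
      have h5 := pathSum_flatten_append_le hg hO r.2
      rw [if_neg h2] at hcost
      omega

theorem exists_circle_tour (hg : ∀ a ∈ good, ∀ b, e a b ≤ 1) (hg' : ∀ a, ∀ b ∈ good, e a b ≤ 1)
    {xs : List ι} {x z : ι} (hx : x ∈ xs.head?) (hz : z ∈ xs.getLast?)
    (hb : ∀ y ∈ xs, IsBlock e good (blk y)) (hc : xs.IsChain (LinkBound e val blk c))
    {Os : List (List α)} (hO : ∀ o ∈ Os, IsBlock e good o)
    (hOs : Os ≠ [] → ∃ y ∈ xs, ∃ y' ∈ xs, val y ≠ val y') {h h' : α} (hh : h ∈ good)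
    (hh' : h' ∈ good) {t : ℕ} (xs_true : val x = true → ∀ b ∈ (blk x).head?, e h b ≤ 0)
    (xs_false : val x = false → ∀ a ∈ (blk x).getLast?, e a h' ≤ 0)
    (zs_true : val z = true → ∀ a ∈ (blk z).getLast?, e a h' ≤ t)
    (zs_false : val z = false → ∀ b ∈ (blk z).head?, e h b ≤ 0) :
    ∃ C : List α, C.Perm (xs.flatMap blk ++ Os.flatten) ∧
      pathSum e (h :: (C ++ [h'])) ≤
        pathSum c xs + (if val z = val x then 0 else 1) + t + Os.length := by
  have mixed : ∀ {x : ι} {l : List ι}, (∀ y, y ∈ x :: l ↔ y ∈ xs) → Os ≠ [] →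
      ∃ y ∈ l, val y ≠ val x := by
    intro x l hl hne
    obtain ⟨y, hy, y', hy', hv⟩ := hOs hne
    rw [← hl, List.mem_cons] at hy hy'
    by_cases hyx : val y = val x
    · rcases hy' with rfl | hy'
      · exact (hv hyx).elim
      · exact ⟨y', hy', fun h => hv (hyx.trans h.symm)⟩
    · rcases hy with rfl | hy
      · exact (hyx rfl).elim
      · exact ⟨y, hy, hyx⟩
  -- If both ends have value `false`, the circle is entered at `z` and left at `x`. Reversing the
  -- line and negating the values reduces this to the forward situation.
  by_cases hff : val x = false ∧ val z = false
  · obtain ⟨hvx, hvz⟩ := hff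
    have hr0 : xs.reverse.head? = some z := by rw [List.head?_reverse]; exact hz
    have hl0 : xs.reverse.getLast? = some x := by rw [List.getLast?_reverse]; exact hx
    obtain ⟨l, hl⟩ : ∃ l, xs.reverse = z :: l := by
      cases hxs : xs.reverse with
      | nil => simp [hxs] at hr0
      | cons a l => rw [hxs] at hr0; simp at hr0; exact ⟨l, by rw [hr0]⟩
    have hmem : ∀ y, y ∈ z :: l ↔ y ∈ xs := fun y => by rw [← hl, List.mem_reverse]
    have hch : (z :: l).IsChain (LinkBound e (fun y => !val y) blk (fun y y' => c y' y)) := by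
      rw [← hl, List.isChain_reverse]
      refine hc.imp fun a b hab => ⟨fun h1 h2 => ?_, fun h1 h2 => ?_, fun h1 => ?_⟩
      · exact hab.backward (by simpa using h2) (by simpa using h1)
      · exact hab.forward (by simpa using h2) (by simpa using h1)
      · exact hab.change fun h => h1 (by rw [h])
    have hr := arrange_spec hg l z (fun y hy => hb y ((hmem y).1 hy)) hch
    obtain ⟨C, hC, hcost⟩ := hr.tour hg hO (fun hne => by
        obtain ⟨y, hy, hv⟩ := mixed hmem hne
        exact ⟨y, hy, by simpa using hv⟩) (h := h) (h' := h') (s := 0) (t := 0)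
      (by rw [hr.head_eq (by simp [hvz])]; exact zs_false hvz)
      (by
        rw [hr.end_eq x (by rw [← hl]; exact hl0) (by simp [hvx])]
        exact xs_false hvx)
    refine ⟨C, hC.trans ((List.Perm.flatMap_right _ ?_).append_right _), hcost.trans ?_⟩
    · rw [← hl]; exact List.reverse_perm xs
    · rw [← hl, pathSum_reverse]
      omega
  · obtain ⟨l, rfl⟩ : ∃ l, xs = x :: l := by
      cases xs with
      | nil => simp at hx
      | cons a l => simp at hx; exact ⟨l, by rw [hx]⟩
    have hr := arrange_spec hg l x hb hc
    cases hvx : val x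
    -- If the ends differ, one extra jump at the start or the end of the circle is needed, which is
    -- the term for the border equation.
    · have hvz : val z = true := by simpa [hvx] using hff
      obtain ⟨C, hC, hcost⟩ := hr.tour hg hO (mixed fun _ => Iff.rfl) (h := h) (h' := h') (s := 1)
        (t := t) (fun b _ => hg h hh b) (by rw [hr.end_eq z hz hvz]; exact zs_true hvz)
      exact ⟨C, hC, hcost.trans (by simp [hvz])⟩
    · have hs : ∀ b ∈ (arrange val blk (x :: l)).1.head?, e h b ≤ 0 := by
        rw [hr.head_eq hvx]; exact xs_true hvx
      cases hvz : val z
      · obtain ⟨C, hC, hcost⟩ := hr.tour hg hO (mixed fun _ => Iff.rfl) (h := h) (h' := h') hs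
          (t := 1) (fun a _ => hg' a h' hh')
        exact ⟨C, hC, hcost.trans (by simp)⟩
      · obtain ⟨C, hC, hcost⟩ := hr.tour hg hO (mixed fun _ => Iff.rfl) (h := h) (h' := h') hs
          (t := t) (by rw [hr.end_eq z hz hvz]; exact zs_true hvz)
        exact ⟨C, hC, hcost.trans (by simp)⟩

end Arrange

/-! ### Short tours -/

/-- The number by which the length of an arc is charged for not being short. -/
def jump (H : HybridInstance) (v w : Label) : ℕ :=
  if (sameGadget v w && (isMid v || isMid w)) || decide ((v, w) ∈ H.arcs) then 0
  else if isMid v && isMid w then 2 else 1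

/-- The vertices that are not in the middle of a gadget. -/
def endLabels : Set Label := {v | isMid v = false}

/-- The way through a parity gadget. -/
def passage (b : Bool) (p : Var) : List Label := [pin b p, (4, p), pout b p]

theorem mem_endLabels {v : Label} : v ∈ endLabels ↔ v.1 ≠ 1 ∧ v.1 ≠ 4 := by
  simp [endLabels, isMid]

section

variable {H : HybridInstance}

theorem jump_le_one_left : ∀ v ∈ endLabels, ∀ w, jump H v w ≤ 1 := by
  intro v hv w
  have : isMid v = false := hv
  unfold jump
  split_ifs <;> simp_all

theorem jump_le_one_right : ∀ v, ∀ w ∈ endLabels, jump H v w ≤ 1 := by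
  intro v w hw
  have : isMid w = false := hw
  unfold jump
  split_ifs <;> simp_all

theorem jump_eq_zero {v w : Label} (h : (v, w) ∈ H.arcs) : jump H v w = 0 := by
  simp [jump, h]

theorem isBlock_passage (b : Bool) (p : Var) : IsBlock (jump H) endLabels (passage b p) := by
  constructor
  · simp [passage]
  · cases b <;> simp [passage, pathSum, jump, sameGadget, isMid, pin, pout]
  · cases b <;> simp [passage, mem_endLabels, pin]
  · cases b <;> simp [passage, mem_endLabels, pout]

theorem isBlock_path (x : Var) : IsBlock (jump H) endLabels (path 0 x) := by
  constructor <;> simp [path, pathSum, jump, sameGadget, isMid, mem_endLabels]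

theorem isBlock_reverse_path (x : Var) :
    IsBlock (jump H) endLabels (path 0 x).reverse := by
  constructor <;> simp [path, pathSum, jump, sameGadget, isMid, mem_endLabels]

end

theorem IsBlock.append {α : Type*} {e : α → α → ℕ} {good : Set α} {l l' : List α}
    (hl : IsBlock e good l) (hl' : IsBlock e good l')
    (h : ∀ a ∈ l.getLast?, ∀ b ∈ l'.head?, e a b ≤ 0) : IsBlock e good (l ++ l') := by
  refine ⟨by simp [hl.ne_nil], ?_, ?_, ?_⟩
  · have := pathSum_append_le h
    have := hl.free
    have := hl'.free
    omega
  · rw [List.head?_append_of_ne_nil _ hl.ne_nil]; exact hl.head_mem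
  · rw [List.getLast?_append_of_ne_nil _ hl'.ne_nil]; exact hl'.last_mem

/-- The values of the variables and the parity gadgets at the variables. For the first variable of a
matching equation, `mate` is the second one. -/
structure TourPlan where
  value : Var → Bool
  bit : Var → Bool
  port : Var → Var
  mate : Var → Var

namespace TourPlan

variable (P : TourPlan)

/-- The parity gadget is visited next to the circle gadget before `x`. -/
def takes (x : Var) : Bool :=
  if P.bit x then P.value x && P.value (P.mate x) else !P.value x

/-- The parity gadget fits neither of its variables. -/
def orphan (x : Var) : Bool := P.bit x && (!P.value x && P.value (P.mate x))

/-- The parity gadget fits both of its variables. -/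
def conflict (x : Var) : Bool := P.bit x && (P.value x && !P.value (P.mate x))

/-- The visit of the parity gadget. -/
def extra (x : Var) : List Label := if P.takes x then passage (P.bit x) (P.port x) else []

/-- The part of the tour between the variable before `x` and `x`. -/
def block (H : HybridInstance) (x : Var) : List Label :=
  if P.value x then path 0 (H.prevVar x) ++ P.extra x
  else P.extra x ++ (path 0 (H.prevVar x)).reverse

/-- The part of the tour that visits a parity gadget which fits neither of its variables. -/
def orphanVisit (x : Var) : List Label :=
  if P.orphan x then passage (P.bit x) (P.port x) else []

/-- The cost of moving from the block of `x` to the one of `y`. -/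
def linkCost (x y : Var) : ℕ :=
  (if P.value x = P.value y then 0 else 1) + (P.conflict x).toNat

/-- The plan fits the instance. -/
structure Valid (H : HybridInstance) : Prop where
  incidence : ∀ x ∈ H.vars, (x, P.bit x, P.port x) ∈ H.incidences
  mate_mem : ∀ x ∈ H.vars, P.mate x ∈ H.vars
  mate_fst : ∀ x ∈ H.vars, (P.mate x).1 = x.1

variable {P} {H : HybridInstance} (hP : P.Valid H) {x : Var} (hx : x ∈ H.vars)

include hP hx

theorem arc_cport : (H.cport x, if P.bit x then pin (P.bit x) (P.port x) else H.ain x) ∈ H.arcs :=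
  HybridInstance.mem_arcs.2 (Or.inl ⟨_, hP.incidence x hx, Or.inl ⟨rfl, rfl⟩⟩)

theorem arc_pout : (pout (P.bit x) (P.port x), if P.bit x then H.ain x else H.cport x) ∈ H.arcs :=
  HybridInstance.mem_arcs.2 (Or.inl ⟨_, hP.incidence x hx, Or.inr (Or.inl ⟨rfl, rfl⟩)⟩)

theorem arc_aout : (H.aout x, if P.bit x then H.cport x else pin (P.bit x) (P.port x)) ∈ H.arcs :=
  HybridInstance.mem_arcs.2 (Or.inl ⟨_, hP.incidence x hx, Or.inr (Or.inr ⟨rfl, rfl⟩)⟩)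

theorem isBlock_block : IsBlock (jump H) endLabels (P.block H x) := by
  have h1 := arc_cport hP hx
  have h2 := arc_pout hP hx
  unfold block extra takes
  cases hv : P.value x
  · cases hb : P.bit x
    · rw [hb] at h2
      simp only [Bool.false_eq_true, if_false, Bool.not_false, if_true] at h2 ⊢
      refine (isBlock_passage _ _).append (isBlock_reverse_path _) ?_
      have := jump_eq_zero h2
      simpa [passage, path, HybridInstance.cport] using this
    · simp only [Bool.false_eq_true, if_false, Bool.false_and, if_true, List.nil_append]
      exact isBlock_reverse_path _
  · cases hb : P.bit x
    · simp only [Bool.false_eq_true, if_false, Bool.not_true, if_true, List.append_nil]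
      exact isBlock_path _
    · rw [hb] at h1
      simp only [if_true, Bool.true_and] at h1 ⊢
      split_ifs
      · refine (isBlock_path _).append (isBlock_passage _ _) ?_
        have := jump_eq_zero h1
        simpa [passage, path, HybridInstance.cport] using this
      · simpa using isBlock_path _

omit hP hx in
theorem head_block (hv : P.value x = true) : (P.block H x).head? = some (0, H.prevVar x) := by
  simp [block, hv, path]

omit hP hx in
theorem last_block (hv : P.value x = false) :
    (P.block H x).getLast? = some (0, H.prevVar x) := by
  simp [block, hv, path]

/-- In a conflict the parity gadget is visited at the second variable. The forward way at `x` then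
misses it, and the step from `cport` to `ain` is a jump. -/
theorem jump_last_block (hv : P.value x = true) :
    ∀ a ∈ (P.block H x).getLast?, jump H a (H.ain x) ≤ (P.conflict x).toNat := by
  have h1 := arc_cport hP hx
  have h2 := arc_pout hP hx
  have h3 := jump_le_one_left (H := H) (H.cport x) (by
    rw [mem_endLabels]; simp [HybridInstance.cport]) (H.ain x)
  unfold block extra takes conflict
  cases hb : P.bit x
  · rw [hb] at h1
    have := jump_eq_zero h1
    simpa [hv, path, HybridInstance.cport] using this
  · rw [hb] at h2
    have := jump_eq_zero h2
    cases hm : P.value (P.mate x)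
    · simpa [hv, path, hm, HybridInstance.cport] using h3
    · simpa [hv, passage, hm] using this

theorem jump_head_block (hv : P.value x = false) :
    ∀ b ∈ (P.block H x).head?, jump H (H.aout x) b ≤ 0 := by
  have h1 := arc_aout hP hx
  unfold block extra takes
  cases hb : P.bit x <;> rw [hb] at h1 <;> have := jump_eq_zero h1
  · simpa [hv, passage] using this
  · simpa [hv, path, HybridInstance.cport] using this

end TourPlan

theorem isChain_map_range' {α : Type*} {R : α → α → Prop} (g : ℕ → α) (m k : ℕ)
    (h : ∀ i, k ≤ i → i + 1 < k + m → R (g i) (g (i + 1))) : ((List.range' k m).map g).IsChain R := by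
  induction m generalizing k with
  | zero => simp
  | succ m ih =>
    cases m with
    | zero => simp
    | succ m =>
      have := ih (k + 1) fun i h1 h2 => h i (by omega) (by omega)
      simp only [List.range'_succ, List.map_cons] at this ⊢
      rw [List.isChain_cons_cons]
      exact ⟨h k le_rfl (by omega), this⟩

namespace HybridInstance

variable {H : HybridInstance}

/-- The variables of a circle. -/
def circleVars (H : HybridInstance) (l : ℕ) : List Var :=
  (List.range' 1 (H.circleSize l)).map fun i => (l, i)

theorem mem_circleVars {l : ℕ} (hl : l < H.numCircles) {x : Var} :
    x ∈ H.circleVars l ↔ x ∈ H.vars ∧ x.1 = l := by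
  rw [mem_vars]
  obtain ⟨l', i⟩ := x
  simp only [circleVars, List.mem_map, List.mem_range'_1, Prod.mk.injEq]
  constructor
  · rintro ⟨a, ⟨h1, h2⟩, rfl, rfl⟩
    exact ⟨⟨hl, h1, by omega⟩, rfl⟩
  · rintro ⟨⟨h1, h2, h3⟩, rfl⟩
    exact ⟨i, ⟨h2, by omega⟩, rfl, rfl⟩

/-- A sum over links omits the change of value before the first variable and the conflict at the
last one; with these two the links add up to a sum over variables. -/
theorem pathSum_linkCost (P : TourPlan) (l m k : ℕ) (hk : 1 ≤ k) :
    pathSum P.linkCost ((List.range' k (m + 1)).map fun i => (l, i)) +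
      (if P.value (H.prevVar (l, k)) = P.value (l, k) then 0 else 1) +
      (P.conflict (l, k + m)).toNat =
    (((List.range' k (m + 1)).map fun i => (l, i)).map fun x =>
      (if P.value (H.prevVar x) = P.value x then 0 else 1) + (P.conflict x).toNat).sum := by
  induction m generalizing k with
  | zero => simp [pathSum]
  | succ m ih =>
    have := ih (k + 1) (by omega)
    have e : H.prevVar (l, k + 1) = (l, k) := by
      have : k ≠ 0 := by omega
      simp [prevVar, this]
    rw [e] at this
    rw [List.range'_succ, List.map_cons, List.map_cons, List.sum_cons, ← this]
    rw [List.range'_succ, List.map_cons]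
    simp only [pathSum, TourPlan.linkCost]
    rw [show k + 1 + m = k + (m + 1) by omega]
    omega

theorem exists_circle (hH : H.IsBermanKarpinski) {P : TourPlan} (hP : P.Valid H) {l : ℕ}
    (hl : l < H.numCircles) :
    ∃ C : List Label, C.Perm ((H.circleVars l).flatMap (P.block H) ++
        (H.circleVars l).flatMap P.orphanVisit) ∧
      pathSum (jump H) ((8, l, 0) :: (C ++ [(8, l + 1, 0)])) ≤ ((H.circleVars l).map fun x =>
        (if P.value (H.prevVar x) = P.value x then 0 else 1) + (P.conflict x).toNat +
          (P.orphan x).toNat).sum := by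
  have hs := hH.seven_le_circleSize hl
  have hmem : ∀ x ∈ H.circleVars l, x ∈ H.vars := fun x hx => ((mem_circleVars hl).1 hx).1
  have h1m : (l, 1) ∈ H.vars := mem_vars.2 ⟨hl, le_rfl, by simp only; omega⟩
  have hsm : (l, H.circleSize l) ∈ H.vars := hH.border_mem hl
  have hprev : H.prevVar (l, 1) = (l, H.circleSize l) := by simp [prevVar]
  have hain : H.ain (l, H.circleSize l) = (8, l + 1, 0) := by simp [ain]
  have haout : H.aout (l, H.circleSize l) = (8, l, 0) := by simp [aout]
  obtain ⟨m, hm⟩ : ∃ m, H.circleSize l = m + 1 := ⟨H.circleSize l - 1, by omega⟩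
  obtain ⟨C, hC, hcost⟩ := exists_circle_tour (e := jump H) (good := endLabels)
    (val := P.value) (blk := P.block H) (c := P.linkCost) jump_le_one_left jump_le_one_right
    (xs := H.circleVars l) (x := (l, 1)) (z := (l, H.circleSize l))
    (by simp [circleVars, hm, List.range'_succ])
    (by simp [circleVars, hm, List.range'_concat, add_comm])
    (fun y hy => TourPlan.isBlock_block hP (hmem y hy))
    (isChain_map_range' _ _ _ fun i h1 h2 => by
      have hi : (l, i) ∈ H.vars := mem_vars.2 ⟨hl, h1, by simp only; omega⟩
      have hp : H.prevVar (l, i + 1) = (l, i) := by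
        have : i ≠ 0 := by omega
        simp [prevVar, this]
      have hb : ¬ i = H.circleSize l := by omega
      have ha : H.ain (l, i) = (0, l, i) := by simp [ain, hb]
      have ha' : H.aout (l, i) = (0, l, i) := by simp [aout, hb]
      refine ⟨fun hv hv' => ?_, fun hv hv' => ?_, fun hv => ?_⟩
      · rw [TourPlan.head_block hv', hp]
        intro a h b hb
        rw [Option.mem_some_iff] at hb
        have := TourPlan.jump_last_block hP hi hv a h
        rw [ha, hb] at this
        simpa [TourPlan.linkCost, hv, hv'] using this
      · rw [TourPlan.last_block hv', hp]
        intro a h b hb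
        rw [Option.mem_some_iff] at h
        have := TourPlan.jump_head_block hP hi hv b hb
        rw [ha', h] at this
        omega
      · simp [TourPlan.linkCost, hv])
    (Os := ((H.circleVars l).filter P.orphan).map fun x => passage (P.bit x) (P.port x))
    (fun o ho => by
      obtain ⟨x, _, rfl⟩ := List.mem_map.1 ho
      exact isBlock_passage _ _)
    -- The two variables of an orphan gadget have different values and lie on the same circle, so
    -- there is a break for inserting its visit.
    (fun hne => by
      obtain ⟨x, hx⟩ := List.exists_mem_of_ne_nil ((H.circleVars l).filter P.orphan)
        (fun h => hne (by rw [h]; rfl))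
      rw [List.mem_filter] at hx
      have ho := hx.2
      simp only [TourPlan.orphan, Bool.and_eq_true, Bool.not_eq_true'] at ho
      have hx' := (mem_circleVars hl).1 hx.1
      refine ⟨x, hx.1, P.mate x, (mem_circleVars hl).2 ⟨hP.mate_mem x hx'.1,
        (hP.mate_fst x hx'.1).trans hx'.2⟩, ?_⟩
      rw [ho.2.1, ho.2.2]
      simp)
    (h := (8, l, 0)) (h' := (8, l + 1, 0)) (by simp [mem_endLabels]) (by simp [mem_endLabels])
    (t := (P.conflict (l, H.circleSize l)).toNat)
    (fun hv => by
      rw [TourPlan.head_block hv, hprev]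
      have := jump_eq_zero (mem_arcs.2 (Or.inr (Or.inl ⟨l, hl, Or.inl ⟨rfl, rfl⟩⟩)))
      simpa using this)
    (fun hv => by
      rw [TourPlan.last_block hv, hprev]
      have := jump_eq_zero (mem_arcs.2 (Or.inr (Or.inl ⟨l, hl, Or.inr ⟨rfl, rfl⟩⟩)))
      simpa using this)
    (fun hv => by
      have := TourPlan.jump_last_block hP hsm hv
      rwa [hain] at this)
    (fun hv => by
      have := TourPlan.jump_head_block hP hsm hv
      rwa [haout] at this)
  refine ⟨C, hC.trans (List.Perm.of_eq ?_), hcost.trans (le_of_eq ?_)⟩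
  · congr 1
    generalize H.circleVars l = xs
    induction xs with
    | nil => rfl
    | cons x xs ih =>
      rw [List.flatMap_cons, ← ih, List.filter_cons]
      unfold TourPlan.orphanVisit
      split_ifs <;> simp
  · have h1 := pathSum_linkCost (H := H) P l m 1 le_rfl
    rw [add_comm 1 m, ← hm, hprev] at h1
    have h2 : (((H.circleVars l).filter P.orphan).map fun x =>
        passage (P.bit x) (P.port x)).length =
        ((H.circleVars l).map fun x => (P.orphan x).toNat).sum := by
      generalize H.circleVars l = xs
      induction xs with
      | nil => rfl
      | cons x xs ih =>
        rw [List.map_cons, List.sum_cons, ← ih, List.filter_cons]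
        split_ifs with h <;> simp [h, add_comm]
    rw [List.sum_map_add (l := H.circleVars l), h2]
    unfold circleVars
    rw [← h1]

end HybridInstance

namespace HybridInstance

variable {H : HybridInstance}

theorem exists_circles (hH : H.IsBermanKarpinski) {P : TourPlan} (hP : P.Valid H) (k : ℕ)
    (hk : k ≤ H.numCircles) :
    ∃ W : List Label, (W ++ [(8, k, 0)]).head? = some (8, 0, 0) ∧
      (∀ a, (W ++ [(8, k, 0)]).count a =
        ((List.range (k + 1)).map fun l => ((8, l, 0) : Label)).count a +
          (((List.range k).flatMap H.circleVars).map fun x =>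
            (P.block H x).count a + (P.orphanVisit x).count a).sum) ∧
      pathSum (jump H) (W ++ [(8, k, 0)]) ≤ (((List.range k).flatMap H.circleVars).map fun x =>
        (if P.value (H.prevVar x) = P.value x then 0 else 1) + (P.conflict x).toNat +
          (P.orphan x).toNat).sum := by
  induction k with
  | zero => exact ⟨[], by simp [pathSum]⟩
  | succ k ih =>
    obtain ⟨W, h1, h2, h3⟩ := ih (by omega)
    obtain ⟨C, hC, hcost⟩ := exists_circle hH hP (l := k) (by omega)
    refine ⟨W ++ (8, k, 0) :: C, ?_, fun a => ?_, ?_⟩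
    · cases W <;> simpa using h1
    · have h4 := hC.count_eq a
      have h5 := h2 a
      rw [List.count_append, List.count_flatMap, List.count_flatMap] at h4
      rw [List.count_append] at h5
      have e1 : ((List.range (k + 1 + 1)).map fun l => ((8, l, 0) : Label)) =
          ((List.range (k + 1)).map fun l => ((8, l, 0) : Label)) ++ [(8, k + 1, 0)] := by
        rw [List.range_succ, List.map_append]
        rfl
      have e2 : (List.range (k + 1)).flatMap H.circleVars =
          (List.range k).flatMap H.circleVars ++ H.circleVars k := by
        rw [List.range_succ, List.flatMap_append]
        simp
      rw [e1, e2, List.map_append, List.sum_append, List.sum_map_add (l := H.circleVars k),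
        List.append_assoc, List.cons_append, List.count_append, List.count_append,
        List.count_cons, List.count_append]
      simp only [Function.comp_def, List.count_cons, List.count_nil] at h4 h5 ⊢
      omega
    · rw [List.range_succ, List.flatMap_append, List.map_append, List.sum_append,
        List.append_assoc, List.cons_append, pathSum_append_cons]
      simp only [List.flatMap_cons, List.flatMap_nil, List.append_nil]
      omega

/-- The visits of the parity gadgets from the core of an equation. -/
def coreVisits (a₁ a₂ a₃ : Bool) (t : Triple) : List Label :=
  (if a₁ then passage (!t.bit) t.1 else []) ++ ((if a₂ then passage (!t.bit) t.2.1 else []) ++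
    if a₃ then passage (!t.bit) t.2.2.1 else [])

/-- Arcs through gadgets turn round the core in one sense and direct arcs in the other. Two moves in
the same sense visit all three vertices, with two gadgets or none; in the odd cases one jump
replaces a missing arc. -/
theorem exists_core {t : Triple} {g : Label} (hz : (t, g) ∈ H.triples.zip (H.targets.drop 1))
    (a₁ a₂ a₃ : Bool) :
    ∃ K : List Label, K.head? = some (7, t.1) ∧
      (K.Perm ([(7, t.1), (6, t.1), (6, t.2.1), (6, t.2.2.1)] ++ coreVisits a₁ a₂ a₃ t)) ∧
      pathSum (jump H) (K ++ [g]) ≤ (a₁ ^^ (a₂ ^^ a₃)).toNat := by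
  have ha : ∀ {v w}, (v, w) ∈ coreArcs t g → jump H v w = 0 := fun h =>
    jump_eq_zero (mem_arcs.2 (Or.inr (Or.inr (Or.inr ⟨t, g, hz, h⟩))))
  have s1 : jump H (7, t.1) (6, t.1) = 0 := ha (by simp [coreArcs])
  have s2 : jump H (7, t.1) (6, t.2.1) = 0 := ha (by simp [coreArcs])
  have s3 : jump H (7, t.1) (6, t.2.2.1) = 0 := ha (by simp [coreArcs])
  have r1 : jump H (6, t.1) (6, t.2.2.1) = 0 := ha (by simp [coreArcs])
  have r2 : jump H (6, t.2.1) (6, t.1) = 0 := ha (by simp [coreArcs])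
  have r3 : jump H (6, t.2.2.1) (6, t.2.1) = 0 := ha (by simp [coreArcs])
  have u1 : jump H (6, t.1) (pout t.bit t.1) = 0 := ha (by simp [coreArcs])
  have u2 : jump H (6, t.2.1) (pout t.bit t.2.1) = 0 := ha (by simp [coreArcs])
  have u3 : jump H (6, t.2.2.1) (pout t.bit t.2.2.1) = 0 := ha (by simp [coreArcs])
  have w1 : jump H (pin t.bit t.1) (6, t.2.1) = 0 := ha (by simp [coreArcs])
  have w2 : jump H (pin t.bit t.2.1) (6, t.2.2.1) = 0 := ha (by simp [coreArcs])
  have w3 : jump H (pin t.bit t.2.2.1) (6, t.1) = 0 := ha (by simp [coreArcs])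
  have e1 : jump H (6, t.1) g = 0 := ha (by simp [coreArcs])
  have e2 : jump H (6, t.2.1) g = 0 := ha (by simp [coreArcs])
  have e3 : jump H (6, t.2.2.1) g = 0 := ha (by simp [coreArcs])
  have p1 : ∀ x, jump H (pout t.bit x) (4, x) = 0 := by
    intro x; cases t.bit <;> simp [jump, pout, sameGadget, isMid]
  have p2 : ∀ x, jump H (4, x) (pin t.bit x) = 0 := by
    intro x; cases t.bit <;> simp [jump, pin, sameGadget, isMid]
  have p3 : ∀ x, passage (!t.bit) x = [pout t.bit x, (4, x), pin t.bit x] := by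
    intro x; cases t.bit <;> rfl
  have six : ∀ x w, jump H (6, x) w ≤ 1 := fun x w =>
    jump_le_one_left _ (by simp [mem_endLabels]) w
  have last : ∀ x w, jump H (pin t.bit x) w ≤ 1 := fun x w =>
    jump_le_one_left _ (by cases t.bit <;> simp [mem_endLabels, pin]) w
  simp only [coreVisits, p3]
  generalize t.1 = x at *
  generalize t.2.1 = y at *
  generalize t.2.2.1 = z at *
  generalize t.bit = b at *
  cases a₁ <;> cases a₂ <;> cases a₃
  · refine ⟨[(7, x), (6, x), (6, z), (6, y)], rfl, ?_, ?_⟩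
    · exact List.perm_iff_count.2 fun a => by simp [List.count_cons]; omega
    · simp [pathSum, *]
  · refine ⟨[(7, x), (6, y), (6, z), pout b z, (4, z), pin b z, (6, x)], rfl, ?_, ?_⟩
    · exact List.perm_iff_count.2 fun a => by simp [List.count_cons]; omega
    · simp [pathSum, *]
  · refine ⟨[(7, x), (6, x), (6, y), pout b y, (4, y), pin b y, (6, z)], rfl, ?_, ?_⟩
    · exact List.perm_iff_count.2 fun a => by simp [List.count_cons]; omega
    · simp [pathSum, *]
  · refine ⟨[(7, x), (6, y), pout b y, (4, y), pin b y, (6, z), pout b z, (4, z), pin b z, (6, x)],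
      rfl, ?_, ?_⟩
    · exact List.perm_iff_count.2 fun a => by simp [List.count_cons]; omega
    · simp [pathSum, *]
  · refine ⟨[(7, x), (6, z), (6, x), pout b x, (4, x), pin b x, (6, y)], rfl, ?_, ?_⟩
    · exact List.perm_iff_count.2 fun a => by simp [List.count_cons]; omega
    · simp [pathSum, *]
  · refine ⟨[(7, x), (6, z), pout b z, (4, z), pin b z, (6, x), pout b x, (4, x), pin b x, (6, y)],
      rfl, ?_, ?_⟩
    · exact List.perm_iff_count.2 fun a => by simp [List.count_cons]; omega
    · simp [pathSum, *]
  · refine ⟨[(7, x), (6, x), pout b x, (4, x), pin b x, (6, y), pout b y, (4, y), pin b y, (6, z)],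
      rfl, ?_, ?_⟩
    · exact List.perm_iff_count.2 fun a => by simp [List.count_cons]; omega
    · simp [pathSum, *]
  · refine ⟨[(7, x), (6, x), pout b x, (4, x), pin b x, (6, y), pout b y, (4, y), pin b y, (6, z),
      pout b z, (4, z), pin b z], rfl, ?_, ?_⟩
    · exact List.perm_iff_count.2 fun a => by simp [List.count_cons]; omega
    · simp [pathSum, *]

/-- The hypothesis says that the links between consecutive cores of `ts` are those of the instance;
in this form it passes to the tail in the induction. -/
theorem exists_cores (a₁ a₂ a₃ : Triple → Bool) (ts : List Triple)
    (hz : ∀ p ∈ ts.zip (((ts.map fun t : Triple => ((7, t.1) : Label)) ++ [(8, 0, 0)]).drop 1),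
      p ∈ H.triples.zip (H.targets.drop 1)) :
    ∃ D : List Label,
      (D ++ [(8, 0, 0)]).head? = ((ts.map fun t : Triple => ((7, t.1) : Label)) ++ [(8, 0, 0)]).head? ∧
      D.Perm (ts.flatMap fun t : Triple => [(7, t.1), (6, t.1), (6, t.2.1), (6, t.2.2.1)] ++
        coreVisits (a₁ t) (a₂ t) (a₃ t) t) ∧
      pathSum (jump H) (D ++ [(8, 0, 0)]) ≤
        (ts.map fun t : Triple => (a₁ t ^^ (a₂ t ^^ a₃ t)).toNat).sum := by
  induction ts with
  | nil => exact ⟨[], by simp [pathSum]⟩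
  | cons t ts ih =>
    simp only [List.map_cons, List.cons_append, List.drop_succ_cons, List.drop_zero] at hz ih ⊢
    cases hT : (ts.map fun t : Triple => ((7, t.1) : Label)) ++ [(8, 0, 0)] with
    | nil => simp at hT
    | cons g T =>
      rw [hT] at hz ih
      obtain ⟨D, h1, h2, h3⟩ := ih fun p hp => hz p (by
        rw [List.zip_cons_cons]; exact List.mem_cons_of_mem _ (by simpa using hp))
      obtain ⟨K, k1, k2, k3⟩ := exists_core (hz (t, g) (by simp)) (a₁ t) (a₂ t) (a₃ t)
      obtain ⟨E, hE⟩ : ∃ E, D ++ [(8, 0, 0)] = g :: E := by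
        cases hD : D ++ [(8, 0, 0)] with
        | nil => simp at hD
        | cons g' E => rw [hD] at h1; simp at h1; exact ⟨E, by rw [h1]⟩
      have hK : K ≠ [] := by rintro rfl; simp at k1
      refine ⟨K ++ D, ?_, ?_, ?_⟩
      · rw [List.append_assoc, List.head?_append_of_ne_nil _ hK, k1]
        rfl
      · rw [List.flatMap_cons]
        exact k2.append h2
      · rw [List.append_assoc, hE, pathSum_append_cons, ← hE, List.sum_cons]
        exact Nat.add_le_add k3 h3

end HybridInstance

namespace HybridInstance

variable {H : HybridInstance}

/-- The plan is read off the equations. -/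
structure _root_.HybridATSP.TourPlan.Fits (P : TourPlan) (H : HybridInstance) : Prop where
  valid : P.Valid H
  matching_fst : ∀ e ∈ H.matching, P.bit e.1 = true ∧ P.port e.1 = e.1 ∧ P.mate e.1 = e.2
  matching_snd : ∀ e ∈ H.matching, P.bit e.2 = false ∧ P.port e.2 = e.1 ∧ P.mate e.2 = e.2
  triple : ∀ t : Triple, t ∈ H.triples → ∀ x ∈ t.vars,
    P.bit x = t.bit ∧ P.port x = x ∧ P.mate x = x

/-- A variable that is not the first one of a matching equation becomes its own `mate`, so that it
has neither a conflict nor an orphan. -/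
theorem exists_plan (hH : H.IsBermanKarpinski) (f : Var → Bool) :
    ∃ P : TourPlan, P.Fits H ∧ P.value = f := by
  have h : ∀ x : Var, ∃ b p m, x ∈ H.vars → (x, b, p) ∈ H.incidences ∧
      ((∃ e ∈ H.matching, x = e.1 ∧ m = e.2) ∨ ((∀ e ∈ H.matching, x ≠ e.1) ∧ m = x)) := by
    intro x
    by_cases hx : x ∈ H.vars
    · obtain ⟨b, p, hj⟩ := hH.exists_incidence hx
      by_cases he : ∃ e ∈ H.matching, x = e.1
      · obtain ⟨e, he, h⟩ := he
        exact ⟨b, p, e.2, fun _ => ⟨hj, Or.inl ⟨e, he, h, rfl⟩⟩⟩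
      · push Not at he
        exact ⟨b, p, x, fun _ => ⟨hj, Or.inr ⟨he, rfl⟩⟩⟩
    · exact ⟨true, x, x, fun h => (hx h).elim⟩
  choose b p m hbpm using h
  have hinc : ∀ x ∈ H.vars, ∀ {b' p'}, (x, b', p') ∈ H.incidences → b x = b' ∧ p x = p' := by
    intro x hx b' p' hj
    have := hH.incidence_fst_inj (hbpm x hx).1 hj rfl
    simpa using this
  have m1 : ∀ e ∈ H.matching, e.1 ∈ H.vars ∧ e.2 ∈ H.vars := fun e he =>
    ⟨hH.mem_vars_of_matching he (by simp), hH.mem_vars_of_matching he (by simp)⟩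
  refine ⟨⟨f, b, p, m⟩, ⟨⟨fun x hx => (hbpm x hx).1, fun x hx => ?_, fun x hx => ?_⟩,
    fun e he => ?_, fun e he => ?_, fun t ht x hx => ?_⟩, rfl⟩
  · show m x ∈ H.vars
    rcases (hbpm x hx).2 with ⟨e, he, _, h⟩ | ⟨_, h⟩
    · rw [h]; exact (m1 e he).2
    · rw [h]; exact hx
  · show (m x).1 = x.1
    rcases (hbpm x hx).2 with ⟨e, he, h', h⟩ | ⟨_, h⟩
    · rw [h, h']; exact (hH.matching_circle e he).symm
    · rw [h]
  · obtain ⟨h1, h2⟩ := hinc _ (m1 e he).1 (mem_incidences.2 (Or.inl ⟨e, he, Or.inl rfl⟩))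
    refine ⟨h1, h2, ?_⟩
    rcases (hbpm _ (m1 e he).1).2 with ⟨e', he', h', h⟩ | ⟨h', _⟩
    · have := hH.matching_unique he he' (x := e.1) (by simp) (by simp [h'])
      subst this
      exact h
    · exact (h' e he rfl).elim
  · obtain ⟨h1, h2⟩ := hinc _ (m1 e he).2 (mem_incidences.2 (Or.inl ⟨e, he, Or.inr rfl⟩))
    refine ⟨h1, h2, ?_⟩
    rcases (hbpm _ (m1 e he).2).2 with ⟨e', he', h', h⟩ | ⟨_, h⟩
    · have := hH.matching_unique he he' (x := e.2) (by simp) (by simp [h'])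
      subst this
      exact (hH.matching_ne he h'.symm).elim
    · exact h
  · have hv := hH.mem_vars_of_triple ht hx
    obtain ⟨h1, h2⟩ := hinc _ hv (mem_incidences.2 (Or.inr ⟨t, ht, x, hx, rfl⟩))
    refine ⟨h1, h2, ?_⟩
    rcases (hbpm _ hv).2 with ⟨e', he', h', h⟩ | ⟨_, h⟩
    · exact (hH.matching_triple_disjoint he' ht (x := x) (by simp [h']) hx).elim
    · exact h

theorem count_passage (a : Label) (b : Bool) (p : Var) :
    (passage b p).count a = (path 3 p).count a := by
  cases b <;> simp [passage, path, pin, pout, List.count_cons]; omega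

theorem count_block (P : TourPlan) (a : Label) (x : Var) :
    (P.block H x).count a = (path 0 (H.prevVar x)).count a + (P.extra x).count a := by
  unfold TourPlan.block
  split_ifs
  · rw [List.count_append]
  · rw [List.count_append, List.count_reverse, add_comm]

theorem exists_tour (hH : H.IsBermanKarpinski) (φ : Var → ZMod 2) :
    ∃ τ : List Label, τ.Perm H.labels ∧ ∃ v, τ.head? = some v ∧
      pathSum (jump H) (τ ++ [v]) ≤ H.numUnsat φ := by
  obtain ⟨P, hP, hf⟩ := exists_plan hH fun x => decide (φ x = 1)
  have hv : ∀ x, P.value x = decide (φ x = 1) := fun x => by rw [hf]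
  obtain ⟨W, w1, w2, w3⟩ := exists_circles hH hP.valid H.numCircles le_rfl
  obtain ⟨D, d1, d2, d3⟩ := exists_cores (H := H) (fun t => P.value t.1 ^^ t.bit)
    (fun t => P.value t.2.1 ^^ t.bit) (fun t => P.value t.2.2.1 ^^ t.bit) H.triples
    (fun p hp => hp)
  have hvars : (List.range H.numCircles).flatMap H.circleVars = H.vars := rfl
  rw [hvars] at w2 w3
  have mt : ∀ t : Triple, t.1 ∈ t.vars ∧ t.2.1 ∈ t.vars ∧ t.2.2.1 ∈ t.vars := by
    simp [Triple.vars]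
  refine ⟨(W ++ [(8, H.numCircles, 0)]) ++ D, List.perm_iff_count.2 fun a => ?_, (8, 0, 0), ?_, ?_⟩
  · rw [List.count_append, w2, d2.count_eq]
    have h0 : (H.vars.map fun x => (P.block H x).count a + (P.orphanVisit x).count a).sum =
        (H.vars.map fun x => (path 0 x).count a).sum +
        (H.vars.map fun x => (P.extra x).count a + (P.orphanVisit x).count a).sum := by
      rw [← hH.sum_prevVar fun x => (path 0 x).count a, ← List.sum_map_add]
      exact congrArg List.sum (List.map_congr_left fun x _ => by rw [count_block]; ring)
    rw [hH.sum_vars fun x => (P.extra x).count a + (P.orphanVisit x).count a] at h0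
    unfold labels pnames
    rw [List.count_append, List.count_append, List.count_append, List.count_flatMap,
      List.count_flatMap, List.count_flatMap, List.count_flatMap, List.map_append, List.sum_append,
      List.map_map, List.sum_map_flatMap]
    -- For all four pairs of values the parity gadget is visited exactly once: by the first
    -- variable, by the second one, or as an orphan.
    have h1 : (H.matching.map fun e => (P.extra e.1).count a + (P.orphanVisit e.1).count a +
        ((P.extra e.2).count a + (P.orphanVisit e.2).count a)) =
        H.matching.map fun e => (path 3 e.1).count a := by
      refine List.map_congr_left fun e he => ?_
      obtain ⟨b1, p1, m1⟩ := hP.matching_fst e he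
      obtain ⟨b2, p2, m2⟩ := hP.matching_snd e he
      unfold TourPlan.extra TourPlan.orphanVisit TourPlan.takes TourPlan.orphan
      rw [b1, p1, m1, b2, p2, m2]
      cases P.value e.1 <;> cases P.value e.2 <;> simp [count_passage]
    have h2 : (H.triples.map fun t => (P.extra t.1).count a + (P.orphanVisit t.1).count a +
        ((P.extra t.2.1).count a + (P.orphanVisit t.2.1).count a +
          ((P.extra t.2.2.1).count a + (P.orphanVisit t.2.2.1).count a))).sum +
        (H.triples.map fun t : Triple => ([(7, t.1), (6, t.1), (6, t.2.1), (6, t.2.2.1)] ++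
          coreVisits (P.value t.1 ^^ t.bit) (P.value t.2.1 ^^ t.bit) (P.value t.2.2.1 ^^ t.bit)
            t).count a).sum =
        (H.triples.map fun t => ([t.1, t.2.1, t.2.2.1].map fun x => (path 3 x).count a).sum).sum +
        (H.triples.map fun t =>
          [((7, t.1) : Label), (6, t.1), (6, t.2.1), (6, t.2.2.1)].count a).sum := by
      rw [← List.sum_map_add, ← List.sum_map_add]
      refine congrArg List.sum (List.map_congr_left fun t ht => ?_)
      -- The circle visits the gadget when the value equals `bit`, the core when it does not.
      have key : ∀ x ∈ Triple.vars t, (P.extra x).count a + (P.orphanVisit x).count a +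
          (if P.value x ^^ Triple.bit t then passage (!Triple.bit t) x else []).count a =
          (path 3 x).count a := by
        intro x hx
        obtain ⟨b1, p1, m1⟩ := hP.triple t ht x hx
        unfold TourPlan.extra TourPlan.orphanVisit TourPlan.takes TourPlan.orphan
        rw [b1, p1, m1]
        cases P.value x <;> cases Triple.bit t <;> simp [count_passage]
      have k1 := key _ (mt t).1
      have k2 := key _ (mt t).2.1
      have k3 := key _ (mt t).2.2
      unfold coreVisits
      rw [List.count_append, List.count_append, List.count_append]
      simp only [List.map_cons, List.map_nil, List.sum_cons, List.sum_nil]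
      omega
    rw [h1] at h0
    simp only [Function.comp_def] at h0 h2 ⊢
    omega
  · rw [List.head?_append_of_ne_nil _ (by simp)]
    exact w1
  · have h1 : pathSum (jump H) ((W ++ [(8, H.numCircles, 0)]) ++ D ++ [(8, 0, 0)]) ≤
        pathSum (jump H) (W ++ [(8, H.numCircles, 0)]) + 0 +
          pathSum (jump H) (D ++ [(8, 0, 0)]) := by
      rw [List.append_assoc]
      refine pathSum_append_le fun v hv w hw => ?_
      rw [d1] at hw
      have e1 : v = (8, H.numCircles, 0) := by simpa [eq_comm] using hv
      have e2 : w = H.targets.getD 0 (8, 0, 0) := by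
        change w ∈ H.targets.head? at hw
        cases hT : H.targets with
        | nil => rw [hT] at hw; simp at hw
        | cons g T => rw [hT] at hw; simpa [eq_comm] using hw
      exact (jump_eq_zero (mem_arcs.2 (Or.inr (Or.inr (Or.inl ⟨e1, e2⟩))))).le
    refine h1.trans ?_
    rw [hH.numUnsat_eq]
    have h2 : (H.vars.map fun x => if P.value (H.prevVar x) = P.value x then 0 else 1).sum ≤
        (H.vars.map fun x => if φ (H.prevVar x) = φ x then 0 else 1).sum := by
      refine List.sum_le_sum fun x _ => ?_
      rw [hv, hv]
      split_ifs with h3 h4 h4 <;> simp_all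
    have h3 : (H.vars.map fun x => (P.conflict x).toNat + (P.orphan x).toNat).sum ≤
        (H.matching.map fun e => if φ e.1 = φ e.2 then 0 else 1).sum := by
      rw [hH.sum_vars]
      have : (H.triples.map fun t => (P.conflict t.1).toNat + (P.orphan t.1).toNat +
          ((P.conflict t.2.1).toNat + (P.orphan t.2.1).toNat +
            ((P.conflict t.2.2.1).toNat + (P.orphan t.2.2.1).toNat))).sum = 0 := by
        rw [List.sum_eq_zero]
        intro i hi
        obtain ⟨t, ht, rfl⟩ := List.mem_map.1 hi
        have key : ∀ x ∈ Triple.vars t, P.conflict x = false ∧ P.orphan x = false := by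
          intro x hx
          obtain ⟨b1, p1, m1⟩ := hP.triple t ht x hx
          unfold TourPlan.conflict TourPlan.orphan
          rw [m1]
          cases P.value x <;> simp
        have k1 := key _ (mt t).1
        have k2 := key _ (mt t).2.1
        have k3 := key _ (mt t).2.2
        simp [k1, k2, k3]
      rw [this, add_zero]
      refine List.sum_le_sum fun e he => ?_
      obtain ⟨b1, p1, m1⟩ := hP.matching_fst e he
      obtain ⟨b2, p2, m2⟩ := hP.matching_snd e he
      unfold TourPlan.conflict TourPlan.orphan
      rw [b1, m1, b2, m2, hv, hv]
      have : ∀ a b : ZMod 2, (true && (decide (a = 1) && !decide (b = 1))).toNat +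
          (true && (!decide (a = 1) && decide (b = 1))).toNat +
          ((false && (decide (b = 1) && !decide (b = 1))).toNat +
          (false && (!decide (b = 1) && decide (b = 1))).toNat) ≤ if a = b then 0 else 1 := by
        decide
      exact this _ _
    have h4 : (H.triples.map fun t : Triple => ((P.value t.1 ^^ t.bit) ^^ ((P.value t.2.1 ^^ t.bit) ^^
        (P.value t.2.2.1 ^^ t.bit))).toNat).sum ≤
        (H.triples.map fun t => if φ t.1 + (φ t.2.1 + φ t.2.2.1) = t.2.2.2 then 0 else 1).sum := by
      refine List.sum_le_sum fun t _ => ?_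
      rw [hv, hv, hv]
      have : ∀ a b c d : ZMod 2, ((decide (a = 1) ^^ decide (d.val = 1)) ^^
          ((decide (b = 1) ^^ decide (d.val = 1)) ^^ (decide (c = 1) ^^ decide (d.val = 1)))).toNat ≤
          if a + (b + c) = d then 0 else 1 := by
        decide
      exact this _ _ _ _
    have h5 : (H.vars.map fun x => (if P.value (H.prevVar x) = P.value x then 0 else 1) +
        (P.conflict x).toNat + (P.orphan x).toNat).sum =
        (H.vars.map fun x => if P.value (H.prevVar x) = P.value x then 0 else 1).sum +
        (H.vars.map fun x => (P.conflict x).toNat + (P.orphan x).toNat).sum := by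
      rw [← List.sum_map_add]
      exact congrArg List.sum (List.map_congr_left fun x _ => by ring)
    omega

end HybridInstance

/-! ### Tours of the two instances, and the metric axioms -/

theorem sum_zipWith_eq_pathSum {α : Type*} (e : α → α → ℕ) (w : α) (l : List α) (v : α) :
    (List.zipWith e (v :: l) (l ++ [w])).sum = pathSum e (v :: l ++ [w]) := by
  induction l generalizing v with
  | nil => simp [pathSum]
  | cons a l ih =>
    have := ih a
    simp only [List.cons_append, List.zipWith_cons_cons, List.sum_cons, pathSum] at this ⊢
    rw [this]

theorem isMid_bne_of_sameGadget {v w : Label} (h : sameGadget v w = true) (hvw : v ≠ w)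
    (hm : (isMid v || isMid w) = true) : (isMid v ^^ isMid w) = true := by
  obtain ⟨i, x⟩ := v
  obtain ⟨j, y⟩ := w
  simp only [sameGadget, isMid, Bool.and_eq_true, Bool.or_eq_true, decide_eq_true_eq] at h hm
  obtain ⟨rfl, h⟩ := h
  have hij : i ≠ j := fun e => hvw (by rw [e])
  rw [bne_iff_ne, Ne, Bool.eq_iff_iff]
  simp only [isMid, Bool.or_eq_true, decide_eq_true_eq]
  omega

theorem sameGadget_trans {u v w : Label} (h1 : sameGadget u v = true)
    (h2 : sameGadget v w = true) : sameGadget u w = true := by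
  simp only [sameGadget, Bool.and_eq_true, Bool.or_eq_true, decide_eq_true_eq] at h1 h2 ⊢
  refine ⟨h1.1.trans h2.1, ?_⟩
  omega

namespace HybridInstance

variable {H : HybridInstance}

/-- `jump` is used as an auxiliary distance. Being a tour depends on the number of vertices only, so
the same `σ` serves for `dist₂` and `dist₄`. -/
theorem exists_isTour (hH : H.IsBermanKarpinski) (φ : Var → ZMod 2) :
    ∃ σ : List ℕ, (H.toATSP (jump H)).IsTour σ ∧
      (H.toATSP (jump H)).tourLength σ ≤ H.numUnsat φ := by
  obtain ⟨τ, h1, v, h2, h3⟩ := exists_tour hH φ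
  have hget : ∀ a ∈ H.labels, H.labels.getD (H.labels.idxOf a) (0, 0, 0) = a := fun a ha => by
    rw [List.getD_eq_getElem _ _ (List.idxOf_lt_length_iff.2 ha), List.getElem_idxOf]
  have hτ : H.tourLabels (τ.map H.labels.idxOf) = τ := by
    unfold tourLabels
    rw [List.map_map]
    exact (List.map_congr_left fun a ha => hget a (h1.subset ha)).trans (List.map_id τ)
  refine ⟨τ.map H.labels.idxOf, ?_, ?_⟩
  · refine (h1.map _).trans (List.Perm.of_eq ?_)
    apply List.ext_getElem
    · simp [toATSP]
    · intro i h4 h5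
      rw [List.getElem_map, hH.nodup_labels.idxOf_getElem, List.getElem_range]
  · refine le_trans (le_of_eq ?_) h3
    unfold ATSPInstance.tourLength
    have e : List.zipWith (H.toATSP (jump H)).dist (τ.map H.labels.idxOf)
        ((τ.map H.labels.idxOf).rotate 1) = List.zipWith (jump H) τ (τ.rotate 1) := by
      conv_rhs => rw [← hτ, tourLabels, ← List.map_rotate, List.zipWith_map]
      rfl
    rw [e]
    cases τ with
    | nil => simp at h2
    | cons a l =>
      obtain rfl : a = v := by simpa using h2
      rw [List.rotate_cons_succ, List.rotate_zero]
      exact sum_zipWith_eq_pathSum _ _ _ _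

theorem dist₂_le (v w : Label) : H.dist₂ v w ≤ 1 + jump H v w := by
  unfold dist₂ jump
  split_ifs <;> omega

/-- A path edge is one unit shorter than other short arcs and has exactly one middle end, which
makes up for it. For two middle vertices of different gadgets the left side is 6; hence the weight 2
in `jump`. -/
theorem dist₄_le (hH : H.IsBermanKarpinski) (v w : Label) :
    H.dist₄ v w + (isMid v).toNat + (isMid w).toNat ≤ 2 + 2 * jump H v w := by
  unfold dist₄ jump
  by_cases ha : (v, w) ∈ H.arcs
  · obtain ⟨h1, h2⟩ := isMid_of_arc ha
    simp only [h1, h2, hH.sameGadget_of_arc ha, ha]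
    split_ifs <;> simp_all
  · by_cases hvw : v = w
    · subst hvw
      cases h1 : isMid v <;> simp [ha, sameGadget]
    · have h2 := fun h => isMid_bne_of_sameGadget (v := v) (w := w) h hvw
      cases hs : sameGadget v w <;> cases hv : isMid v <;> cases hw : isMid w <;>
        simp_all

theorem exists_isTour₂ (hH : H.IsBermanKarpinski) (φ : Var → ZMod 2) :
    ∃ σ : List ℕ, (H.toATSP H.dist₂).IsTour σ ∧
      (H.toATSP H.dist₂).tourLength σ ≤
        3 * H.m₂ + 13 * H.m₃ + H.numCircles + 1 + H.numUnsat φ := by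
  obtain ⟨σ, h1, h2⟩ := exists_isTour hH φ
  have h3 : (H.toATSP H.dist₂).IsTour σ := h1
  refine ⟨σ, h3, ?_⟩
  rw [tourLength_eq hH h1] at h2
  rw [tourLength_eq hH h3, ← hH.length_labels]
  refine (List.sum_le_sum fun v _ => dist₂_le v _).trans ?_
  rw [List.sum_map_add, List.map_const', List.sum_replicate, smul_eq_mul, mul_one]
  omega

theorem exists_isTour₄ (hH : H.IsBermanKarpinski) (φ : Var → ZMod 2) :
    ∃ σ : List ℕ, (H.toATSP H.dist₄).IsTour σ ∧
      (H.toATSP H.dist₄).tourLength σ ≤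
        4 * H.m₂ + 20 * H.m₃ + 2 * H.numCircles + 2 + 2 * H.numUnsat φ := by
  obtain ⟨σ, h1, h2⟩ := exists_isTour hH φ
  have h3 : (H.toATSP H.dist₄).IsTour σ := h1
  refine ⟨σ, h3, ?_⟩
  rw [tourLength_eq hH h1] at h2
  rw [tourLength_eq hH h3]
  have hp := tourLabels_perm h1
  have hπ := isTourPerm_formPerm hp (hp.nodup_iff.2 hH.nodup_labels)
  have h4 := sum_isMid hH
  have h5 : (H.labels.map fun v => (isMid ((H.tourLabels σ).formPerm v)).toNat).sum =
      H.m₂ + 3 * H.m₃ := by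
    rw [← h4, ← ((hπ.perm hH).map fun v => (isMid v).toNat).sum_eq, List.map_map]
    rfl
  have h6 := List.sum_le_sum fun v (_ : v ∈ H.labels) =>
    dist₄_le hH v ((H.tourLabels σ).formPerm v)
  rw [List.sum_map_add, List.sum_map_add, List.sum_map_add, List.map_const', List.sum_replicate,
    List.sum_map_mul_left, smul_eq_mul, hH.length_labels] at h6
  omega

theorem isOneB_toATSP (hH : H.IsBermanKarpinski) {d : Label → Label → ℕ} {B : ℕ}
    (h0 : ∀ v, d v v = 0) (h1 : ∀ v w, v ≠ w → 1 ≤ d v w) (hB : ∀ v w, d v w ≤ B)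
    (ht : ∀ u v w, d u w ≤ d u v + d v w) : (H.toATSP d).IsOneB B where
  dist_self _ _ := h0 _
  one_le v hv w hw h := by
    refine h1 _ _ fun e => h ?_
    have hv : v < H.labels.length := hv
    have hw : w < H.labels.length := hw
    rw [List.getD_eq_getElem _ _ hv, List.getD_eq_getElem _ _ hw] at e
    exact hH.nodup_labels.getElem_inj_iff.1 e
  le_bound _ _ _ _ _ := hB _ _
  triangle _ _ _ _ _ _ := ht _ _ _

theorem isOneB_dist₂ (hH : H.IsBermanKarpinski) : (H.toATSP H.dist₂).IsOneB 2 := by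
  have h0 : ∀ v, H.dist₂ v v = 0 := fun v => by simp [dist₂]
  have h1 : ∀ v w, v ≠ w → 1 ≤ H.dist₂ v w := fun v w h => by
    unfold dist₂
    rw [if_neg (by simpa using h)]
    split_ifs <;> omega
  have hB : ∀ v w, H.dist₂ v w ≤ 2 := fun v w => by
    unfold dist₂
    split_ifs <;> omega
  refine isOneB_toATSP hH h0 h1 hB fun u v w => ?_
  by_cases huv : u = v
  · subst huv; omega
  by_cases hvw : v = w
  · subst hvw; omega
  have := h1 u v huv
  have := h1 v w hvw
  have := hB u w
  omega

theorem isOneB_dist₄ (hH : H.IsBermanKarpinski) : (H.toATSP H.dist₄).IsOneB 4 := by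
  have h0 : ∀ v, H.dist₄ v v = 0 := fun v => by simp [dist₄]
  have h1 : ∀ v w, v ≠ w → 1 ≤ H.dist₄ v w := fun v w h => by
    unfold dist₄
    rw [if_neg (by simpa using h)]
    split_ifs <;> omega
  have hB : ∀ v w, H.dist₄ v w ≤ 4 := fun v w => by
    unfold dist₄
    split_ifs <;> omega
  have heq1 : ∀ v w, v ≠ w → H.dist₄ v w ≤ 1 →
      sameGadget v w = true ∧ (isMid v ^^ isMid w) = true := fun v w hvw h => by
    unfold dist₄ at h
    rw [if_neg (by simpa using hvw)] at h
    split_ifs at h with hs hm <;> try omega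
    exact ⟨hs, isMid_bne_of_sameGadget hs hvw hm⟩
  have hle2 : ∀ v w, v ≠ w → H.dist₄ v w ≤ 2 →
      sameGadget v w = true ∨ (isMid v = false ∧ isMid w = false) := fun v w hvw h => by
    unfold dist₄ at h
    rw [if_neg (by simpa using hvw)] at h
    split_ifs at h with hs hm ha <;> try omega
    · exact Or.inl hs
    · exact Or.inl hs
    · exact Or.inr (isMid_of_arc (by simpa using ha))
  have hs2 : ∀ v w, sameGadget v w = true → H.dist₄ v w ≤ 2 := fun v w h => by
    unfold dist₄
    rw [if_pos h]
    split_ifs <;> omega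
  have hm3 : ∀ v w, (isMid v ^^ isMid w) = true → H.dist₄ v w ≤ 3 := fun v w h => by
    unfold dist₄
    split_ifs <;> omega
  refine isOneB_toATSP hH h0 h1 hB fun u v w => ?_
  by_cases huv : u = v
  · subst huv; omega
  by_cases hvw : v = w
  · subst hvw; omega
  have a1 := h1 u v huv
  have a2 := h1 v w hvw
  have a3 := hB u w
  by_contra! hlt
  rcases Nat.lt_or_ge 1 (H.dist₄ u v) with h | h
  -- A violated inequality has total at most 3 on the right, so one side is a path edge. If the
  -- other side has length 2, either all three vertices are in one gadget, or exactly one of `u` and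
  -- `w` is a middle vertex and their distance is at most 3.
  · obtain ⟨g1, g2⟩ := heq1 v w hvw (by omega)
    rcases hle2 u v huv (by omega) with h' | ⟨e1, e2⟩
    · have := hs2 u w (sameGadget_trans h' g1)
      omega
    · have := hm3 u w (by rw [e2] at g2; rw [e1]; exact g2)
      omega
  · obtain ⟨g1, g2⟩ := heq1 u v huv h
    rcases hle2 v w hvw (by omega) with h' | ⟨e1, e2⟩
    · have := hs2 u w (sameGadget_trans g1 h')
      omega
    · have := hm3 u w (by rw [e1] at g2; rw [e2]; exact g2)
      rcases Nat.lt_or_ge 1 (H.dist₄ v w) with h'' | h''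
      · omega
      · have := (heq1 v w hvw h'').2
        simp [e1, e2] at this

end HybridInstance

end HybridATSP

theorem mainTheorem1 :
    (∃ D : HybridInstance → ATSPInstance,
      PolyTimeOn {H | H.IsBermanKarpinski} D ∧
      (∀ H : HybridInstance, H.IsBermanKarpinski → (D H).IsOneB 2) ∧
      (∀ H : HybridInstance, H.IsBermanKarpinski → ∀ (φ : Var → ZMod 2) (u : ℕ),
        H.numUnsat φ ≤ u →
        ∃ σ : List ℕ, (D H).IsTour σ ∧
          (D H).tourLength σ ≤ 3 * H.m₂ + 13 * H.m₃ + H.numCircles + 1 + u) ∧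
      (∃ ψ : HybridInstance × List ℕ → List Var,
        PolyTimeOn {p | p.1.IsBermanKarpinski ∧ (D p.1).IsTour p.2} ψ ∧
        ∀ H : HybridInstance, H.IsBermanKarpinski → ∀ σ : List ℕ, (D H).IsTour σ → ∀ u : ℝ,
          ((D H).tourLength σ : ℝ) = 3 * H.m₂ + 13 * H.m₃ + H.numCircles + 1 + u →
          (H.numUnsat (assignmentOf (ψ (H, σ))) : ℝ) ≤ u)) ∧
    (∃ D : HybridInstance → ATSPInstance,
      PolyTimeOn {H | H.IsBermanKarpinski} D ∧
      (∀ H : HybridInstance, H.IsBermanKarpinski → (D H).IsOneB 4) ∧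
      (∀ H : HybridInstance, H.IsBermanKarpinski → ∀ (φ : Var → ZMod 2) (u : ℕ),
        H.numUnsat φ ≤ u →
        ∃ σ : List ℕ, (D H).IsTour σ ∧
          (D H).tourLength σ ≤ 4 * H.m₂ + 20 * H.m₃ + 2 * H.numCircles + 2 + 2 * u) ∧
      (∃ ψ : HybridInstance × List ℕ → List Var,
        PolyTimeOn {p | p.1.IsBermanKarpinski ∧ (D p.1).IsTour p.2} ψ ∧
        ∀ H : HybridInstance, H.IsBermanKarpinski → ∀ σ : List ℕ, (D H).IsTour σ → ∀ u : ℝ,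
          ((D H).tourLength σ : ℝ) = 4 * H.m₂ + 20 * H.m₃ + 2 * H.numCircles + 2 + 2 * u →
          (H.numUnsat (assignmentOf (ψ (H, σ))) : ℝ) ≤ u)) := by
  have hψ : PT fun p : HybridInstance × List ℕ => p.1.decode (p.1.usedArcs p.2) :=
    PT.decode (PT.usedArcs (PT.fst PT.id) (PT.snd PT.id)) (PT.fst PT.id)
  refine ⟨⟨fun H => H.toATSP H.dist₂, PT.polyTimeOn (PT.toATSP (d := fun H => H.dist₂)
      (PT.dist₂ (PT.fst (PT.fst PT.id)) (PT.snd (PT.fst PT.id)) (PT.snd PT.id))) _,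
      fun H hH => HybridInstance.isOneB_dist₂ hH, fun H hH φ u hu => ?_, _, hψ.polyTimeOn _,
      fun H hH σ hσ u hu => ?_⟩,
    ⟨fun H => H.toATSP H.dist₄, PT.polyTimeOn (PT.toATSP (d := fun H => H.dist₄)
      (PT.dist₄ (PT.fst (PT.fst PT.id)) (PT.snd (PT.fst PT.id)) (PT.snd PT.id))) _,
      fun H hH => HybridInstance.isOneB_dist₄ hH, fun H hH φ u hu => ?_, _, hψ.polyTimeOn _,
      fun H hH σ hσ u hu => ?_⟩⟩
  · obtain ⟨σ, h1, h2⟩ := HybridInstance.exists_isTour₂ hH φ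
    exact ⟨σ, h1, h2.trans (by omega)⟩
  · have h : (_ : ℝ) ≤ _ := Nat.cast_le.2 (HybridInstance.le_tourLength₂ hH hσ rfl)
    push_cast at h
    linarith
  · obtain ⟨σ, h1, h2⟩ := HybridInstance.exists_isTour₄ hH φ
    exact ⟨σ, h1, h2.trans (by omega)⟩
  · have h : (_ : ℝ) ≤ _ := Nat.cast_le.2 (HybridInstance.le_tourLength₄ hH hσ rfl)
    push_cast at h
    linarith
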